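/- Let $d\in\{1,2,3\}$, let $\Omega\subset\mathbb{R}^d$ be a (bounded) convex polyhedral domain, and let $T>0$, $\alpha\in(0,1)$, $0<c_0<c_1<\infty$ and $\gamma>0$. Let $$\mathcal{A}=\{q\in L^\infty(\Omega\times(0,T)):\ c_0\le q\le c_1\ \text{a.e. in }\Omega\times(0,T)\},$$ and let $u_0\in L^2(\Omega)$, $f\in L^2(0,T;H^{-1}(\Omega))$ and $z^\delta\in L^2(0,T;L^2(\Omega))$. For $q\in\mathcal{A}$, a weak solution of the subdiffusion problem $$\partial_t^\alpha u-\nabla\cdot(q\nabla u)=f\ \text{ in }\Omega\times(0,T],\qquad u=0\ \text{ on }\partial\Omega\times(0,T],\qquad u(0)=u_0,$$ is a function $u\in L^2(0,T;H_0^1(\Omega))$ such that ${}_0I_t^{1-\alpha}(u-u_0)\in{}_0H^1(0,T;H^{-1}(\Omega))$ and, with $\partial_t^\alpha u:=\frac{\mathrm d}{\mathrm dt}\,{}_0I_t^{1-\alpha}(u-u_0)\in L^2(0,T;H^{-1}(\Omega))$, for almost every $t\in(0,T)$, $$(\partial_t^\alpha u(t),\phi)+(q(t)\nabla u(t),\nabla\phi)=(f(t),\phi)\qquad\text{for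 all }\phi\in H_0^1(\Omega).$$ Here ${}_0I_t^{\beta}w(t)=\frac1{\Gamma(\beta)}\int_0^t(t-s)^{\beta-1}w(s)\,\mathrm ds$ is the Riemann--Liouville fractional integral, and ${}_0H^1(0,T;X)$ is the space of functions in $H^1(0,T;X)$ that vanish at $t=0$. Then for every $q\in\mathcal{A}$ there is exactly one weak solution $u(q)$, and the functional $$J_\gamma(q;z^\delta)=\tfrac12\|u(q)-z^\delta\|_{L^2(0,T;L^2(\Omega))}^2+\tfrac\gamma2\|\nabla_{x,t}q\|_{L^2(0,T;L^2(\Omega))}^2,$$ where $\nabla_{x,t}$ is the weak space-time gradient and the second term is $+\infty$ if $q\notin H^1(\Omega\times(0,T))$, has at least one minimizer over $\mathcal{A}$: there is $q^*\in\mathcal{A}$ with $J_\gamma(q^*;z^\delta)<\infty$ and $J_\gamma(q^*;z^\delta)\le J_\gamma(q;z^\delta)$ for all $q\in\mathcal{A}$. -/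

import Mathlib

open MeasureTheory Set
open scoped ENNReal ContDiff

noncomputable section

namespace Subdiffusion

/-- The Euclidean space `ℝ^d`. -/
abbrev Space (d : ℕ) : Type := EuclideanSpace ℝ (Fin d)

/-- A bounded convex polyhedral domain: the nonempty interior of the convex hull of finitely many
points. -/
def IsConvexPolyhedralDomain {d : ℕ} (Ω : Set (Space d)) : Prop :=
  Ω.Nonempty ∧ ∃ S : Finset (Space d), Ω = interior (convexHull ℝ (S : Set (Space d)))

/-- `φ` is a test function on `U`: smooth, with compact support contained in `U`. -/
def IsTestFunction {E : Type*} [NormedAddCommGroup E] [NormedSpace ℝ E] (U : Set E) (φ : E → ℝ) :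
    Prop :=
  ContDiff ℝ ∞ φ ∧ HasCompactSupport φ ∧ tsupport φ ⊆ U

/-! ### The spaces on the domain `Ω` -/

section Spatial

variable {d : ℕ} (Ω : Set (Space d))

/-- `L²(Ω)`. -/
abbrev L2 : Type := Lp ℝ 2 (volume.restrict Ω)

/-- `L²(Ω; ℝ^d)`. -/
abbrev L2Vec : Type := Lp (Space d) 2 (volume.restrict Ω)

/-- The pairs `(φ, ∇φ)`, for test functions `φ` on `Ω`, as a subspace of the Hilbert space
`L²(Ω) × L²(Ω; ℝ^d)`, whose squared norm at `(φ, ∇φ)` is the squared `H¹(Ω)` norm of `φ`. -/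
def testGraph : Submodule ℝ (WithLp 2 (L2 Ω × L2Vec Ω)) where
  carrier := {w | ∃ φ : Space d → ℝ, IsTestFunction Ω φ ∧
    w.fst =ᵐ[volume.restrict Ω] φ ∧ w.snd =ᵐ[volume.restrict Ω] gradient φ}
  zero_mem' := by
    refine ⟨0, ⟨contDiff_const, HasCompactSupport.zero, by simp [tsupport]⟩, ?_, ?_⟩
    · exact Lp.coeFn_zero _ _ _
    · rw [show gradient (0 : Space d → ℝ) = 0 from gradient_fun_const' (0 : ℝ)]
      exact Lp.coeFn_zero _ _ _
  add_mem' := by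
    rintro v w ⟨φ, ⟨hφ, hφc, hφs⟩, h1, h2⟩ ⟨ψ, ⟨hψ, hψc, hψs⟩, h3, h4⟩
    refine ⟨φ + ψ, ⟨hφ.add hψ, hφc.add hψc,
      (tsupport_add φ ψ).trans (union_subset hφs hψs)⟩, ?_, ?_⟩
    · exact (Lp.coeFn_add v.fst w.fst).trans (h1.add h3)
    · refine (Lp.coeFn_add v.snd w.snd).trans ((h2.add h4).trans (Filter.Eventually.of_forall ?_))
      intro x
      simp only [Pi.add_apply, gradient]
      rw [fderiv_add (hφ.differentiable (by simp) x) (hψ.differentiable (by simp) x), map_add]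
  smul_mem' := by
    rintro c w ⟨φ, ⟨hφ, hφc, hφs⟩, h1, h2⟩
    refine ⟨fun x => c • φ x, ⟨hφ.const_smul c, hφc.smul_left (f := fun _ => c),
      (tsupport_smul_subset_right (fun _ => c) φ).trans hφs⟩, ?_, ?_⟩
    · exact (Lp.coeFn_smul c w.fst).trans (h1.const_smul c)
    · refine (Lp.coeFn_smul c w.snd).trans
        ((h2.const_smul c).trans (Filter.Eventually.of_forall ?_))
      intro x
      simp only [Pi.smul_apply, gradient]
      rw [fderiv_fun_const_smul (hφ.differentiable (by simp) x) c, map_smulₛₗ]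
      simp

/-- `H¹₀(Ω)`: the closure of the test functions in the `H¹(Ω)` norm. An element is the pair of the
function and its (weak) gradient. -/
abbrev H10 : Type := (testGraph Ω).topologicalClosure

/-- `H⁻¹(Ω)`, the dual space of `H¹₀(Ω)`. -/
abbrev Hm1 : Type := StrongDual ℝ (H10 Ω)

/-- The inclusion `H¹₀(Ω) → L²(Ω)`. -/
def toL2 : H10 Ω →L[ℝ] L2 Ω :=
  (WithLp.fstL 2 ℝ (L2 Ω) (L2Vec Ω)).comp (testGraph Ω).topologicalClosure.subtypeL

/-- The gradient `∇ : H¹₀(Ω) → L²(Ω; ℝ^d)`. -/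
def grad : H10 Ω →L[ℝ] L2Vec Ω :=
  (WithLp.sndL 2 ℝ (L2 Ω) (L2Vec Ω)).comp (testGraph Ω).topologicalClosure.subtypeL

/-- The embedding `L²(Ω) → H⁻¹(Ω)`, `v ↦ (v, ·)`. -/
def l2ToDual (v : L2 Ω) : Hm1 Ω := (innerSL ℝ v).comp (toL2 Ω)

end Spatial

/-! ### Functions of space and time -/

/-- The Bochner space `L²(0,T;X)`. -/
abbrev L2Time (T : ℝ) (X : Type*) [NormedAddCommGroup X] : Type _ :=
  Lp X 2 (volume.restrict (Ioo 0 T))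

/-- The Riemann-Liouville fractional integral `(₀I_t^β w)(t)` of order `β > 0`. -/
def rlIntegral {X : Type*} [NormedAddCommGroup X] [NormedSpace ℝ X] (β : ℝ) (w : ℝ → X) (t : ℝ) :
    X :=
  (Real.Gamma β)⁻¹ • ∫ s in (0 : ℝ)..t, (t - s) ^ (β - 1) • w s

/-- `w` belongs to `₀H¹(0,T;X)` with weak derivative `g`: it is (a.e. equal to) the primitive,
vanishing at `t = 0`, of the function `g ∈ L²(0,T;X)`. -/
def HasZeroH1Deriv {X : Type*} [NormedAddCommGroup X] [NormedSpace ℝ X] (T : ℝ) (w : ℝ → X)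
    (g : L2Time T X) : Prop :=
  ∀ᵐ t ∂volume.restrict (Ioo 0 T), w t = ∫ s in (0 : ℝ)..t, g s

section SpaceTime

variable {d : ℕ} (Ω : Set (Space d)) (T : ℝ)

/-- The space-time cylinder `Ω × (0,T)`. -/
def cylinder : Set (Space d × ℝ) := Ω ×ˢ Ioo 0 T

/-- `L^∞(Ω × (0,T))`. -/
abbrev LInfty : Type := Lp ℝ ∞ (volume.restrict (cylinder Ω T))

/-- The admissible set `𝒜` of the `q ∈ L^∞(Ω × (0,T))` with `c₀ ≤ q ≤ c₁` a.e. -/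
def admissibleSet (c₀ c₁ : ℝ) : Set (LInfty Ω T) :=
  {q | ∀ᵐ z ∂volume.restrict (cylinder Ω T), c₀ ≤ q z ∧ q z ≤ c₁}

/-- `u ∈ L²(0,T;H¹₀(Ω))` is a weak solution of `∂_t^α u - ∇·(q∇u) = f` with initial value `u₀`:
`₀I_t^{1-α}(u - u₀)` lies in `₀H¹(0,T;H⁻¹(Ω))`, and its derivative `g`, which is the
Djrbashian-Caputo derivative `∂_t^α u`, satisfies, for a.e. `t`,
`(g(t),φ) + (q(t)∇u(t),∇φ) = (f(t),φ)` for all `φ ∈ H¹₀(Ω)`. -/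
def IsWeakSolution (α : ℝ) (u₀ : L2 Ω) (f : L2Time T (Hm1 Ω)) (q : LInfty Ω T)
    (u : L2Time T (H10 Ω)) : Prop :=
  ∃ g : L2Time T (Hm1 Ω),
    HasZeroH1Deriv T
      (fun t => l2ToDual Ω (rlIntegral (1 - α) (fun s => toL2 Ω (u s) - u₀) t)) g ∧
    ∀ᵐ t ∂volume.restrict (Ioo 0 T), ∀ φ : H10 Ω,
      g t φ + ∫ x in Ω, q (x, t) * inner ℝ (grad Ω (u t) x) (grad Ω φ x) = f t φ

/-- `G = (∇_x q, ∂_t q) ∈ L²(Ω × (0,T); ℝ^d × ℝ)` is the weak space-time gradient of `q`. -/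
def HasWeakGradient (q : LInfty Ω T)
    (G : Lp (WithLp 2 (Space d × ℝ)) 2 (volume.restrict (cylinder Ω T))) : Prop :=
  ∀ φ : Space d × ℝ → ℝ, IsTestFunction (cylinder Ω T) φ → ∀ v : Space d × ℝ,
    ∫ z in cylinder Ω T, q z * fderiv ℝ φ z v =
      -∫ z in cylinder Ω T, inner ℝ (G z) (WithLp.toLp 2 v) * φ z

/-- The squared seminorm `‖∇_{x,t} q‖²` in `L²(0,T;L²(Ω))`; it is `∞` if `q` is not in
`H¹(Ω × (0,T))`. -/
def h1SeminormSq (q : LInfty Ω T) : ℝ≥0∞ :=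
  ⨅ (G : Lp (WithLp 2 (Space d × ℝ)) 2 (volume.restrict (cylinder Ω T)))
    (_ : HasWeakGradient Ω T q G), ENNReal.ofReal (‖G‖ ^ 2)

/-- The value `½‖u - z‖² + (γ/2)‖∇_{x,t} q‖²` of the regularized output least-squares functional,
for the state `u`. -/
def objective (γ : ℝ) (z : L2Time T (L2 Ω)) (u : L2Time T (H10 Ω)) (q : LInfty Ω T) : ℝ≥0∞ :=
  ENNReal.ofReal (1 / 2 * ‖(toL2 Ω).compLp u - z‖ ^ 2) +
    ENNReal.ofReal (γ / 2) * h1SeminormSq Ω T q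

end SpaceTime

end Subdiffusion

end

/-! Everything about the states rests on one operator equation. Let `j` be the inclusion of
`L²(0,T;H¹₀)` in `L²(0,T;L²)`, `j'` its adjoint, `B` and `C` the Riemann-Liouville integrals of
order `α` on these two spaces, and `A = ∇* q ∇`. With `H⁻¹` identified with `H¹₀` by Riesz,
injectivity of the integral of order `1 - α` shows that being a weak solution means `j' (j u - u₀) =
B (F - A u)` (`exists_hasZeroH1Deriv_iff`). Here `A` is coercive by Poincaré and `q ≥ c₀`, `B` and
`C` are accretive, and `B j' = j' C` because time and space operations commute.

Existence, with a bound independent of `q` (`exists_solution_of_accretive`): the transposed problem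
has the form `⟪u, K x⟫ = L x`, and testing `K x` with `B* x` bounds `L x` by a multiple of `‖K x‖`.
An initial value that is merely in `L²` is admitted because `⟪w, u₀⟫² ≤ κ ⟪C w, w⟫`
(`exists_inner_constTime_sq_le`): the form of the integral of order `α` dominates the squared norm
of the adjoint integral of order `α/2`, and a function constant in time is the integral of order
`α/2` of an `L²` function, since `α/2 < 1/2`. Uniqueness (`solution_unique_of_accretive`) tests the
homogeneous equation with resolvent approximations of `(B*)⁻¹ u`.

The minimizer comes from the direct method (`exists_minimizer`). Along a minimizing sequence the
coefficients are uniformly bounded and their gradients are bounded in `L²`. An interior Rellich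
argument (`tendsto_integral_sq_of_weak`), which uses the uniform bound near the boundary instead of
boundary regularity, gives almost everywhere convergence of a subsequence of the coefficients. Then
`Aₙ x → A x` for each fixed `x`; since `Aₙ` is symmetric it can be moved onto the test vector, and
the equation survives mere weak convergence of the states (`solution_of_tendsto`). Uniqueness
identifies the weak limit as the state of the limit coefficient, and both squared norms are weakly
lower semicontinuous. -/

noncomputable section

namespace Subdiffusion

/-! ### Accretive operator equations and weak compactness in Hilbert spaces -/

section Abstract

open ContinuousLinearMap
open scoped InnerProductSpace

variable {X Y : Type*} [NormedAddCommGroup X] [InnerProductSpace ℝ X] [CompleteSpace X]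
  [NormedAddCommGroup Y] [InnerProductSpace ℝ Y] [CompleteSpace Y]

/-- A functional that is dominated by `‖K ·‖` is of the form `⟪u, K ·⟫`. -/
theorem exists_inner_eq_of_abs_le_norm {X : Type*} [NormedAddCommGroup X] [InnerProductSpace ℝ X]
    (K : X →L[ℝ] Y) (L : X →L[ℝ] ℝ) (C : ℝ) (hC : 0 ≤ C)
    (h : ∀ x, |L x| ≤ C * ‖K x‖) : ∃ u : Y, ‖u‖ ≤ C ∧ ∀ x, ⟪u, K x⟫_ℝ = L x := by
  -- The kernel of `K` lies in that of `L`, so `L` descends to a bounded functional on the range of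
  -- `K`, which need not be closed; Hahn-Banach and Riesz give `u`.
  have hker : K.toLinearMap.ker ≤ L.toLinearMap.ker := by
    intro x hx
    have hx' : K x = 0 := hx
    have := h x
    rw [hx', norm_zero, mul_zero] at this
    exact abs_nonpos_iff.mp this
  let l : K.toLinearMap.range →ₗ[ℝ] ℝ :=
    (K.toLinearMap.ker.liftQ L.toLinearMap hker).comp
      K.toLinearMap.quotKerEquivRange.symm.toLinearMap
  have hl : ∀ x, l ⟨K x, x, rfl⟩ = L x := by
    intro x
    have : K.toLinearMap.quotKerEquivRange.symm ⟨K x, x, rfl⟩ = Submodule.Quotient.mk x := by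
      rw [LinearEquiv.symm_apply_eq]
      rfl
    change (K.toLinearMap.ker.liftQ L.toLinearMap hker)
      (K.toLinearMap.quotKerEquivRange.symm ⟨K x, x, rfl⟩) = L x
    rw [this]
    rfl
  have hlC : ∀ y, ‖l y‖ ≤ C * ‖y‖ := by
    rintro ⟨_, x, rfl⟩
    have := h x
    rw [← hl] at this
    exact this
  obtain ⟨g, hg, hgn⟩ := exists_extension_norm_eq (𝕜 := ℝ) K.toLinearMap.range (l.mkContinuous C hlC)
  refine ⟨(InnerProductSpace.toDual ℝ Y).symm g, ?_, fun x => ?_⟩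
  · rw [LinearIsometryEquiv.norm_map, hgn]
    exact l.mkContinuous_norm_le hC hlC
  · rw [InnerProductSpace.toDual_symm_apply]
    have := hg ⟨K x, x, rfl⟩
    rw [← hl x]
    exact this

/-- A bounded accretive operator and its adjoint have the same kernel; hence an injective one has
dense range. -/
theorem denseRange_of_accretive_of_injective (B : X →L[ℝ] X) (hB : ∀ x, 0 ≤ ⟪B x, x⟫_ℝ)
    (hinj : Function.Injective B) : DenseRange B := by
  have hker : ∀ x, adjoint B x = 0 → x = 0 := by
    intro x hx
    apply hinj
    rw [map_zero, ← inner_self_eq_zero (𝕜 := ℝ)]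
    -- Accretivity at `x + t • B x`; the constant term and one linear term vanish because `B* x =
    -- 0`. For all `t` this forces the remaining linear coefficient `‖B x‖²` to be zero.
    have key : ∀ t : ℝ, 0 ≤ t * ⟪B x, B x⟫_ℝ + t ^ 2 * ⟪B (B x), B x⟫_ℝ := by
      intro t
      have h1 := hB (x + t • B x)
      have h2 : ⟪B (B x), x⟫_ℝ = 0 := by rw [← adjoint_inner_right, hx, inner_zero_right]
      have h3 : ⟪B x, x⟫_ℝ = 0 := by rw [← adjoint_inner_right, hx, inner_zero_right]
      simp only [map_add, map_smul, inner_add_left, inner_add_right, inner_smul_left,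
        inner_smul_right, h2, h3, RCLike.conj_to_real] at h1
      nlinarith
    set a := ⟪B x, B x⟫_ℝ with ha
    set b := ⟪B (B x), B x⟫_ℝ with hb
    have ha0 : 0 ≤ a := real_inner_self_nonneg
    have hb0 : 0 ≤ b := hB (B x)
    by_contra hne
    have hpos : 0 < a := lt_of_le_of_ne ha0 (Ne.symm hne)
    -- A negative `t` so small that the linear term beats the quadratic one; the `+ 1` covers `b =
    -- 0`.
    have := key (-(a / (2 * (b + 1))))
    have hb1 : 0 < b + 1 := by linarith
    have e : -(a / (2 * (b + 1))) * a + (-(a / (2 * (b + 1)))) ^ 2 * b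
        = -(a ^ 2 * (b + 2)) / (4 * (b + 1) ^ 2) := by
      field_simp
      ring
    rw [e] at this
    have : -(a ^ 2 * (b + 2)) / (4 * (b + 1) ^ 2) < 0 := by
      apply div_neg_of_neg_of_pos
      · have : 0 < a ^ 2 * (b + 2) := by positivity
        linarith
      · positivity
    linarith
  have : B.toLinearMap.range.topologicalClosure = ⊤ := by
    rw [Submodule.topologicalClosure_eq_top_iff, Submodule.eq_bot_iff]
    intro x hx
    apply hker
    rw [← inner_self_eq_zero (𝕜 := ℝ), adjoint_inner_right]
    exact (Submodule.mem_orthogonal _ _).mp hx _ ⟨_, rfl⟩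
  rw [DenseRange, dense_iff_closure_eq]
  have h2 := congrArg (fun s : Submodule ℝ X => (s : Set X)) this
  rw [Submodule.topologicalClosure_coe] at h2
  exact h2

/-- Existence for `j' (j u - e) = B (f - A u)`, with an a priori bound. -/
theorem exists_solution_of_accretive (j : X →L[ℝ] Y) (j' : Y →L[ℝ] X) (B A : X →L[ℝ] X) (C : Y →L[ℝ] Y) (e : Y)
    (f : X) {κ a : ℝ} (hj : ∀ x y, ⟪j x, y⟫_ℝ = ⟪x, j' y⟫_ℝ) (hκ : 0 < κ) (ha : 0 < a) (hBC : ∀ y, B (j' y) = j' (C y))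
    (hC : ∀ y, ⟪y, e⟫_ℝ ^ 2 ≤ κ * ⟪C y, y⟫_ℝ) (hA : ∀ x, a * ‖x‖ ^ 2 ≤ ⟪A x, x⟫_ℝ) :
    ∃ u : X, ‖u‖ ≤ √(κ / a) + ‖f‖ / a ∧ j' (j u - e) = B (f - A u) := by
  obtain rfl : j' = adjoint j :=
    (eq_adjoint_iff _ _).mpr fun y x => by rw [real_inner_comm, ← hj, real_inner_comm]
  -- Pairing the equation with `x` and moving every operator to the right turns it into `⟪u, K x⟫ =
  -- L x`.
  let K : X →L[ℝ] X := (adjoint j).comp j + (adjoint A).comp (adjoint B)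
  let L : X →L[ℝ] ℝ := (innerSL ℝ e).comp j + (innerSL ℝ f).comp (adjoint B)
  obtain ⟨u, hu, huK⟩ := exists_inner_eq_of_abs_le_norm K L (√(κ / a) + ‖f‖ / a) (by positivity) (by
    intro x
    -- The decisive choice is to test with `B* x`: the second term controls `‖B* x‖` by coercivity,
    -- and the intertwining relation makes the first one the form of `C`, which controls `⟪j x, e⟫`
    -- through `hC`.
    have h1 : ⟪K x, adjoint B x⟫_ℝ = ⟪C (j x), j x⟫_ℝ + ⟪A (adjoint B x), adjoint B x⟫_ℝ := by
      simp only [K, add_apply, coe_comp, Function.comp_apply, inner_add_left]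
      rw [adjoint_inner_right, hBC, adjoint_inner_left, adjoint_inner_left, real_inner_comm]
      rw [real_inner_comm (A _)]
    have h2 : ⟪K x, adjoint B x⟫_ℝ ≤ ‖K x‖ * ‖adjoint B x‖ := real_inner_le_norm _ _
    have h3 := hC (j x)
    have h4 := hA (adjoint B x)
    set k := ‖K x‖
    set b := ‖adjoint B x‖
    have hk : 0 ≤ k := norm_nonneg _
    have hb : 0 ≤ b := norm_nonneg _
    have hCn : 0 ≤ ⟪C (j x), j x⟫_ℝ := by
      by_contra hneg
      push Not at hneg
      nlinarith [sq_nonneg ⟪j x, e⟫_ℝ, mul_neg_of_pos_of_neg hκ hneg]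
    have hbk : b ≤ k / a := by
      rw [le_div_iff₀ ha]
      by_contra hcon
      push Not at hcon
      have hbpos : 0 < b := by
        rcases hb.lt_or_eq with h | h
        · exact h
        · rw [← h] at hcon; linarith
      nlinarith
    have he : |⟪j x, e⟫_ℝ| ≤ √(κ / a) * k := by
      apply abs_le_of_sq_le_sq _ (by positivity)
      rw [mul_pow, Real.sq_sqrt (by positivity)]
      calc ⟪j x, e⟫_ℝ ^ 2 ≤ κ * ⟪C (j x), j x⟫_ℝ := h3
        _ ≤ κ * (k * b) := by
          apply mul_le_mul_of_nonneg_left _ hκ.le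
          nlinarith [mul_nonneg ha.le (sq_nonneg b)]
        _ ≤ κ * (k * (k / a)) := by gcongr
        _ = κ / a * k ^ 2 := by ring
    have hf : |⟪f, adjoint B x⟫_ℝ| ≤ ‖f‖ / a * k :=
      calc |⟪f, adjoint B x⟫_ℝ| ≤ ‖f‖ * b := abs_real_inner_le_norm _ _
        _ ≤ ‖f‖ * (k / a) := by gcongr
        _ = ‖f‖ / a * k := by ring
    calc |L x| = |⟪j x, e⟫_ℝ + ⟪f, adjoint B x⟫_ℝ| := by
          simp [L, real_inner_comm]
      _ ≤ |⟪j x, e⟫_ℝ| + |⟪f, adjoint B x⟫_ℝ| := abs_add_le _ _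
      _ ≤ (√(κ / a) + ‖f‖ / a) * k := by rw [add_mul]; exact add_le_add he hf)
  refine ⟨u, hu, ext_inner_right ℝ fun x => ?_⟩
  have h := huK x
  simp only [K, L, add_apply, coe_comp, Function.comp_apply, inner_add_right, innerSL_apply_apply,
    adjoint_inner_right] at h
  rw [map_sub, map_sub, inner_sub_left, inner_sub_left, adjoint_inner_left, adjoint_inner_left]
  linarith

/-- Uniqueness for `j' (j u - e) = B (f - A u)`. -/
theorem solution_unique_of_accretive (j : X →L[ℝ] Y) (j' : Y →L[ℝ] X) (B A : X →L[ℝ] X) (C : Y →L[ℝ] Y)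
    {a : ℝ} (hj : ∀ x y, ⟪j x, y⟫_ℝ = ⟪x, j' y⟫_ℝ) (ha : 0 < a) (hBC : ∀ y, B (j' y) = j' (C y))
    (hC : ∀ y, 0 ≤ ⟪C y, y⟫_ℝ) (hB : ∀ x, 0 ≤ ⟪B x, x⟫_ℝ) (hinj : Function.Injective B)
    (hA : ∀ x, a * ‖x‖ ^ 2 ≤ ⟪A x, x⟫_ℝ) (u : X) (hu : j' (j u) + B (A u) = 0) :
    u = 0 := by
  obtain rfl : j' = adjoint j :=
    (eq_adjoint_iff _ _).mpr fun y x => by rw [real_inner_comm, ← hj, real_inner_comm]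
  have hdense := denseRange_of_accretive_of_injective B hB hinj
  -- `B*` need not be onto, but `B* + ε` is coercive, so Lax-Milgram gives an approximate preimage
  -- `x` of `u`.
  have hres : ∀ ε : ℝ, 0 < ε → ∃ x : X, adjoint B x + ε • x = u := by
    intro ε hε
    let b : X →L[ℝ] X →L[ℝ] ℝ := (innerSL ℝ).comp (adjoint B + ε • ContinuousLinearMap.id ℝ X)
    have hb : ∀ x y, b x y = ⟪adjoint B x + ε • x, y⟫_ℝ := fun x y => rfl
    have hco : IsCoercive b := by
      refine ⟨ε, hε, fun x => ?_⟩
      rw [hb, inner_add_left, adjoint_inner_left, real_inner_comm, inner_smul_left,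
        real_inner_self_eq_norm_sq]
      have := hB x
      simp only [RCLike.conj_to_real]
      nlinarith
    refine ⟨hco.continuousLinearEquivOfBilin.symm u, ext_inner_right ℝ fun y => ?_⟩
    rw [← hb, ← IsCoercive.continuousLinearEquivOfBilin_apply hco,
      ContinuousLinearEquiv.apply_symm_apply]
  -- Pairing the equation with `x` leaves `⟪A u, u⟫ ≤ ⟪A u, ε • x⟫`, as the `j` term is nonnegative.
  -- The vectors `ε • x` are bounded by `‖u‖` and are of order `ε` against any `B y`; density of the
  -- range of `B` then makes the right side vanish.
  have key : ∀ ε : ℝ, 0 < ε → ∀ y, ⟪A u, u⟫_ℝ ≤ ‖A u - B y‖ * ‖u‖ + ε * (2 * ‖y‖ * ‖u‖) := by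
    intro ε hε y
    obtain ⟨x, hx⟩ := hres ε hε
    have hxn : ‖ε • x‖ ≤ ‖u‖ := by
      have h1 : ⟪u, x⟫_ℝ = ⟪B x, x⟫_ℝ + ε * ‖x‖ ^ 2 := by
        rw [← hx, inner_add_left, adjoint_inner_left, real_inner_comm, inner_smul_left,
          real_inner_self_eq_norm_sq]
        rfl
      have h2 := real_inner_le_norm u x
      have h3 := hB x
      rw [norm_smul, Real.norm_of_nonneg hε.le]
      by_contra hcon
      push Not at hcon
      have hxp : 0 < ‖x‖ := by
        rcases (norm_nonneg x).lt_or_eq with h | h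
        · exact h
        · rw [← h, mul_zero] at hcon
          exact absurd hcon (not_lt.mpr (norm_nonneg _))
      nlinarith
    have h1 : ⟪j u, j x⟫_ℝ + ⟪A u, adjoint B x⟫_ℝ = 0 := by
      rw [adjoint_inner_right, ← adjoint_inner_left, ← inner_add_left, hu, inner_zero_left]
    have h2 : 0 ≤ ⟪j u, j x⟫_ℝ := by
      rw [← hx, map_add, map_smul, inner_add_left, inner_smul_left, real_inner_self_eq_norm_sq]
      have : ⟪j (adjoint B x), j x⟫_ℝ = ⟪C (j x), j x⟫_ℝ := by
        rw [← adjoint_inner_right, adjoint_inner_left, hBC, adjoint_inner_right, real_inner_comm]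
      rw [this]
      have := hC (j x)
      simp only [RCLike.conj_to_real]
      positivity
    have h3 : adjoint B x = u - ε • x := by rw [← hx]; abel
    have h4 : ⟪A u, u⟫_ℝ ≤ ⟪A u, ε • x⟫_ℝ := by
      rw [h3, inner_sub_right] at h1
      linarith
    have h5 : ⟪B y, ε • x⟫_ℝ ≤ ε * (2 * ‖y‖ * ‖u‖) := by
      rw [inner_smul_right, ← adjoint_inner_right, h3]
      apply mul_le_mul_of_nonneg_left _ hε.le
      calc ⟪y, u - ε • x⟫_ℝ ≤ ‖y‖ * ‖u - ε • x‖ := real_inner_le_norm _ _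
        _ ≤ ‖y‖ * (‖u‖ + ‖u‖) := by
          gcongr
          exact (norm_sub_le _ _).trans (by gcongr)
        _ = 2 * ‖y‖ * ‖u‖ := by ring
    calc ⟪A u, u⟫_ℝ ≤ ⟪A u - B y, ε • x⟫_ℝ + ⟪B y, ε • x⟫_ℝ := by
          rw [← inner_add_left, sub_add_cancel]; exact h4
      _ ≤ ‖A u - B y‖ * ‖u‖ + ε * (2 * ‖y‖ * ‖u‖) := by
          apply add_le_add _ h5
          exact (real_inner_le_norm _ _).trans (by gcongr)
  have key2 : ∀ y, ⟪A u, u⟫_ℝ ≤ ‖A u - B y‖ * ‖u‖ := by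
    intro y
    apply le_of_forall_pos_le_add
    intro δ hδ
    have hM : 0 ≤ 2 * ‖y‖ * ‖u‖ := by positivity
    refine (key (δ / (2 * ‖y‖ * ‖u‖ + 1)) (by positivity) y).trans ?_
    gcongr
    rw [div_mul_eq_mul_div, div_le_iff₀ (by positivity)]
    nlinarith
  have key3 : ⟪A u, u⟫_ℝ ≤ 0 := by
    apply le_of_forall_pos_le_add
    intro δ hδ
    obtain ⟨y, hy⟩ := hdense.exists_dist_lt (A u) (ε := δ / (‖u‖ + 1)) (by positivity)
    rw [dist_eq_norm] at hy
    refine (key2 y).trans ?_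
    rw [zero_add]
    calc ‖A u - B y‖ * ‖u‖ ≤ δ / (‖u‖ + 1) * ‖u‖ := by gcongr
      _ ≤ δ := by
        rw [div_mul_eq_mul_div, div_le_iff₀ (by positivity)]
        nlinarith [norm_nonneg u]
  have h := hA u
  have : ‖u‖ ^ 2 ≤ 0 := by
    by_contra hcon
    push Not at hcon
    nlinarith
  exact norm_eq_zero.mp (by nlinarith [norm_nonneg u])

/-- Bounded sequences in a Hilbert space have weakly convergent subsequences. -/
theorem exists_subseq_tendsto_inner (x : ℕ → X) {R : ℝ} (hx : ∀ n, ‖x n‖ ≤ R) :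
    ∃ (y : X) (φ : ℕ → ℕ), StrictMono φ ∧
      ∀ w, Filter.Tendsto (fun n => ⟪x (φ n), w⟫_ℝ) Filter.atTop (nhds ⟪y, w⟫_ℝ) := by
  -- Sequential Banach-Alaoglu needs a separable space, so it is applied in the closed span of the
  -- sequence.
  let M : Submodule ℝ X := (Submodule.span ℝ (Set.range x)).topologicalClosure
  have hsep : TopologicalSpace.SeparableSpace M := by
    have h1 : TopologicalSpace.IsSeparable (M : Set X) := by
      rw [Submodule.topologicalClosure_coe]
      exact ((Set.countable_range x).isSeparable.span (R := ℝ)).closure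
    exact h1.separableSpace
  have : CompleteSpace M := Submodule.topologicalClosure.completeSpace _
  have hxM : ∀ n, x n ∈ M := fun n =>
    Submodule.le_topologicalClosure _ (Submodule.subset_span ⟨n, rfl⟩)
  let ℓ : ℕ → WeakDual ℝ M := fun n =>
    StrongDual.toWeakDual (InnerProductSpace.toDual ℝ M ⟨x n, hxM n⟩)
  have hℓ : ∀ n, ℓ n ∈ WeakDual.toStrongDual ⁻¹' Metric.closedBall (0 : StrongDual ℝ M) R := by
    intro n
    have : ‖InnerProductSpace.toDual ℝ M ⟨x n, hxM n⟩‖ ≤ R := by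
      rw [LinearIsometryEquiv.norm_map]
      exact hx n
    exact mem_closedBall_zero_iff.mpr this
  obtain ⟨g, -, φ, hφ, hg⟩ := WeakDual.isSeqCompact_closedBall ℝ M 0 R hℓ
  refine ⟨((InnerProductSpace.toDual ℝ M).symm (WeakDual.toStrongDual g) : M), φ, hφ, fun w => ?_⟩
  have h1 : ∀ m : M, ⟪(m : X), w⟫_ℝ = ⟪m, M.orthogonalProjectionOnto w⟫_ℝ := by
    intro m
    simp
  have h2 := (WeakDual.eval_continuous (M.orthogonalProjectionOnto w)).continuousAt.tendsto.comp hg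
  rw [h1]
  rw [InnerProductSpace.toDual_symm_apply]
  refine h2.congr fun n => ?_
  have := h1 ⟨x (φ n), hxM _⟩
  simp only at this
  rw [this]
  rfl

end Abstract

/-! ### Integral operators on Bochner spaces: Schur's test and composition -/

section SchurKernel

open scoped InnerProductSpace

variable {S : Type*} [MeasurableSpace S]

/-- A nonnegative measurable kernel whose marginals are bounded by `K`. -/
structure IsSchurKernel (μ : Measure S) (k : S → S → ℝ) (K : ℝ) : Prop where
  bound_nonneg : 0 ≤ K
  measurable : Measurable (Function.uncurry k)
  nonneg : ∀ t s, 0 ≤ k t s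
  left : ∀ t, ∫⁻ s, ENNReal.ofReal (k t s) ∂μ ≤ ENNReal.ofReal K
  right : ∀ s, ∫⁻ t, ENNReal.ofReal (k t s) ∂μ ≤ ENNReal.ofReal K

variable {μ : Measure S} {k l m : S → S → ℝ} {K L M : ℝ}

theorem IsSchurKernel.swap (hk : IsSchurKernel μ k K) : IsSchurKernel μ (fun t s => k s t) K where
  bound_nonneg := hk.bound_nonneg
  measurable := hk.measurable.comp measurable_swap
  nonneg t s := hk.nonneg s t
  left := hk.right
  right := hk.left

theorem IsSchurKernel.measurable_left (hk : IsSchurKernel μ k K) (t : S) : Measurable (k t) :=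
  hk.measurable.comp measurable_prodMk_left

/-- Cauchy-Schwarz with the kernel split into two square roots; the factor free of `g` is a
marginal. -/
theorem IsSchurKernel.lintegral_sq_le (hk : IsSchurKernel μ k K) (t : S) {g : S → ℝ≥0∞}
    (hg : AEMeasurable g μ) :
    (∫⁻ s, ENNReal.ofReal (k t s) * g s ∂μ) ^ 2 ≤
      ENNReal.ofReal K * ∫⁻ s, ENNReal.ofReal (k t s) * g s ^ 2 ∂μ := by
  set κ : S → ℝ≥0∞ := fun s => ENNReal.ofReal (k t s)
  have hκ : Measurable κ := (hk.measurable_left t).ennreal_ofReal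
  have hsq : ∀ x : ℝ≥0∞, (x ^ (1 / 2 : ℝ)) ^ (2 : ℝ) = x := fun x => by
    rw [← ENNReal.rpow_mul]; norm_num
  have h := ENNReal.lintegral_mul_le_Lp_mul_Lq μ (p := 2) (q := 2) Real.HolderConjugate.two_two
    (f := fun s => κ s ^ (1 / 2 : ℝ)) (g := fun s => κ s ^ (1 / 2 : ℝ) * g s)
    (hκ.pow_const _).aemeasurable ((hκ.pow_const _).aemeasurable.mul hg)
  have e1 : ∀ s, ((fun s => κ s ^ (1 / 2 : ℝ)) * fun s => κ s ^ (1 / 2 : ℝ) * g s) s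
      = κ s * g s := fun s => by
    simp only [Pi.mul_apply]
    rw [← mul_assoc, ← sq, ← ENNReal.rpow_natCast, Nat.cast_ofNat, hsq]
  have e2 : ∀ s, (κ s ^ (1 / 2 : ℝ) * g s) ^ (2 : ℝ) = κ s * g s ^ 2 := fun s => by
    rw [ENNReal.mul_rpow_of_nonneg _ _ (by norm_num), hsq]
    norm_num
  simp only [e1, e2, hsq] at h
  calc (∫⁻ s, κ s * g s ∂μ) ^ 2
      ≤ ((∫⁻ s, κ s ∂μ) ^ (1 / 2 : ℝ) * (∫⁻ s, κ s * g s ^ 2 ∂μ) ^ (1 / 2 : ℝ)) ^ 2 := by gcongr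
    _ = (∫⁻ s, κ s ∂μ) * ∫⁻ s, κ s * g s ^ 2 ∂μ := by
      rw [mul_pow, ← ENNReal.rpow_natCast, ← ENNReal.rpow_natCast, Nat.cast_ofNat, hsq, hsq]
    _ ≤ _ := by gcongr; exact hk.left t

/-- Schur's test: after the pointwise Cauchy-Schwarz bound, Tonelli brings in the other marginal. -/
theorem IsSchurKernel.lintegral_lintegral_sq_le [SFinite μ] (hk : IsSchurKernel μ k K)
    {g : S → ℝ≥0∞} (hg : AEMeasurable g μ) :
    ∫⁻ t, (∫⁻ s, ENNReal.ofReal (k t s) * g s ∂μ) ^ 2 ∂μ ≤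
      ENNReal.ofReal K ^ 2 * ∫⁻ s, g s ^ 2 ∂μ := by
  have hm : AEMeasurable (Function.uncurry fun t s => ENNReal.ofReal (k t s) * g s ^ 2)
      (μ.prod μ) :=
    (hk.measurable.ennreal_ofReal.aemeasurable).mul ((hg.pow_const 2).comp_snd)
  calc ∫⁻ t, (∫⁻ s, ENNReal.ofReal (k t s) * g s ∂μ) ^ 2 ∂μ
      ≤ ∫⁻ t, ENNReal.ofReal K * ∫⁻ s, ENNReal.ofReal (k t s) * g s ^ 2 ∂μ ∂μ :=
        lintegral_mono fun t => hk.lintegral_sq_le t hg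
    _ = ENNReal.ofReal K * ∫⁻ t, ∫⁻ s, ENNReal.ofReal (k t s) * g s ^ 2 ∂μ ∂μ := by
        rw [lintegral_const_mul' _ _ ENNReal.ofReal_ne_top]
    _ = ENNReal.ofReal K * ∫⁻ s, (∫⁻ t, ENNReal.ofReal (k t s) ∂μ) * g s ^ 2 ∂μ := by
        rw [lintegral_lintegral_swap hm]
        congr 1
        refine lintegral_congr fun s => ?_
        rw [lintegral_mul_const]
        exact (hk.swap.measurable_left s).ennreal_ofReal
    _ ≤ ENNReal.ofReal K * ∫⁻ s, ENNReal.ofReal K * g s ^ 2 ∂μ := by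
        gcongr with s
        exact hk.right s
    _ = _ := by
        rw [lintegral_const_mul' _ _ ENNReal.ofReal_ne_top]
        ring

variable {E F : Type*} [NormedAddCommGroup E] [NormedSpace ℝ E]
  [NormedAddCommGroup F] [NormedSpace ℝ F]

theorem eLpNorm_two_sq {E : Type*} [NormedAddCommGroup E] (w : S → E) : eLpNorm w 2 μ ^ 2 = ∫⁻ s, ‖w s‖ₑ ^ 2 ∂μ := by
  rw [eLpNorm_eq_lintegral_rpow_enorm_toReal (by norm_num) (by norm_num), ← ENNReal.rpow_natCast,
    ← ENNReal.rpow_mul]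
  norm_num

theorem lintegral_enorm_sq_lt_top {w : S → E} (hw : MemLp w 2 μ) : ∫⁻ s, ‖w s‖ₑ ^ 2 ∂μ < ⊤ := by
  rw [← eLpNorm_two_sq]
  exact ENNReal.pow_lt_top hw.eLpNorm_lt_top

theorem IsSchurKernel.ae_integrable [SFinite μ] (hk : IsSchurKernel μ k K) {w : S → E}
    (hw : MemLp w 2 μ) : ∀ᵐ t ∂μ, Integrable (fun s => k t s • w s) μ := by
  have hm : AEMeasurable (fun t => (∫⁻ s, ENNReal.ofReal (k t s) * ‖w s‖ₑ ∂μ) ^ 2) μ := by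
    apply AEMeasurable.pow_const
    exact AEMeasurable.lintegral_prod_right'
      (f := fun p : S × S => ENNReal.ofReal (k p.1 p.2) * ‖w p.2‖ₑ)
      (hk.measurable.ennreal_ofReal.aemeasurable.mul hw.1.enorm.comp_snd)
  have h := hk.lintegral_lintegral_sq_le hw.1.enorm
  have hlt : ∫⁻ t, (∫⁻ s, ENNReal.ofReal (k t s) * ‖w s‖ₑ ∂μ) ^ 2 ∂μ ≠ ⊤ := by
    refine (h.trans_lt (ENNReal.mul_lt_top ?_ (lintegral_enorm_sq_lt_top hw))).ne
    exact ENNReal.pow_lt_top ENNReal.ofReal_lt_top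
  filter_upwards [ae_lt_top' hm hlt] with t ht
  refine ⟨(hk.measurable_left t).aestronglyMeasurable.smul hw.1, ?_⟩
  rw [hasFiniteIntegral_iff_enorm]
  have : ∀ s, ‖k t s • w s‖ₑ = ENNReal.ofReal (k t s) * ‖w s‖ₑ := fun s => by
    rw [enorm_smul, Real.enorm_of_nonneg (hk.nonneg t s)]
  simp only [this]
  by_contra hcon
  rw [not_lt, top_le_iff] at hcon
  simp [hcon] at ht

theorem IsSchurKernel.aestronglyMeasurable [SFinite μ] (hk : IsSchurKernel μ k K) {w : S → E}
    (hw : AEStronglyMeasurable w μ) : AEStronglyMeasurable (fun t => ∫ s, k t s • w s ∂μ) μ :=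
  AEStronglyMeasurable.integral_prod_right' (f := fun p : S × S => k p.1 p.2 • w p.2)
    (hk.measurable.aestronglyMeasurable.smul hw.comp_snd)

theorem IsSchurKernel.eLpNorm_le [SFinite μ] (hk : IsSchurKernel μ k K) {w : S → E}
    (hw : AEStronglyMeasurable w μ) :
    eLpNorm (fun t => ∫ s, k t s • w s ∂μ) 2 μ ≤ ENNReal.ofReal K * eLpNorm w 2 μ := by
  have h : eLpNorm (fun t => ∫ s, k t s • w s ∂μ) 2 μ ^ 2 ≤
      (ENNReal.ofReal K * eLpNorm w 2 μ) ^ 2 := by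
    rw [eLpNorm_two_sq, mul_pow, eLpNorm_two_sq]
    refine le_trans (lintegral_mono fun t => ?_) (hk.lintegral_lintegral_sq_le hw.enorm)
    gcongr
    refine (enorm_integral_le_lintegral_enorm _).trans (lintegral_mono fun s => ?_)
    rw [enorm_smul, Real.enorm_of_nonneg (hk.nonneg t s)]
  exact (ENNReal.pow_le_pow_left_iff (by norm_num)).mp h

theorem IsSchurKernel.memLp [SFinite μ] (hk : IsSchurKernel μ k K) {w : S → E}
    (hw : MemLp w 2 μ) : MemLp (fun t => ∫ s, k t s • w s ∂μ) 2 μ :=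
  ⟨hk.aestronglyMeasurable hw.1, (hk.eLpNorm_le hw.1).trans_lt
    (ENNReal.mul_lt_top ENNReal.ofReal_lt_top hw.2)⟩

/-- The integral operator with kernel `k` on `L²(μ; E)`. -/
def kernelOp [SFinite μ] (hk : IsSchurKernel μ k K) (E : Type*) [NormedAddCommGroup E]
    [NormedSpace ℝ E] : Lp E 2 μ →L[ℝ] Lp E 2 μ :=
  LinearMap.mkContinuous
    { toFun := fun w => (hk.memLp (Lp.memLp w)).toLp
      map_add' := fun v w => by
        rw [← MemLp.toLp_add]
        apply MemLp.toLp_congr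
        filter_upwards [hk.ae_integrable (Lp.memLp v), hk.ae_integrable (Lp.memLp w)] with t hv hw
        rw [Pi.add_apply, ← integral_add hv hw]
        refine integral_congr_ae ?_
        filter_upwards [Lp.coeFn_add v w] with s hs
        rw [hs, Pi.add_apply, smul_add]
      map_smul' := fun c w => by
        rw [← MemLp.toLp_const_smul]
        apply MemLp.toLp_congr
        refine .of_forall fun t => ?_
        rw [RingHom.id_apply, Pi.smul_apply, ← integral_smul]
        refine integral_congr_ae ?_
        filter_upwards [Lp.coeFn_smul c w] with s hs
        rw [hs, Pi.smul_apply, smul_comm] }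
    K (fun w => by
      have h := hk.eLpNorm_le (Lp.memLp w).1
      change ‖(hk.memLp (Lp.memLp w)).toLp‖ ≤ K * ‖w‖
      rw [Lp.norm_toLp, Lp.norm_def]
      have h2 := ENNReal.toReal_mono (ENNReal.mul_ne_top ENNReal.ofReal_ne_top
        (Lp.memLp w).eLpNorm_ne_top) h
      rwa [ENNReal.toReal_mul, ENNReal.toReal_ofReal hk.bound_nonneg] at h2)

theorem coeFn_kernelOp [SFinite μ] (hk : IsSchurKernel μ k K) (w : Lp E 2 μ) :
    kernelOp hk E w =ᵐ[μ] fun t => ∫ s, k t s • w s ∂μ :=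
  MemLp.coeFn_toLp (hk.memLp (Lp.memLp w))

/-- A bounded operator passes through the Bochner integral. This is the source of the relation `B j'
= j' C`. -/
theorem compLp_kernelOp [SFinite μ] [CompleteSpace E] [CompleteSpace F] (hk : IsSchurKernel μ k K)
    (A : E →L[ℝ] F) (w : Lp E 2 μ) :
    A.compLp (kernelOp hk E w) = kernelOp hk F (A.compLp w) := by
  apply Lp.ext
  filter_upwards [A.coeFn_compLp (kernelOp hk E w), coeFn_kernelOp hk w,
    coeFn_kernelOp hk (A.compLp w), hk.ae_integrable (Lp.memLp w)] with t h1 h2 h3 h4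
  rw [h1, h2, h3, ← A.integral_comp_comm h4]
  refine integral_congr_ae ?_
  filter_upwards [A.coeFn_compLp w] with s hs
  rw [hs, map_smul]

/-- Fubini. Joint integrability follows from applying both kernels to `‖w‖`, which is legitimate
because they are nonnegative. -/
theorem kernelOp_kernelOp [SFinite μ] [CompleteSpace E] (hk : IsSchurKernel μ k K)
    (hl : IsSchurKernel μ l L) (hm : IsSchurKernel μ m M)
    (h : ∀ᵐ t ∂μ, ∀ᵐ r ∂μ, ∫ s, k t s * l s r ∂μ = m t r) (w : Lp E 2 μ) :
    kernelOp hk E (kernelOp hl E w) = kernelOp hm E w := by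
  apply Lp.ext
  have hn : MemLp (fun s => ‖w s‖) 2 μ := (Lp.memLp w).norm
  filter_upwards [coeFn_kernelOp hk (kernelOp hl E w), coeFn_kernelOp hm w, h,
    hk.ae_integrable (hl.memLp hn)] with t h1 h2 h3 h4
  rw [h1, h2]
  have e1 : ∫ s, k t s • kernelOp hl E w s ∂μ = ∫ s, ∫ r, (k t s * l s r) • w r ∂μ ∂μ := by
    refine integral_congr_ae ?_
    filter_upwards [coeFn_kernelOp hl w] with s hs
    rw [hs, ← integral_smul]
    simp only [smul_smul]
  have hint : Integrable (Function.uncurry fun s r => (k t s * l s r) • w r) (μ.prod μ) := by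
    rw [integrable_prod_iff]
    · refine ⟨?_, ?_⟩
      · filter_upwards [hl.ae_integrable (Lp.memLp w)] with s hs
        refine (hs.smul (k t s)).congr (.of_forall fun r => ?_)
        simp only [Function.uncurry_apply_pair, mul_smul, Pi.smul_apply]
      · refine h4.congr (.of_forall fun s => ?_)
        simp only
        rw [smul_eq_mul, ← integral_const_mul]
        refine integral_congr_ae (.of_forall fun r => ?_)
        simp only [Function.uncurry_apply_pair, norm_smul, norm_mul, smul_eq_mul,
          Real.norm_of_nonneg (hk.nonneg _ _), Real.norm_of_nonneg (hl.nonneg _ _), mul_assoc]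
    · refine AEStronglyMeasurable.smul ?_ (Lp.memLp w).1.comp_snd
      exact (((hk.measurable_left t).comp measurable_fst).mul hl.measurable).aestronglyMeasurable
  rw [e1, integral_integral_swap hint]
  refine integral_congr_ae ?_
  filter_upwards [h3] with r hr
  rw [integral_smul_const, hr]

end SchurKernel

/-! ### Bilinear forms of integral operators -/

section SchurKernelInner

open scoped InnerProductSpace

variable {S : Type*} [MeasurableSpace S] {μ : Measure S} {k : S → S → ℝ} {K : ℝ}
  {E : Type*} [NormedAddCommGroup E] [InnerProductSpace ℝ E] [CompleteSpace E]

theorem IsSchurKernel.integrable_mul_norm {E : Type*} [NormedAddCommGroup E] [SFinite μ] (hk : IsSchurKernel μ k K) {v w : S → E}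
    (hv : MemLp v 2 μ) (hw : MemLp w 2 μ) :
    Integrable (Function.uncurry fun t s => k t s * (‖v t‖ * ‖w s‖)) (μ.prod μ) := by
  rw [integrable_prod_iff]
  · refine ⟨?_, ?_⟩
    · filter_upwards [hk.ae_integrable hw.norm] with t ht
      refine (ht.const_mul ‖v t‖).congr (.of_forall fun s => ?_)
      simp only [Function.uncurry_apply_pair, smul_eq_mul]
      ring
    · refine (MemLp.integrable_mul hv.norm (hk.memLp hw.norm)).congr (.of_forall fun t => ?_)
      rw [Pi.mul_apply, ← integral_const_mul]
      refine integral_congr_ae (.of_forall fun s => ?_)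
      simp only [Function.uncurry_apply_pair, norm_mul, norm_norm, smul_eq_mul,
        Real.norm_of_nonneg (hk.nonneg _ _)]
      ring
  · exact hk.measurable.aestronglyMeasurable.mul (hv.1.norm.comp_fst.mul hw.1.norm.comp_snd)

theorem IsSchurKernel.integrable_mul_inner [SFinite μ] (hk : IsSchurKernel μ k K) {v w : S → E}
    (hv : MemLp v 2 μ) (hw : MemLp w 2 μ) :
    Integrable (Function.uncurry fun t s => k t s * ⟪w s, v t⟫_ℝ) (μ.prod μ) := by
  refine (hk.integrable_mul_norm hv hw).mono ?_ (.of_forall fun p => ?_)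
  · exact hk.measurable.aestronglyMeasurable.mul
      (AEStronglyMeasurable.inner (𝕜 := ℝ) hw.1.comp_snd hv.1.comp_fst)
  · simp only [Function.uncurry_def, norm_mul, norm_norm]
    gcongr
    rw [mul_comm]
    exact norm_inner_le_norm _ _

theorem inner_kernelOp [SFinite μ] (hk : IsSchurKernel μ k K) (v w : Lp E 2 μ) :
    ⟪kernelOp hk E w, v⟫_ℝ = ∫ t, ∫ s, k t s * ⟪w s, v t⟫_ℝ ∂μ ∂μ := by
  rw [L2.inner_def]
  refine integral_congr_ae ?_
  filter_upwards [coeFn_kernelOp hk w, hk.ae_integrable (Lp.memLp w)] with t h1 h2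
  rw [h1, real_inner_comm, ← integral_inner h2]
  refine integral_congr_ae (.of_forall fun s => ?_)
  simp only [inner_smul_right, real_inner_comm]

theorem inner_kernelOp_swap [SFinite μ] (hk : IsSchurKernel μ k K) (v w : Lp E 2 μ) :
    ⟪kernelOp hk E w, v⟫_ℝ = ⟪w, kernelOp hk.swap E v⟫_ℝ := by
  rw [inner_kernelOp, real_inner_comm, inner_kernelOp,
    integral_integral_swap (hk.integrable_mul_inner (Lp.memLp v) (Lp.memLp w))]
  simp only [real_inner_comm]

end SchurKernelInner

/-! ### Riemann-Liouville integrals: semigroup law and injectivity -/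

section RiemannLiouville

open scoped InnerProductSpace

/-- The kernel `x ↦ x₊^{β-1} / Γ(β)` of the Riemann-Liouville integral. -/
def rlKernel (β x : ℝ) : ℝ := if 0 < x then (Real.Gamma β)⁻¹ * x ^ (β - 1) else 0

theorem rlKernel_of_pos {β x : ℝ} (hx : 0 < x) :
    rlKernel β x = (Real.Gamma β)⁻¹ * x ^ (β - 1) := if_pos hx

theorem rlKernel_of_nonpos {β x : ℝ} (hx : x ≤ 0) : rlKernel β x = 0 := if_neg hx.not_gt

theorem rlKernel_nonneg {β : ℝ} (hβ : 0 < β) (x : ℝ) : 0 ≤ rlKernel β x := by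
  rw [rlKernel]
  split_ifs with h
  · have := Real.Gamma_pos_of_pos hβ
    positivity
  · exact le_rfl

theorem measurable_rlKernel (β : ℝ) : Measurable (rlKernel β) :=
  Measurable.ite measurableSet_Ioi (by fun_prop) measurable_const

theorem rlKernel_one {x : ℝ} (hx : 0 < x) : rlKernel 1 x = 1 := by
  rw [rlKernel_of_pos hx]
  simp

theorem integrableOn_rlKernel {β : ℝ} (hβ : 0 < β) (T : ℝ) :
    IntegrableOn (rlKernel β) (Ioo 0 T) := by
  rcases le_or_gt T 0 with hT | hT
  · rw [Ioo_eq_empty (not_lt.mpr hT)]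
    exact integrableOn_empty
  have h : IntervalIntegrable (fun x : ℝ => x ^ (β - 1)) volume 0 T :=
    intervalIntegral.intervalIntegrable_rpow' (by linarith)
  rw [intervalIntegrable_iff_integrableOn_Ioo_of_le hT.le] at h
  exact IntegrableOn.congr_fun (h.const_mul (Real.Gamma β)⁻¹) (fun x hx => (rlKernel_of_pos hx.1).symm)
    measurableSet_Ioo

/-- Differences of points of `(0,T)` are less than `T`, so cutting the kernel off at `T` changes
nothing there and makes it integrable on the line; translation invariance then bounds both marginals
by its integral. -/
theorem isSchurKernel_rlKernel {β : ℝ} (hβ : 0 < β) (T : ℝ) :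
    IsSchurKernel (volume.restrict (Ioo 0 T))
      (fun t s => (Ioo 0 T).indicator (rlKernel β) (t - s)) (∫ x in Ioo 0 T, rlKernel β x) := by
  have hm : Measurable ((Ioo 0 T).indicator (rlKernel β)) :=
    (measurable_rlKernel β).indicator measurableSet_Ioo
  have hn : ∀ x, 0 ≤ (Ioo 0 T).indicator (rlKernel β) x :=
    fun x => indicator_nonneg (fun y _ => rlKernel_nonneg hβ y) x
  have hint : ∫⁻ x, ENNReal.ofReal ((Ioo 0 T).indicator (rlKernel β) x) =
      ENNReal.ofReal (∫ x in Ioo 0 T, rlKernel β x) := by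
    rw [← integral_indicator measurableSet_Ioo, ofReal_integral_eq_lintegral_ofReal]
    · exact (integrableOn_rlKernel hβ T).integrable_indicator measurableSet_Ioo
    · exact .of_forall hn
  refine ⟨setIntegral_nonneg measurableSet_Ioo fun x _ => rlKernel_nonneg hβ x,
    hm.comp (measurable_fst.sub measurable_snd), fun t s => hn _, fun t => ?_, fun s => ?_⟩
  · refine (lintegral_mono' Measure.restrict_le_self le_rfl).trans ?_
    rw [lintegral_sub_left_eq_self (fun x => ENNReal.ofReal ((Ioo 0 T).indicator (rlKernel β) x)),
      hint]
  · refine (lintegral_mono' Measure.restrict_le_self le_rfl).trans ?_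
    rw [lintegral_sub_right_eq_self (fun x => ENNReal.ofReal ((Ioo 0 T).indicator (rlKernel β) x)),
      hint]

theorem indicator_rlKernel {β T t s : ℝ} (ht : t ∈ Ioo 0 T) (hs : s ∈ Ioo 0 T) :
    (Ioo 0 T).indicator (rlKernel β) (t - s) = rlKernel β (t - s) := by
  rcases le_or_gt (t - s) 0 with h | h
  · rw [indicator_of_notMem (fun h' => h'.1.not_ge h), rlKernel_of_nonpos h]
  · rw [indicator_of_mem (show t - s ∈ Ioo 0 T from ⟨h, by linarith [ht.2, hs.1]⟩)]

theorem integral_rpow_mul_rpow {a b c : ℝ} (ha : 0 < a) (hb : 0 < b) (hc : 0 < c) :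
    ∫ x in (0 : ℝ)..c, x ^ (a - 1) * (c - x) ^ (b - 1) =
      c ^ (a + b - 1) * (Real.Gamma a * Real.Gamma b / Real.Gamma (a + b)) := by
  have h := Complex.betaIntegral_scaled a b hc
  rw [Complex.betaIntegral_eq_Gamma_mul_div _ _ (by simpa) (by simpa), ← Complex.ofReal_add,
    Complex.Gamma_ofReal, Complex.Gamma_ofReal, Complex.Gamma_ofReal] at h
  have e : ∫ x in (0 : ℝ)..c, (x : ℂ) ^ ((a : ℂ) - 1) * ((c : ℂ) - x) ^ ((b : ℂ) - 1) =
      ((∫ x in (0 : ℝ)..c, x ^ (a - 1) * (c - x) ^ (b - 1) : ℝ) : ℂ) := by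
    rw [← intervalIntegral.integral_ofReal]
    refine intervalIntegral.integral_congr fun x hx => ?_
    rw [uIcc_of_le hc.le] at hx
    simp only [Complex.ofReal_mul]
    rw [Complex.ofReal_cpow hx.1, Complex.ofReal_cpow (sub_nonneg.mpr hx.2)]
    push_cast
    rfl
  rw [e] at h
  have e2 : (c : ℂ) ^ ((a + b : ℝ) - 1 : ℂ) = ((c ^ (a + b - 1) : ℝ) : ℂ) := by
    rw [Complex.ofReal_cpow hc.le]
    push_cast
    rfl
  rw [e2] at h
  exact_mod_cast h

/-- Euler's beta integral, shifted by `r`. With the kernel extended by zero the identity also holds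
for `t ≤ r`, where both sides vanish. -/
theorem integral_rlKernel_mul_rlKernel {a b T t r : ℝ} (ha : 0 < a) (hb : 0 < b)
    (hr : 0 ≤ r) (ht : t ≤ T) :
    ∫ s in Ioo 0 T, rlKernel a (t - s) * rlKernel b (s - r) = rlKernel (a + b) (t - r) := by
  have hGa := Real.Gamma_pos_of_pos ha
  have hGb := Real.Gamma_pos_of_pos hb
  have e : ∀ s, rlKernel a (t - s) * rlKernel b (s - r) = (Ioo r t).indicator (fun s =>
      (Real.Gamma a)⁻¹ * (Real.Gamma b)⁻¹ * ((s - r) ^ (b - 1) * (t - s) ^ (a - 1))) s := by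
    intro s
    by_cases hs : s ∈ Ioo r t
    · rw [indicator_of_mem hs, rlKernel_of_pos (sub_pos.mpr hs.2), rlKernel_of_pos (sub_pos.mpr hs.1)]
      ring
    · rw [indicator_of_notMem hs]
      rw [mem_Ioo, not_and_or, not_lt, not_lt] at hs
      rcases hs with h | h
      · rw [rlKernel_of_nonpos (sub_nonpos.mpr h), mul_zero]
      · rw [rlKernel_of_nonpos (sub_nonpos.mpr h), zero_mul]
  simp only [e]
  rw [setIntegral_indicator measurableSet_Ioo, inter_eq_self_of_subset_right (Ioo_subset_Ioo hr ht),
    integral_const_mul]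
  rcases le_or_gt t r with h | h
  · rw [Ioo_eq_empty (not_lt.mpr h), rlKernel_of_nonpos (sub_nonpos.mpr h)]
    simp
  · rw [← integral_Ioc_eq_integral_Ioo, ← intervalIntegral.integral_of_le h.le]
    have h1 : ∫ s in r..t, (s - r) ^ (b - 1) * (t - s) ^ (a - 1) =
        ∫ x in (0 : ℝ)..(t - r), x ^ (b - 1) * ((t - r) - x) ^ (a - 1) := by
      have := intervalIntegral.integral_comp_sub_right (a := r) (b := t)
        (fun x => x ^ (b - 1) * ((t - r) - x) ^ (a - 1)) r
      rw [sub_self] at this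
      rw [← this]
      refine intervalIntegral.integral_congr fun s _ => ?_
      congr 2
      ring
    rw [h1, integral_rpow_mul_rpow hb ha (sub_pos.mpr h), rlKernel_of_pos (sub_pos.mpr h),
      add_comm b a]
    field_simp

/-- The Riemann-Liouville integral as an operator on `L²(0,T;E)`. -/
def rlOp (T : ℝ) {β : ℝ} (hβ : 0 < β) (E : Type*) [NormedAddCommGroup E] [NormedSpace ℝ E] :
    L2Time T E →L[ℝ] L2Time T E :=
  kernelOp (isSchurKernel_rlKernel hβ T) E

variable {E F : Type*} [NormedAddCommGroup E] [NormedSpace ℝ E] [NormedAddCommGroup F]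
  [NormedSpace ℝ F] {T β : ℝ}

theorem rlIntegral_eq_setIntegral {t : ℝ} (ht : t ∈ Ioo 0 T) (w : ℝ → E) :
    rlIntegral β w t =
      ∫ s in Ioo 0 T, (Ioo 0 T).indicator (rlKernel β) (t - s) • w s := by
  have e : ∀ s ∈ Ioo 0 T, (Ioo 0 T).indicator (rlKernel β) (t - s) • w s =
      (Ioo 0 t).indicator (fun s => (Real.Gamma β)⁻¹ • (t - s) ^ (β - 1) • w s) s := by
    intro s hs
    rw [indicator_rlKernel ht hs]
    by_cases h : s < t
    · rw [rlKernel_of_pos (sub_pos.mpr h), indicator_of_mem (show s ∈ Ioo 0 t from ⟨hs.1, h⟩), smul_smul]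
    · rw [rlKernel_of_nonpos (by linarith), indicator_of_notMem (fun h' => h h'.2), zero_smul]
  rw [setIntegral_congr_fun measurableSet_Ioo e, setIntegral_indicator measurableSet_Ioo,
    inter_eq_self_of_subset_right (Ioo_subset_Ioo le_rfl ht.2.le), integral_smul, rlIntegral,
    intervalIntegral.integral_of_le ht.1.le, integral_Ioc_eq_integral_Ioo]

theorem coeFn_rlOp (hβ : 0 < β) (w : L2Time T E) :
    rlOp T hβ E w =ᵐ[volume.restrict (Ioo 0 T)] rlIntegral β w := by
  filter_upwards [coeFn_kernelOp (isSchurKernel_rlKernel hβ T) w,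
    ae_restrict_mem measurableSet_Ioo] with t h1 h2
  rw [rlIntegral_eq_setIntegral h2]
  exact h1

theorem rlIntegral_one (w : ℝ → E) (t : ℝ) : rlIntegral 1 w t = ∫ s in (0 : ℝ)..t, w s := by
  simp [rlIntegral]

theorem rlIntegral_congr_ae {v w : ℝ → E} (h : v =ᵐ[volume.restrict (Ioo 0 T)] w) {t : ℝ}
    (ht : t ∈ Ioo 0 T) : rlIntegral β v t = rlIntegral β w t := by
  rw [rlIntegral_eq_setIntegral ht, rlIntegral_eq_setIntegral ht]
  refine integral_congr_ae ?_
  filter_upwards [h] with s hs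
  rw [hs]

theorem compLp_rlOp [CompleteSpace E] [CompleteSpace F] (hβ : 0 < β) (A : E →L[ℝ] F)
    (w : L2Time T E) : A.compLp (rlOp T hβ E w) = rlOp T hβ F (A.compLp w) :=
  compLp_kernelOp _ A w

theorem rlOp_rlOp [CompleteSpace E] {a b c : ℝ} (ha : 0 < a) (hb : 0 < b) (hc : 0 < c)
    (habc : a + b = c) (w : L2Time T E) :
    rlOp T ha E (rlOp T hb E w) = rlOp T hc E w := by
  subst habc
  refine kernelOp_kernelOp _ _ _ ?_ w
  filter_upwards [ae_restrict_mem measurableSet_Ioo] with t ht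
  filter_upwards [ae_restrict_mem measurableSet_Ioo] with r hr
  rw [indicator_rlKernel ht hr, ← integral_rlKernel_mul_rlKernel ha hb hr.1.le ht.2.le]
  refine setIntegral_congr_fun measurableSet_Ioo fun s hs => ?_
  rw [indicator_rlKernel ht hs, indicator_rlKernel hs hr]

/-- A primitive that vanishes almost everywhere vanishes on the whole open interval by continuity,
and Lebesgue differentiation recovers the integrand. -/
theorem rlOp_one_injective [CompleteSpace E] :
    Function.Injective (rlOp T one_pos E) := by
  rw [injective_iff_map_eq_zero]
  intro w hw
  rcases le_or_gt T 0 with hT | hT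
  · apply Lp.ext
    have : ∀ᵐ t ∂volume.restrict (Ioo 0 T), t ∈ Ioo 0 T := ae_restrict_mem measurableSet_Ioo
    filter_upwards [this] with t ht
    exact absurd (ht.1.trans ht.2) (not_lt.mpr hT)
  have hint : IntervalIntegrable w volume 0 T := by
    rw [intervalIntegrable_iff_integrableOn_Ioo_of_le hT.le]
    exact (Lp.memLp w).integrable (by norm_num)
  have hcont : ContinuousOn (fun t => ∫ s in (0 : ℝ)..t, w s) (Icc 0 T) :=
    intervalIntegral.continuousOn_primitive_interval' hint left_mem_uIcc |>.mono
      (by rw [uIcc_of_le hT.le])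
  have h0 : (fun t => ∫ s in (0 : ℝ)..t, w s) =ᵐ[volume.restrict (Ioo 0 T)] fun _ => 0 := by
    have h1 := coeFn_rlOp one_pos w
    rw [hw] at h1
    filter_upwards [h1, Lp.coeFn_zero E 2 (volume.restrict (Ioo 0 T))] with t ht ht0
    rw [← rlIntegral_one, ← ht, ht0, Pi.zero_apply]
  have h2 : EqOn (fun t => ∫ s in (0 : ℝ)..t, w s) (fun _ => 0) (Ioo 0 T) :=
    Measure.eqOn_open_of_ae_eq h0 isOpen_Ioo (hcont.mono Ioo_subset_Icc_self) continuousOn_const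
  apply Lp.ext
  filter_upwards [ae_restrict_of_ae hint.ae_hasDerivAt_integral, ae_restrict_mem measurableSet_Ioo,
    Lp.coeFn_zero E 2 (volume.restrict (Ioo 0 T))] with t ht htT h0
  have h3 := ht (by rw [uIcc_of_le hT.le]; exact Ioo_subset_Icc_self htT) 0 left_mem_uIcc
  have h4 : HasDerivAt (fun t => ∫ s in (0 : ℝ)..t, w s) 0 t :=
    (hasDerivAt_const t (0 : E)).congr_of_eventuallyEq (h2.eventuallyEq_of_mem (isOpen_Ioo.mem_nhds htT))
  rw [h3.unique h4, h0, Pi.zero_apply]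

/-- Composing with the integral of order `1 - β` reduces this to order one. -/
theorem rlOp_injective [CompleteSpace E] (hβ : 0 < β) (hβ1 : β < 1) :
    Function.Injective (rlOp T hβ E) := by
  intro v w h
  apply rlOp_one_injective (T := T)
  rw [← rlOp_rlOp (sub_pos.mpr hβ1) hβ one_pos (by ring) v, h, rlOp_rlOp]
  ring

end RiemannLiouville

/-! ### Positivity of the Riemann-Liouville integral -/

section Accretive

open scoped InnerProductSpace

/-- Near zero `0 < a` suffices; at infinity the integrand decays like `x ^ (2 * a - 2)`, which is
where `a < 1/2` enters. -/
theorem integrableOn_one_add_rpow_mul_rpow {a : ℝ} (ha : 0 < a) (ha2 : a < 1 / 2) :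
    IntegrableOn (fun x : ℝ => (1 + x) ^ (a - 1) * x ^ (a - 1)) (Ioi 0) := by
  have hm : Measurable (fun x : ℝ => (1 + x) ^ (a - 1) * x ^ (a - 1)) := by fun_prop
  rw [← Ioc_union_Ioi_eq_Ioi zero_le_one]
  refine IntegrableOn.union ?_ ?_
  · have h : IntervalIntegrable (fun x : ℝ => x ^ (a - 1)) volume 0 1 :=
      intervalIntegral.intervalIntegrable_rpow' (by linarith)
    rw [intervalIntegrable_iff_integrableOn_Ioc_of_le zero_le_one] at h
    refine h.mono' hm.aestronglyMeasurable ?_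
    filter_upwards [ae_restrict_mem measurableSet_Ioc] with x hx
    have hx0 := hx.1
    rw [Real.norm_of_nonneg (by positivity)]
    have : (1 + x) ^ (a - 1) ≤ 1 :=
      Real.rpow_le_one_of_one_le_of_nonpos (by linarith) (by linarith)
    have h2 : 0 ≤ x ^ (a - 1) := by positivity
    nlinarith
  · have h := integrableOn_Ioi_rpow_of_lt (show 2 * a - 2 < -1 by linarith) zero_lt_one
    refine h.mono' hm.aestronglyMeasurable ?_
    filter_upwards [ae_restrict_mem measurableSet_Ioi] with x hx
    have hx0 : 0 < x := zero_lt_one.trans hx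
    rw [Real.norm_of_nonneg (by positivity)]
    have : (1 + x) ^ (a - 1) ≤ x ^ (a - 1) :=
      Real.rpow_le_rpow_of_nonpos hx0 (by linarith) (by linarith)
    have h2 : 0 ≤ x ^ (a - 1) := by positivity
    calc (1 + x) ^ (a - 1) * x ^ (a - 1) ≤ x ^ (a - 1) * x ^ (a - 1) := by gcongr
      _ = x ^ (2 * a - 2) := by
        rw [← Real.rpow_add hx0]
        ring_nf

/-- The autocorrelation of the kernel of order `a` is, up to a constant, the symmetrized kernel of
order `2a`. -/
theorem exists_integral_rlKernel_sub {a : ℝ} (ha : 0 < a) (ha2 : a < 1 / 2) :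
    ∃ c : ℝ, 0 < c ∧ ∀ t s : ℝ, t ≠ s →
      Integrable (fun r => rlKernel a (t - r) * rlKernel a (s - r)) ∧
      ∫ r, rlKernel a (t - r) * rlKernel a (s - r) =
        c * (rlKernel (2 * a) (t - s) + rlKernel (2 * a) (s - t)) := by
  have hG := Real.Gamma_pos_of_pos ha
  have hG2 := Real.Gamma_pos_of_pos (show 0 < 2 * a by linarith)
  set c₀ : ℝ := ∫ x in Ioi (0 : ℝ), (1 + x) ^ (a - 1) * x ^ (a - 1) with hc₀
  have hpos : ∀ x ∈ Ioi (0 : ℝ), 0 < (1 + x) ^ (a - 1) * x ^ (a - 1) := fun x hx => by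
    have : (0 : ℝ) < x := hx
    positivity
  have hc₀n : 0 < c₀ := by
    refine (setIntegral_pos_iff_support_of_nonneg_ae ?_
      (integrableOn_one_add_rpow_mul_rpow ha ha2)).mpr ?_
    · filter_upwards [ae_restrict_mem measurableSet_Ioi] with x hx using (hpos x hx).le
    · have hsub : Ioi 0 ⊆ Function.support fun x : ℝ => (1 + x) ^ (a - 1) * x ^ (a - 1) :=
        fun x hx => (hpos x hx).ne'
      rw [inter_eq_self_of_subset_right hsub, Real.volume_Ioi]
      exact ENNReal.zero_lt_top
  -- Substituting `δ * x` for `x` extracts the power `δ ^ (2 * a - 1)` and leaves the constant `c₀`.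
  have main : ∀ δ : ℝ, 0 < δ →
      Integrable (fun x => rlKernel a (δ + x) * rlKernel a x) ∧
      ∫ x, rlKernel a (δ + x) * rlKernel a x =
        Real.Gamma (2 * a) * (Real.Gamma a)⁻¹ ^ 2 * c₀ * rlKernel (2 * a) δ := by
    intro δ hδ
    have e : (fun x => rlKernel a (δ + x) * rlKernel a x) = (Ioi (0 : ℝ)).indicator (fun x =>
        (Real.Gamma a)⁻¹ ^ 2 * ((δ + x) ^ (a - 1) * x ^ (a - 1))) := by
      funext x
      by_cases hx : 0 < x
      · rw [indicator_of_mem (show x ∈ Ioi 0 from hx), rlKernel_of_pos hx,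
          rlKernel_of_pos (by linarith)]
        ring
      · rw [indicator_of_notMem (show x ∉ Ioi 0 from hx), rlKernel_of_nonpos (not_lt.mp hx),
          mul_zero]
    have e2 : EqOn (fun x : ℝ => (δ + δ * x) ^ (a - 1) * (δ * x) ^ (a - 1))
        (fun x => δ ^ (2 * a - 2) * ((1 + x) ^ (a - 1) * x ^ (a - 1))) (Ioi 0) := by
      intro x hx
      have hx0 : (0 : ℝ) < x := hx
      simp only
      rw [show δ + δ * x = δ * (1 + x) by ring, Real.mul_rpow hδ.le (by positivity),
        Real.mul_rpow hδ.le hx0.le, show 2 * a - 2 = (a - 1) + (a - 1) by ring, Real.rpow_add hδ]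
      ring
    have hi : IntegrableOn (fun x : ℝ => (δ + x) ^ (a - 1) * x ^ (a - 1)) (Ioi 0) := by
      have := integrableOn_Ioi_comp_mul_left_iff
        (fun x : ℝ => (δ + x) ^ (a - 1) * x ^ (a - 1)) 0 hδ
      rw [mul_zero] at this
      rw [← this]
      refine IntegrableOn.congr_fun ?_ e2.symm measurableSet_Ioi
      exact (integrableOn_one_add_rpow_mul_rpow ha ha2).const_mul _
    rw [e]
    refine ⟨?_, ?_⟩
    · rw [integrable_indicator_iff measurableSet_Ioi]
      exact hi.const_mul _
    · rw [integral_indicator measurableSet_Ioi, integral_const_mul, rlKernel_of_pos hδ]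
      have h1 := integral_comp_mul_left_Ioi
        (fun x : ℝ => (δ + x) ^ (a - 1) * x ^ (a - 1)) 0 hδ
      rw [mul_zero, setIntegral_congr_fun measurableSet_Ioi e2, integral_const_mul, ← hc₀,
        smul_eq_mul] at h1
      have h2 : ∫ x in Ioi (0 : ℝ), (δ + x) ^ (a - 1) * x ^ (a - 1) =
          δ ^ (2 * a - 1) * c₀ := by
        have h3 : δ ^ (2 * a - 1) = δ * δ ^ (2 * a - 2) := by
          rw [show 2 * a - 1 = 1 + (2 * a - 2) by ring, Real.rpow_add hδ, Real.rpow_one]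
        rw [h3, mul_assoc, h1]
        field_simp
      rw [h2]
      field_simp
  refine ⟨Real.Gamma (2 * a) * (Real.Gamma a)⁻¹ ^ 2 * c₀, by positivity, ?_⟩
  have main2 : ∀ t s : ℝ, s < t →
      Integrable (fun r => rlKernel a (t - r) * rlKernel a (s - r)) ∧
      ∫ r, rlKernel a (t - r) * rlKernel a (s - r) =
        Real.Gamma (2 * a) * (Real.Gamma a)⁻¹ ^ 2 * c₀ *
          (rlKernel (2 * a) (t - s) + rlKernel (2 * a) (s - t)) := by
    intro t s hst
    obtain ⟨h1, h2⟩ := main (t - s) (sub_pos.mpr hst)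
    have e : (fun r => rlKernel a (t - r) * rlKernel a (s - r)) =
        fun r => (fun x => rlKernel a (t - s + x) * rlKernel a x) (s - r) := by
      funext r
      simp only
      congr 2
      ring
    rw [e]
    refine ⟨h1.comp_sub_left s, ?_⟩
    rw [integral_sub_left_eq_self (fun x => rlKernel a (t - s + x) * rlKernel a x), h2,
      rlKernel_of_nonpos (show s - t ≤ 0 by linarith), add_zero]
  intro t s hts
  rcases lt_or_gt_of_ne hts with h | h
  · obtain ⟨h1, h2⟩ := main2 s t h
    simp only [mul_comm (rlKernel a (t - _)), add_comm (rlKernel (2 * a) (t - s))]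
    exact ⟨h1, h2⟩
  · exact main2 t s h

variable {E : Type*} [NormedAddCommGroup E] [InnerProductSpace ℝ E] [CompleteSpace E]

/-- Here `r` runs over the whole line: on `(0,T)` this is Schur's test, for `r < 0` the kernel is
bounded on `(0,T)`, and for `r ≥ T` it vanishes there. -/
theorem ae_integrable_rlKernel_smul {a T : ℝ} (ha : 0 < a) (ha1 : a < 1) {w : ℝ → E}
    (hw : MemLp w 2 (volume.restrict (Ioo 0 T))) :
    ∀ᵐ r : ℝ, Integrable (fun t => rlKernel a (t - r) • w t) (volume.restrict (Ioo 0 T)) := by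
  have h1 : ∀ᵐ r : ℝ, r ∈ Ioo 0 T →
      Integrable (fun t => rlKernel a (t - r) • w t) (volume.restrict (Ioo 0 T)) := by
    rw [← ae_restrict_iff' measurableSet_Ioo]
    filter_upwards [(isSchurKernel_rlKernel ha T).swap.ae_integrable hw,
      ae_restrict_mem measurableSet_Ioo] with r hr hrT
    refine hr.congr ?_
    filter_upwards [ae_restrict_mem measurableSet_Ioo] with t ht
    rw [indicator_rlKernel ht hrT]
  filter_upwards [h1, Measure.ae_ne volume (0 : ℝ)] with r hr hr0
  rcases lt_or_gt_of_ne hr0 with h | h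
  · have hwi : Integrable w (volume.restrict (Ioo 0 T)) := hw.integrable (by norm_num)
    refine hwi.bdd_smul (C := (Real.Gamma a)⁻¹ * (-r) ^ (a - 1)) ?_ ?_
    · exact ((measurable_rlKernel a).comp (measurable_id.sub_const r)).aestronglyMeasurable
    · filter_upwards [ae_restrict_mem measurableSet_Ioo] with t ht
      rw [Real.norm_of_nonneg (rlKernel_nonneg ha _), rlKernel_of_pos (by linarith [ht.1])]
      have := Real.Gamma_pos_of_pos ha
      gcongr ?_ * ?_
      exact Real.rpow_le_rpow_of_nonpos (by linarith) (by linarith [ht.1]) (by linarith)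
  · by_cases hT : r < T
    · exact hr ⟨h, hT⟩
    · refine (integrable_zero ℝ E _).congr ?_
      filter_upwards [ae_restrict_mem measurableSet_Ioo] with t ht
      rw [rlKernel_of_nonpos (by linarith [ht.2]), zero_smul, Pi.zero_apply]

/-- Symmetrized, the kernel of order `2a` is an autocorrelation, so by Fubini the quadratic form is
a multiple of `∫ ‖∫ g (t - r) • w t‖²` over all real `r`. Keeping only `r` in `(0,T)` leaves the
squared norm of the adjoint integral of order `a`. -/
theorem exists_norm_kernelOp_swap_sq_le {a : ℝ} (ha : 0 < a) (ha2 : a < 1 / 2) (T : ℝ) (E : Type*)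
    [NormedAddCommGroup E] [InnerProductSpace ℝ E] [CompleteSpace E] :
    ∃ c : ℝ, 0 < c ∧ ∀ w : L2Time T E, ‖kernelOp (isSchurKernel_rlKernel ha T).swap E w‖ ^ 2 ≤
        c * ⟪rlOp T (show 0 < 2 * a by linarith) E w, w⟫_ℝ := by
  obtain ⟨c, hc, H⟩ := exists_integral_rlKernel_sub ha ha2
  refine ⟨2 * c, by positivity, fun w => ?_⟩
  set μ : Measure ℝ := volume.restrict (Ioo 0 T) with hμ
  have hw : MemLp w 2 μ := Lp.memLp w
  have hk := isSchurKernel_rlKernel (show 0 < 2 * a by linarith) T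
  set k : ℝ → ℝ → ℝ := fun t s => (Ioo 0 T).indicator (rlKernel (2 * a)) (t - s) with hkdef
  set g : ℝ → ℝ := rlKernel a with hg
  have hgm : Measurable g := measurable_rlKernel a
  have hgn : ∀ x, 0 ≤ g x := rlKernel_nonneg ha
  -- The autocorrelation formula is only available off the diagonal, which is a null set.
  have hne : ∀ᵐ p ∂μ.prod μ, p.1 ∈ Ioo 0 T ∧ p.2 ∈ Ioo 0 T ∧ p.1 ≠ p.2 := by
    have hm : MeasurableSet {p : ℝ × ℝ | p.1 ∈ Ioo 0 T ∧ p.2 ∈ Ioo 0 T ∧ p.1 ≠ p.2} :=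
      (measurable_fst measurableSet_Ioo).inter ((measurable_snd measurableSet_Ioo).inter
        (measurableSet_eq_fun measurable_fst measurable_snd).compl)
    rw [Measure.ae_prod_iff_ae_ae hm]
    filter_upwards [ae_restrict_mem measurableSet_Ioo] with t ht
    filter_upwards [ae_restrict_mem measurableSet_Ioo,
      ae_restrict_of_ae (Measure.ae_ne volume t)] with s hs hts
    exact ⟨ht, hs, hts.symm⟩
  have hH : ∀ᵐ p ∂μ.prod μ, Integrable (fun r => g (p.1 - r) * g (p.2 - r)) ∧
      ∫ r, g (p.1 - r) * g (p.2 - r) = c * (k p.1 p.2 + k p.2 p.1) := by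
    filter_upwards [hne] with p hp
    rw [hkdef]
    simp only
    rw [indicator_rlKernel hp.1 hp.2.1, indicator_rlKernel hp.2.1 hp.1]
    exact H _ _ hp.2.2
  let f : ℝ × ℝ → ℝ → ℝ := fun p r => g (p.1 - r) * g (p.2 - r) * ⟪w p.2, w p.1⟫_ℝ
  have hinner : AEStronglyMeasurable (fun p : ℝ × ℝ => ⟪w p.2, w p.1⟫_ℝ) (μ.prod μ) :=
    AEStronglyMeasurable.inner (𝕜 := ℝ) hw.1.comp_snd hw.1.comp_fst
  have hf : Integrable (Function.uncurry f) ((μ.prod μ).prod volume) := by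
    rw [integrable_prod_iff]
    · refine ⟨?_, ?_⟩
      · filter_upwards [hH] with p hp
        exact hp.1.mul_const ⟪w p.2, w p.1⟫_ℝ
      · have h1 := (hk.integrable_mul_inner hw hw).norm
        have h2 := (hk.swap.integrable_mul_inner hw hw).norm
        refine ((h1.add h2).const_mul c).congr ?_
        filter_upwards [hH] with p hp
        simp only [Function.uncurry_def, f, norm_mul, Pi.add_apply, Real.norm_of_nonneg (hgn _),
          Real.norm_of_nonneg (hk.nonneg _ _)]
        rw [integral_mul_const, hp.2]
        ring
    · refine AEStronglyMeasurable.mul ?_ hinner.comp_fst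
      refine Measurable.aestronglyMeasurable ?_
      exact (hgm.comp ((measurable_fst.comp measurable_fst).sub measurable_snd)).mul
        (hgm.comp ((measurable_snd.comp measurable_fst).sub measurable_snd))
  have hswap := integral_integral_swap hf
  have hL : ∫ p, (∫ r, f p r) ∂μ.prod μ = 2 * c * ⟪rlOp T (show 0 < 2 * a by linarith) E w, w⟫_ℝ := by
    have e1 : ∫ p, (∫ r, f p r) ∂μ.prod μ = ∫ p, c * (k p.1 p.2 * ⟪w p.2, w p.1⟫_ℝ +
        k p.2 p.1 * ⟪w p.2, w p.1⟫_ℝ) ∂μ.prod μ := by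
      refine integral_congr_ae ?_
      filter_upwards [hH] with p hp
      simp only [f]
      rw [integral_mul_const, hp.2]
      ring
    have i1 := hk.integrable_mul_inner hw hw
    have i2 := hk.swap.integrable_mul_inner hw hw
    rw [e1, integral_const_mul]
    have e2 : ∫ p, (k p.1 p.2 * ⟪w p.2, w p.1⟫_ℝ + k p.2 p.1 * ⟪w p.2, w p.1⟫_ℝ) ∂μ.prod μ =
        ∫ p, k p.1 p.2 * ⟪w p.2, w p.1⟫_ℝ ∂μ.prod μ +
        ∫ p, k p.2 p.1 * ⟪w p.2, w p.1⟫_ℝ ∂μ.prod μ := integral_add i1 i2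
    have e3 : ∫ p, k p.1 p.2 * ⟪w p.2, w p.1⟫_ℝ ∂μ.prod μ =
        ⟪rlOp T (show 0 < 2 * a by linarith) E w, w⟫_ℝ := by
      rw [rlOp, inner_kernelOp]
      exact integral_prod _ i1
    have e4 : ∫ p, k p.2 p.1 * ⟪w p.2, w p.1⟫_ℝ ∂μ.prod μ =
        ⟪rlOp T (show 0 < 2 * a by linarith) E w, w⟫_ℝ := by
      rw [rlOp, inner_kernelOp_swap, real_inner_comm, inner_kernelOp]
      exact integral_prod _ i2
    rw [e2, e3, e4]
    ring
  have hR : ∀ᵐ r : ℝ, ∫ p, f p r ∂μ.prod μ = ‖∫ t, g (t - r) • w t ∂μ‖ ^ 2 := by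
    filter_upwards [ae_integrable_rlKernel_smul ha (by linarith) hw, hf.swap.prod_right_ae]
      with r hr hfr
    have hfr' : Integrable (fun p => f p r) (μ.prod μ) := hfr
    rw [integral_prod _ hfr', ← real_inner_self_eq_norm_sq, ← integral_inner hr]
    refine integral_congr_ae (.of_forall fun t => ?_)
    simp only
    rw [real_inner_comm, ← integral_inner hr]
    refine integral_congr_ae (.of_forall fun s => ?_)
    simp only [f, inner_smul_left, inner_smul_right, RCLike.conj_to_real, real_inner_comm]
    ring
  have hRi : Integrable (fun r : ℝ => ‖∫ t, g (t - r) • w t ∂μ‖ ^ 2) :=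
    hf.integral_prod_right.congr hR
  rw [← hL, hswap, integral_congr_ae hR]
  have e5 : ‖kernelOp (isSchurKernel_rlKernel ha T).swap E w‖ ^ 2 =
      ∫ r in Ioo 0 T, ‖∫ t, g (t - r) • w t ∂μ‖ ^ 2 := by
    rw [← real_inner_self_eq_norm_sq, L2.inner_def]
    refine integral_congr_ae ?_
    filter_upwards [coeFn_kernelOp (isSchurKernel_rlKernel ha T).swap w,
      ae_restrict_mem measurableSet_Ioo] with r hr hrT
    rw [real_inner_self_eq_norm_sq, hr]
    congr 2
    refine setIntegral_congr_fun measurableSet_Ioo fun t ht => ?_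
    rw [indicator_rlKernel ht hrT]
  rw [e5]
  exact setIntegral_le_integral hRi (.of_forall fun r => sq_nonneg _)

/-- The constant function with value `e`. -/
def constTime {E : Type*} [NormedAddCommGroup E] (T : ℝ) (e : E) : L2Time T E := (memLp_const e).toLp (fun _ : ℝ => e)

theorem coeFn_constTime {E : Type*} [NormedAddCommGroup E] (T : ℝ) (e : E) :
    constTime T e =ᵐ[volume.restrict (Ioo 0 T)] fun _ => e := MemLp.coeFn_toLp _

/-- The square of the kernel of order `b` is a multiple of the kernel of order `2 * b - 1 > 0`. -/
theorem memLp_rlKernel {b T : ℝ} (hb : 1 / 2 < b) :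
    MemLp (rlKernel b) 2 (volume.restrict (Ioo 0 T)) := by
  rw [memLp_two_iff_integrable_sq (measurable_rlKernel b).aestronglyMeasurable]
  have h := (integrableOn_rlKernel (show 0 < 2 * b - 1 by linarith) T).const_mul
    ((Real.Gamma b)⁻¹ ^ 2 * Real.Gamma (2 * b - 1))
  refine IntegrableOn.congr_fun h (fun x hx => ?_) measurableSet_Ioo
  have := Real.Gamma_pos_of_pos (show 0 < 2 * b - 1 by linarith)
  rw [rlKernel_of_pos hx.1, rlKernel_of_pos hx.1, mul_pow, ← Real.rpow_natCast (x ^ (b - 1)),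
    ← Real.rpow_mul hx.1.le]
  push_cast
  rw [show (b - 1) * 2 = 2 * b - 1 - 1 by ring]
  field_simp

/-- The Riemann-Liouville integral is accretive, and its quadratic form dominates the square of
the mean. -/
theorem exists_inner_constTime_sq_le {α : ℝ} (hα : 0 < α) (hα1 : α < 1) (T : ℝ) (e : E) :
    ∃ κ : ℝ, 0 < κ ∧ ∀ w : L2Time T E, ⟪w, constTime T e⟫_ℝ ^ 2 ≤ κ * ⟪rlOp T hα E w, w⟫_ℝ := by
  have ha : 0 < α / 2 := by linarith
  obtain ⟨c, hc, H⟩ := exists_norm_kernelOp_swap_sq_le ha (by linarith) T E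
  -- The function whose integral of order `α / 2` is the constant `e`; it is square integrable since
  -- `1 - α / 2 > 1 / 2`.
  have hh : MemLp (fun t => rlKernel (1 - α / 2) t • e) 2 (volume.restrict (Ioo 0 T)) :=
    (ContinuousLinearMap.toSpanSingleton ℝ e).comp_memLp'
      (memLp_rlKernel (show 1 / 2 < 1 - α / 2 by linarith))
  set h : L2Time T E := hh.toLp with hdef
  have hconst : constTime T e = rlOp T ha E h := by
    apply Lp.ext
    filter_upwards [coeFn_constTime T e, coeFn_kernelOp (isSchurKernel_rlKernel ha T) h,
      ae_restrict_mem measurableSet_Ioo] with t h1 h2 ht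
    rw [h1, rlOp, h2]
    have e1 : ∫ s in Ioo 0 T, (Ioo 0 T).indicator (rlKernel (α / 2)) (t - s) • h s =
        ∫ s in Ioo 0 T, (rlKernel (α / 2) (t - s) * rlKernel (1 - α / 2) (s - 0)) • e := by
      refine integral_congr_ae ?_
      filter_upwards [hh.coeFn_toLp, ae_restrict_mem measurableSet_Ioo] with s hs hsT
      rw [hs, indicator_rlKernel ht hsT, smul_smul, sub_zero]
    rw [e1, integral_smul_const, integral_rlKernel_mul_rlKernel ha (by linarith) le_rfl ht.2.le,
      show α / 2 + (1 - α / 2) = 1 by ring, sub_zero, rlKernel_one ht.1, one_smul]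
  have H' : ∀ w : L2Time T E, ‖kernelOp (isSchurKernel_rlKernel ha T).swap E w‖ ^ 2 ≤
        c * ⟪rlOp T hα E w, w⟫_ℝ := by
    intro w
    have := H w
    simp only [show 2 * (α / 2) = α by ring] at this
    exact this
  -- The `+ 1` keeps the constant positive when `e = 0`.
  refine ⟨c * (‖h‖ ^ 2 + 1), by positivity, fun w => ?_⟩
  rw [hconst, real_inner_comm, rlOp, inner_kernelOp_swap, real_inner_comm]
  have h1 := abs_real_inner_le_norm (kernelOp (isSchurKernel_rlKernel ha T).swap E w) h
  have h2 := H' w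
  rw [← sq_abs]
  calc |⟪kernelOp (isSchurKernel_rlKernel ha T).swap E w, h⟫_ℝ| ^ 2
      ≤ (‖kernelOp (isSchurKernel_rlKernel ha T).swap E w‖ * ‖h‖) ^ 2 := by gcongr
    _ = ‖kernelOp (isSchurKernel_rlKernel ha T).swap E w‖ ^ 2 * ‖h‖ ^ 2 := by ring
    _ ≤ (c * ⟪rlOp T hα E w, w⟫_ℝ) * (‖h‖ ^ 2 + 1) := by 
          gcongr
          · exact (sq_nonneg _).trans h2
          · linarith
    _ = _ := by ring

end Accretive

/-! ### Weak and strong measurability in separable spaces -/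

section WeakMeasurability

open scoped InnerProductSpace

variable {S : Type*} [MeasurableSpace S]

/-- A weakly measurable function with values in a separable Hilbert space is strongly
measurable. -/
theorem stronglyMeasurable_of_forall_inner {H : Type*} [NormedAddCommGroup H]
    [InnerProductSpace ℝ H] [SecondCountableTopology H] {f : S → H}
    (hf : ∀ v, Measurable fun t => ⟪f t, v⟫_ℝ) : StronglyMeasurable f := by
  borelize H
  refine Measurable.stronglyMeasurable ?_
  have hball : ∀ (a : H) (r : ℝ), 0 ≤ r → MeasurableSet (f ⁻¹' Metric.closedBall a r) := by
    intro a r hr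
    -- Completing the square, `‖x‖ ≤ r` holds exactly when `2 ⟪x, u⟫ - ‖u‖² ≤ r²` for every `u`, and
    -- a dense sequence of `u` is enough. Closed balls thus have measurable preimages.
    have e : f ⁻¹' Metric.closedBall a r =
        ⋂ n : ℕ, {t | 2 * (⟪f t, TopologicalSpace.denseSeq H n⟫_ℝ -
          ⟪a, TopologicalSpace.denseSeq H n⟫_ℝ) - ‖TopologicalSpace.denseSeq H n‖ ^ 2 ≤ r ^ 2} := by
      ext t
      simp only [mem_preimage, mem_closedBall_iff_norm, mem_iInter, mem_ofPred_eq, ← inner_sub_left]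
      have key : ∀ u : H, 2 * ⟪f t - a, u⟫_ℝ - ‖u‖ ^ 2 = ‖f t - a‖ ^ 2 - ‖f t - a - u‖ ^ 2 := by
        intro u
        rw [norm_sub_sq_real (f t - a) u]
        ring
      constructor
      · intro h n
        rw [key]
        nlinarith [sq_nonneg ‖f t - a - TopologicalSpace.denseSeq H n‖, norm_nonneg (f t - a)]
      · intro h
        have hcl : IsClosed {u : H | 2 * ⟪f t - a, u⟫_ℝ - ‖u‖ ^ 2 ≤ r ^ 2} :=
          isClosed_le (by fun_prop) continuous_const
        have h2 : ∀ u : H, 2 * ⟪f t - a, u⟫_ℝ - ‖u‖ ^ 2 ≤ r ^ 2 := fun u =>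
          (TopologicalSpace.denseRange_denseSeq H).induction_on u hcl h
        have h3 := h2 (f t - a)
        rw [key, sub_self, norm_zero] at h3
        exact abs_le_of_sq_le_sq' (by linarith) hr |>.2
    rw [e]
    exact MeasurableSet.iInter fun n =>
      measurableSet_le (((hf _).sub_const _).const_mul 2 |>.sub_const _) measurable_const
  refine measurable_of_isOpen fun U hU => ?_
  let I : Set (ℕ × ℕ) := {p | Metric.closedBall (TopologicalSpace.denseSeq H p.1)
    ((p.2 + 1 : ℝ)⁻¹) ⊆ U}
  have hU' : U = ⋃ p ∈ I, Metric.closedBall (TopologicalSpace.denseSeq H p.1)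
      ((p.2 + 1 : ℝ)⁻¹) := by
    refine subset_antisymm (fun x hx => ?_) (iUnion₂_subset fun p hp => hp)
    obtain ⟨ε, hε, hεU⟩ := Metric.isOpen_iff.mp hU x hx
    obtain ⟨k, hk⟩ := exists_nat_one_div_lt (half_pos hε)
    rw [one_div] at hk
    have hk0 : (0 : ℝ) < (k + 1 : ℝ)⁻¹ := by positivity
    obtain ⟨n, hn⟩ := (TopologicalSpace.denseRange_denseSeq H).exists_dist_lt x hk0
    refine mem_iUnion₂.mpr ⟨(n, k), fun y hy => hεU ?_, hn.le⟩
    rw [Metric.mem_closedBall] at hy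
    rw [Metric.mem_ball]
    have := dist_triangle_right y x (TopologicalSpace.denseSeq H n)
    simp only at hy
    linarith
  rw [hU']
  simp only [preimage_iUnion]
  exact MeasurableSet.biUnion (to_countable _) fun p _ => hball _ _ (by positivity)

/-- Approximation of `w` by simple functions; the family of operators need only be measurable on
each fixed vector. -/
theorem stronglyMeasurable_clm_apply {E F : Type*} [NormedAddCommGroup E] [NormedSpace ℝ E]
    [NormedAddCommGroup F] [NormedSpace ℝ F] {M : S → E →L[ℝ] F}
    (hM : ∀ e, StronglyMeasurable fun t => M t e) {w : S → E} (hw : StronglyMeasurable w) :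
    StronglyMeasurable fun t => M t (w t) := by
  have hs : ∀ s : SimpleFunc S E, StronglyMeasurable fun t => M t (s t) := by
    intro s
    have e : (fun t => M t (s t)) =
        fun t => ∑ y ∈ s.range, (s ⁻¹' {y}).indicator (fun t => M t y) t := by
      funext t
      rw [Finset.sum_eq_single (s t)]
      · rw [indicator_of_mem (by simp)]
      · intro y _ hy
        exact indicator_of_notMem (fun h => hy h.symm) _
      · exact fun h => absurd (SimpleFunc.mem_range_self s t) h
    rw [e]
    exact Finset.stronglyMeasurable_fun_sum _ fun y _ =>
      (hM y).indicator (s.measurableSet_fiber y)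
  refine stronglyMeasurable_of_tendsto Filter.atTop (fun n => hs (hw.approx n)) ?_
  rw [tendsto_pi_nhds]
  intro t
  exact ((M t).continuous.tendsto _).comp (hw.tendsto_approx t)

end WeakMeasurability

/-! ### Dominated convergence in `L²` -/

section Dominated

open Filter

variable {S : Type*} [MeasurableSpace S] {μ : Measure S} {E : Type*} [NormedAddCommGroup E]
  [InnerProductSpace ℝ E]

theorem norm_sq_eq_integral (w : Lp E 2 μ) : ‖w‖ ^ 2 = ∫ x, ‖w x‖ ^ 2 ∂μ := by
  rw [← real_inner_self_eq_norm_sq, L2.inner_def]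
  simp only [real_inner_self_eq_norm_sq]

theorem integrable_norm_sq {E : Type*} [NormedAddCommGroup E] (w : Lp E 2 μ) : Integrable (fun x => ‖w x‖ ^ 2) μ :=
  (memLp_two_iff_integrable_sq_norm (Lp.memLp w).1).mp (Lp.memLp w)

/-- Dominated convergence in `L²`. -/
theorem tendsto_L2_of_dominated {f : ℕ → Lp E 2 μ} {f₀ g : Lp E 2 μ} {C : ℝ}
    (hb : ∀ n, ∀ᵐ x ∂μ, ‖f n x‖ ≤ C * ‖g x‖)
    (hlim : ∀ᵐ x ∂μ, Tendsto (fun n => f n x) atTop (nhds (f₀ x))) :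
    Tendsto f atTop (nhds f₀) := by
  rw [tendsto_iff_norm_sub_tendsto_zero]
  have hsq : Tendsto (fun n => ‖f n - f₀‖ ^ 2) atTop (nhds 0) := by
    simp only [norm_sq_eq_integral]
    have h0 : ∫ _ : S, (0 : ℝ) ∂μ = 0 := integral_zero _ _
    rw [← h0]
    refine tendsto_integral_of_dominated_convergence (fun x => (2 * C) ^ 2 * ‖g x‖ ^ 2)
      (fun n => ((Lp.memLp _).1.norm.pow 2)) ((integrable_norm_sq g).const_mul _) ?_ ?_
    · have hb0 : ∀ᵐ x ∂μ, ‖f₀ x‖ ≤ C * ‖g x‖ := by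
        filter_upwards [ae_all_iff.mpr hb, hlim] with x hx hl
        exact le_of_tendsto hl.norm (.of_forall hx)
      intro n
      filter_upwards [hb n, hb0, Lp.coeFn_sub (f n) f₀] with x h1 h2 h3
      rw [Real.norm_of_nonneg (by positivity), h3, Pi.sub_apply, ← mul_pow]
      gcongr
      exact (norm_sub_le _ _).trans (by linarith)
    · filter_upwards [hlim, ae_all_iff.mpr fun n => Lp.coeFn_sub (f n) f₀] with x hx h3
      have h4 : Tendsto (fun n => ‖f n x - f₀ x‖ ^ 2) atTop (nhds (0 ^ 2)) :=
        (tendsto_iff_norm_sub_tendsto_zero.mp hx).pow 2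
      rw [zero_pow two_ne_zero] at h4
      refine h4.congr fun n => ?_
      rw [h3 n, Pi.sub_apply]
  have := hsq.sqrt
  simpa [Real.sqrt_sq (norm_nonneg _)] using this

end Dominated

/-! ### Multiplication by bounded coefficients of space and time -/

section Multiplication

open Filter
open scoped InnerProductSpace

variable {S : Type*} [MeasurableSpace S] {μ : Measure S} {E : Type*} [NormedAddCommGroup E]
  [InnerProductSpace ℝ E] {C : ℝ}

theorem memLp_bdd_smul {m : S → ℝ} (hm : Measurable m) (hC : ∀ x, |m x| ≤ C) (w : Lp E 2 μ) :
    MemLp (fun x => m x • w x) 2 μ := by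
  refine (Lp.memLp w).of_le_mul (c := C) (hm.aestronglyMeasurable.smul (Lp.memLp w).1)
    (.of_forall fun x => ?_)
  rw [norm_smul]
  exact mul_le_mul_of_nonneg_right (hC x) (norm_nonneg _)

/-- Multiplication by a bounded measurable function on `L²(μ; E)`. -/
def mulOp {m : S → ℝ} (hm : Measurable m) (hC : ∀ x, |m x| ≤ C) (μ : Measure S) (E : Type*)
    [NormedAddCommGroup E] [InnerProductSpace ℝ E] : Lp E 2 μ →L[ℝ] Lp E 2 μ :=
  LinearMap.mkContinuous
    { toFun := fun w => (memLp_bdd_smul hm hC w).toLp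
      map_add' := fun v w => by
        rw [← MemLp.toLp_add]
        apply MemLp.toLp_congr
        filter_upwards [Lp.coeFn_add v w] with x hx
        rw [hx, Pi.add_apply, Pi.add_apply, smul_add]
      map_smul' := fun c w => by
        rw [← MemLp.toLp_const_smul]
        apply MemLp.toLp_congr
        filter_upwards [Lp.coeFn_smul c w] with x hx
        rw [hx, RingHom.id_apply, Pi.smul_apply, Pi.smul_apply, smul_comm] }
    C (fun w => by
      refine Lp.norm_le_mul_norm_of_ae_le_mul ?_
      filter_upwards [(memLp_bdd_smul hm hC w).coeFn_toLp] with x hx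
      refine (congrArg norm hx).trans_le ?_
      rw [norm_smul]
      exact mul_le_mul_of_nonneg_right (hC x) (norm_nonneg _))

theorem coeFn_mulOp {m : S → ℝ} (hm : Measurable m) (hC : ∀ x, |m x| ≤ C) (w : Lp E 2 μ) :
    mulOp hm hC μ E w =ᵐ[μ] fun x => m x • w x := (memLp_bdd_smul hm hC w).coeFn_toLp

theorem norm_mulOp_apply_le {m : S → ℝ} (hm : Measurable m) (hC : ∀ x, |m x| ≤ C) (w : Lp E 2 μ) :
    ‖mulOp hm hC μ E w‖ ≤ C * ‖w‖ := by
  refine Lp.norm_le_mul_norm_of_ae_le_mul ?_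
  filter_upwards [coeFn_mulOp hm hC w] with x hx
  rw [hx, norm_smul]
  exact mul_le_mul_of_nonneg_right (hC x) (norm_nonneg _)

theorem inner_mulOp {m : S → ℝ} (hm : Measurable m) (hC : ∀ x, |m x| ≤ C) (v w : Lp E 2 μ) :
    ⟪mulOp hm hC μ E w, v⟫_ℝ = ∫ x, m x * ⟪w x, v x⟫_ℝ ∂μ := by
  rw [L2.inner_def]
  refine integral_congr_ae ?_
  filter_upwards [coeFn_mulOp hm hC w] with x hx
  rw [hx, inner_smul_left]
  rfl

theorem inner_mulOp_comm {m : S → ℝ} (hm : Measurable m) (hC : ∀ x, |m x| ≤ C)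
    (v w : Lp E 2 μ) : ⟪mulOp hm hC μ E w, v⟫_ℝ = ⟪w, mulOp hm hC μ E v⟫_ℝ := by
  rw [real_inner_comm (mulOp hm hC μ E v), inner_mulOp, inner_mulOp]
  simp only [real_inner_comm]

theorem mul_norm_sq_le_inner_mulOp {m : S → ℝ} (hm : Measurable m) (hC : ∀ x, |m x| ≤ C) {c : ℝ}
    (hc : ∀ x, c ≤ m x) (w : Lp E 2 μ) : c * ‖w‖ ^ 2 ≤ ⟪mulOp hm hC μ E w, w⟫_ℝ := by
  rw [norm_sq_eq_integral, ← integral_const_mul, L2.inner_def]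
  refine integral_mono_ae ((integrable_norm_sq w).const_mul c) (L2.integrable_inner _ _) ?_
  filter_upwards [coeFn_mulOp hm hC w] with x hx
  rw [hx, inner_smul_left, real_inner_self_eq_norm_sq]
  exact mul_le_mul_of_nonneg_right (hc x) (by positivity)

variable [SFinite μ] [SecondCountableTopology (Lp E 2 μ)] {T : ℝ}

/-- On a fixed vector, weak measurability in time is measurability of a parameter integral;
separability upgrades it to strong measurability. -/
theorem stronglyMeasurable_mulOp {m : S × ℝ → ℝ} (hm : Measurable m) (hC : ∀ z, |m z| ≤ C)
    {w : ℝ → Lp E 2 μ} (hw : StronglyMeasurable w) :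
    StronglyMeasurable fun t =>
      mulOp (hm.comp measurable_prodMk_right) (fun x => hC (x, t)) μ E (w t) := by
  refine stronglyMeasurable_clm_apply (fun e => stronglyMeasurable_of_forall_inner fun v => ?_) hw
  simp only [inner_mulOp]
  refine (StronglyMeasurable.integral_prod_left'
    (f := fun z : S × ℝ => m z * ⟪e z.1, v z.1⟫_ℝ) ?_).measurable
  refine hm.stronglyMeasurable.mul ?_
  exact (StronglyMeasurable.inner (𝕜 := ℝ) (Lp.stronglyMeasurable e)
    (Lp.stronglyMeasurable v)).comp_measurable measurable_fst

theorem memLp_mulOp {m : S × ℝ → ℝ} (hm : Measurable m) (hC : ∀ z, |m z| ≤ C)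
    (w : L2Time T (Lp E 2 μ)) :
    MemLp (fun t => mulOp (hm.comp measurable_prodMk_right) (fun x => hC (x, t)) μ E (w t)) 2
      (volume.restrict (Ioo 0 T)) :=
  (Lp.memLp w).of_le_mul (c := C)
    (stronglyMeasurable_mulOp hm hC (Lp.stronglyMeasurable w)).aestronglyMeasurable
    (.of_forall fun _ => norm_mulOp_apply_le _ _ _)

/-- Multiplication by a bounded measurable function of space and time. -/
def timeMulOp {m : S × ℝ → ℝ} (hm : Measurable m) (hC : ∀ z, |m z| ≤ C) (T : ℝ) (μ : Measure S)
    [SFinite μ] (E : Type*) [NormedAddCommGroup E] [InnerProductSpace ℝ E]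
    [SecondCountableTopology (Lp E 2 μ)] :
    L2Time T (Lp E 2 μ) →L[ℝ] L2Time T (Lp E 2 μ) :=
  LinearMap.mkContinuous
    { toFun := fun w => (memLp_mulOp hm hC w).toLp
      map_add' := fun v w => by
        rw [← MemLp.toLp_add]
        apply MemLp.toLp_congr
        filter_upwards [Lp.coeFn_add v w] with t ht
        rw [ht, Pi.add_apply, Pi.add_apply, map_add]
      map_smul' := fun c w => by
        rw [← MemLp.toLp_const_smul]
        apply MemLp.toLp_congr
        filter_upwards [Lp.coeFn_smul c w] with t ht
        rw [ht, RingHom.id_apply, Pi.smul_apply, Pi.smul_apply, map_smul] }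
    C (fun w => by
      refine Lp.norm_le_mul_norm_of_ae_le_mul ?_
      filter_upwards [(memLp_mulOp hm hC w).coeFn_toLp] with t ht
      exact (congrArg norm ht).trans_le (norm_mulOp_apply_le _ _ _))

theorem coeFn_timeMulOp {m : S × ℝ → ℝ} (hm : Measurable m) (hC : ∀ z, |m z| ≤ C)
    (w : L2Time T (Lp E 2 μ)) :
    timeMulOp hm hC T μ E w =ᵐ[volume.restrict (Ioo 0 T)]
      fun t => mulOp (hm.comp measurable_prodMk_right) (fun x => hC (x, t)) μ E (w t) :=
  (memLp_mulOp hm hC w).coeFn_toLp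

theorem inner_timeMulOp_comm {m : S × ℝ → ℝ} (hm : Measurable m) (hC : ∀ z, |m z| ≤ C)
    (v w : L2Time T (Lp E 2 μ)) :
    ⟪timeMulOp hm hC T μ E w, v⟫_ℝ = ⟪w, timeMulOp hm hC T μ E v⟫_ℝ := by
  rw [L2.inner_def, L2.inner_def]
  refine integral_congr_ae ?_
  filter_upwards [coeFn_timeMulOp hm hC w, coeFn_timeMulOp hm hC v] with t h1 h2
  rw [h1, h2, inner_mulOp_comm]

theorem mul_norm_sq_le_inner_timeMulOp {m : S × ℝ → ℝ} (hm : Measurable m)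
    (hC : ∀ z, |m z| ≤ C) {c : ℝ} (hc : ∀ z, c ≤ m z) (w : L2Time T (Lp E 2 μ)) :
    c * ‖w‖ ^ 2 ≤ ⟪timeMulOp hm hC T μ E w, w⟫_ℝ := by
  rw [norm_sq_eq_integral, ← integral_const_mul, L2.inner_def]
  refine integral_mono_ae ((integrable_norm_sq w).const_mul c) (L2.integrable_inner _ _) ?_
  filter_upwards [coeFn_timeMulOp hm hC w] with t ht
  rw [ht]
  exact mul_norm_sq_le_inner_mulOp _ _ (fun x => hc (x, t)) _

/-- Dominated convergence twice, in space for almost every time and then in time. Almost everywhere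
convergence of the coefficients gives convergence on fixed vectors, which is all the stability
argument uses. -/
theorem tendsto_timeMulOp {m : ℕ → S × ℝ → ℝ} {m₀ : S × ℝ → ℝ} (hm : ∀ n, Measurable (m n))
    (hm₀ : Measurable m₀) (hC : ∀ n z, |m n z| ≤ C) (hC₀ : ∀ z, |m₀ z| ≤ C)
    (hlim : ∀ᵐ t ∂volume.restrict (Ioo 0 T), ∀ᵐ x ∂μ,
      Tendsto (fun n => m n (x, t)) atTop (nhds (m₀ (x, t))))
    (w : L2Time T (Lp E 2 μ)) :
    Tendsto (fun n => timeMulOp (hm n) (hC n) T μ E w) atTop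
      (nhds (timeMulOp hm₀ hC₀ T μ E w)) := by
  refine tendsto_L2_of_dominated (C := C) (g := w) (fun n => ?_) ?_
  · filter_upwards [coeFn_timeMulOp (hm n) (hC n) w] with t ht
    rw [ht]
    exact norm_mulOp_apply_le _ _ _
  · filter_upwards [hlim, coeFn_timeMulOp hm₀ hC₀ w,
      ae_all_iff.mpr fun n => coeFn_timeMulOp (hm n) (hC n) w] with t ht h0 hn
    simp only [h0, hn]
    refine tendsto_L2_of_dominated (C := C) (g := w t) (fun n => ?_) ?_
    · filter_upwards [coeFn_mulOp ((hm n).comp measurable_prodMk_right)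
        (fun x => hC n (x, t)) (w t)] with x hx
      rw [hx, norm_smul]
      exact mul_le_mul_of_nonneg_right (hC n (x, t)) (norm_nonneg _)
    · filter_upwards [ht, coeFn_mulOp (hm₀.comp measurable_prodMk_right)
        (fun x => hC₀ (x, t)) (w t), ae_all_iff.mpr fun n =>
        coeFn_mulOp ((hm n).comp measurable_prodMk_right) (fun x => hC n (x, t)) (w t)]
        with x hx h0 hn
      simp only [h0, hn]
      exact hx.smul_const _

end Multiplication

/-! ### Poincaré inequality on bounded domains -/

section Poincare

open scoped InnerProductSpace

variable {d : ℕ} {Ω : Set (Space d)}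

theorem IsConvexPolyhedralDomain.isOpen (hΩ : IsConvexPolyhedralDomain Ω) : IsOpen Ω := by
  obtain ⟨-, S, rfl⟩ := hΩ
  exact isOpen_interior

theorem IsConvexPolyhedralDomain.isBounded (hΩ : IsConvexPolyhedralDomain Ω) :
    Bornology.IsBounded Ω := by
  obtain ⟨-, S, rfl⟩ := hΩ
  exact ((isBounded_convexHull.mpr S.finite_toSet.isBounded)).subset interior_subset

/-- The Poincaré inequality for test functions. -/
theorem integral_sq_le_of_isTestFunction {R : ℝ} (hR : ∀ x ∈ Ω, ‖x‖ ≤ R) (i : Fin d)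
    {φ : Space d → ℝ} (hφ : IsTestFunction Ω φ) :
    ∫ x in Ω, φ x ^ 2 ≤ (2 * R) ^ 2 * ∫ x in Ω, ‖gradient φ x‖ ^ 2 := by
  obtain ⟨hs, hc, hsupp⟩ := hφ
  have hd : Differentiable ℝ φ := hs.differentiable (by simp)
  have hgc : Continuous (gradient φ) := by
    unfold gradient
    exact (LinearIsometryEquiv.continuous _).comp (hs.continuous_fderiv (by simp))
  have hgs : Function.support (gradient φ) ⊆ tsupport φ := by
    intro x hx
    apply support_fderiv_subset ℝ
    intro h
    apply hx
    rw [gradient, h, map_zero]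
  have hgcs : HasCompactSupport (gradient φ) := hc.mono' hgs
  obtain ⟨G, hG⟩ : ∃ G, G = gradient φ := ⟨_, rfl⟩
  have hGn : ∀ x, ‖G x‖ = ‖fderiv ℝ φ x‖ := fun x => by
    rw [hG, gradient, LinearIsometryEquiv.norm_map]
  rw [← hG] at hgc hgs hgcs ⊢
  clear hG
  have z1 : ∀ x, x ∉ Ω → φ x ^ 2 = 0 := fun x hx => by
    rw [image_eq_zero_of_notMem_tsupport fun h => hx (hsupp h)]; simp
  have z2 : ∀ x, x ∉ Ω → ‖G x‖ ^ 2 = 0 := fun x hx => by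
    rw [Function.notMem_support.mp fun h => hx (hsupp (hgs h))]; simp
  rw [setIntegral_eq_integral_of_forall_compl_eq_zero z1,
    setIntegral_eq_integral_of_forall_compl_eq_zero z2]
  -- A unit coordinate vector and the coordinate function along it.
  obtain ⟨v, ℓ, hv, hℓv, hℓ⟩ : ∃ (v : Space d) (ℓ : Space d →L[ℝ] ℝ), ‖v‖ = 1 ∧ ℓ v = 1 ∧
      ∀ x, |ℓ x| ≤ ‖x‖ :=
    ⟨EuclideanSpace.single i 1, EuclideanSpace.proj i, by simp, by simp,
      fun x => PiLp.norm_apply_le x i⟩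
  have hfd : ∀ x, |fderiv ℝ φ x v| ≤ ‖G x‖ := fun x => by
    rw [hGn]
    simpa [hv] using (fderiv ℝ φ x).le_opNorm v
  have hdc : Continuous fun x => fderiv ℝ φ x v :=
    (hs.continuous_fderiv (by simp)).clm_apply continuous_const
  have hcs2 : HasCompactSupport fun x => φ x ^ 2 := hc.comp_left (g := fun y : ℝ => y ^ 2) (by simp)
  have hsq : ∀ x, fderiv ℝ (fun x => φ x ^ 2) x v = 2 * φ x * fderiv ℝ φ x v := fun x => by
    rw [fderiv_fun_pow 2 (hd x)]
    simp
  have hcd : HasCompactSupport fun x => 2 * φ x * fderiv ℝ φ x v * ℓ x :=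
    ((hc.mul_left (f := fun _ => (2 : ℝ))).mul_right).mul_right
  have i0 : Integrable fun x => 2 * φ x * fderiv ℝ φ x v * ℓ x :=
    (((continuous_const.mul hs.continuous).mul hdc).mul ℓ.continuous).integrable_of_hasCompactSupport
      hcd
  have i1 : Integrable (fun x => φ x ^ 2) :=
    (hs.continuous.pow 2).integrable_of_hasCompactSupport hcs2
  have hcs3 : HasCompactSupport fun x => ‖G x‖ ^ 2 := by
    refine hgcs.mono fun x hx h0 => hx ?_
    simp only [h0, norm_zero, ne_eq, OfNat.ofNat_ne_zero, not_false_eq_true, zero_pow]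
  have i2 : Integrable (fun x => ‖G x‖ ^ 2) :=
    (hgc.norm.pow 2).integrable_of_hasCompactSupport hcs3
  -- Integration by parts against `ℓ`, whose derivative along `v` is `1`. Young's inequality, with
  -- `|ℓ| ≤ R` on `Ω`, then leaves half of `∫ φ²` to be absorbed on the left.
  have hkey : ∫ x, φ x ^ 2 = -∫ x, 2 * φ x * fderiv ℝ φ x v * ℓ x := by
    have h := integral_mul_fderiv_eq_neg_fderiv_mul_of_integrable (μ := volume)
      (f := fun x => φ x ^ 2) (g := ℓ) (v := v) (by simpa only [hsq] using i0)
      (by simpa only [ContinuousLinearMap.fderiv, hℓv, mul_one] using i1)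
      (((hs.continuous.pow 2).mul ℓ.continuous).integrable_of_hasCompactSupport hcs2.mul_right)
      (fun x _ => (hd x).fun_pow 2) (fun x _ => ℓ.differentiableAt)
    simpa only [ContinuousLinearMap.fderiv, hℓv, mul_one, hsq] using h
  have hle : ∫ x, φ x ^ 2 ≤ ∫ x, (1 / 2 * φ x ^ 2 + 2 * R ^ 2 * ‖G x‖ ^ 2) := by
    rw [hkey, ← integral_neg]
    refine integral_mono i0.neg ((i1.const_mul _).add (i2.const_mul _)) fun x => ?_
    simp only
    by_cases hx : x ∈ Ω
    · have h1 : |ℓ x| ≤ R := (hℓ x).trans (hR x hx)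
      have h2 := hfd x
      have h3 : |2 * φ x * fderiv ℝ φ x v * ℓ x| ≤ 2 * |φ x| * ‖G x‖ * R := by
        rw [abs_mul, abs_mul, abs_mul, abs_two]
        gcongr
      have h4 := neg_abs_le (2 * φ x * fderiv ℝ φ x v * ℓ x)
      nlinarith [sq_nonneg (|φ x| - 2 * R * ‖G x‖), sq_abs (φ x)]
    · have : φ x = 0 := image_eq_zero_of_notMem_tsupport fun h => hx (hsupp h)
      rw [this]
      simp only [mul_zero, zero_mul, neg_zero]
      positivity
  rw [integral_add (i1.const_mul _) (i2.const_mul _), integral_const_mul,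
    integral_const_mul] at hle
  linarith

/-- The Poincaré inequality is a closed condition on pairs, so it passes from test functions to
their closure; adding the gradient term accounts for the `+ 1` in the constant. -/
theorem exists_norm_sq_le_grad (hd : 1 ≤ d) (hΩ : Bornology.IsBounded Ω) :
    ∃ c : ℝ, 0 < c ∧ ∀ u : H10 Ω, c * ‖u‖ ^ 2 ≤ ‖grad Ω u‖ ^ 2 := by
  obtain ⟨R, hR⟩ := hΩ.exists_norm_le
  have hclosed : IsClosed {w : WithLp 2 (L2 Ω × L2Vec Ω) | ‖w.fst‖ ^ 2 ≤ (2 * R) ^ 2 * ‖w.snd‖ ^ 2} := by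
    have h1 : Continuous fun w : WithLp 2 (L2 Ω × L2Vec Ω) => w.fst :=
      (WithLp.fstL 2 ℝ (L2 Ω) (L2Vec Ω)).continuous
    have h2 : Continuous fun w : WithLp 2 (L2 Ω × L2Vec Ω) => w.snd :=
      (WithLp.sndL 2 ℝ (L2 Ω) (L2Vec Ω)).continuous
    exact isClosed_le (h1.norm.pow 2) ((h2.norm.pow 2).const_mul _)
  have hsub : ((testGraph Ω).topologicalClosure : Set (WithLp 2 (L2 Ω × L2Vec Ω))) ⊆
      {w | ‖w.fst‖ ^ 2 ≤ (2 * R) ^ 2 * ‖w.snd‖ ^ 2} := by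
    rw [Submodule.topologicalClosure_coe]
    refine closure_minimal ?_ hclosed
    rintro w ⟨φ, hφ, h1, h2⟩
    have h := integral_sq_le_of_isTestFunction hR ⟨0, hd⟩ hφ
    change ‖w.fst‖ ^ 2 ≤ (2 * R) ^ 2 * ‖w.snd‖ ^ 2
    rw [norm_sq_eq_integral, norm_sq_eq_integral]
    have e1 : ∫ x in Ω, ‖w.fst x‖ ^ 2 = ∫ x in Ω, φ x ^ 2 := by
      refine integral_congr_ae ?_
      filter_upwards [h1] with x hx
      rw [hx, Real.norm_eq_abs, sq_abs]
    have e2 : ∫ x in Ω, ‖w.snd x‖ ^ 2 = ∫ x in Ω, ‖gradient φ x‖ ^ 2 := by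
      refine integral_congr_ae ?_
      filter_upwards [h2] with x hx
      rw [hx]
    rw [e1, e2]
    exact h
  refine ⟨((2 * R) ^ 2 + 1)⁻¹, by positivity, fun u => ?_⟩
  have h := hsub u.2
  have hn : ‖u‖ ^ 2 = ‖(u : WithLp 2 (L2 Ω × L2Vec Ω)).fst‖ ^ 2 +
      ‖(u : WithLp 2 (L2 Ω × L2Vec Ω)).snd‖ ^ 2 := WithLp.prod_norm_sq_eq_of_L2 _
  have hg : ‖grad Ω u‖ = ‖(u : WithLp 2 (L2 Ω × L2Vec Ω)).snd‖ := rfl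
  rw [inv_mul_le_iff₀ (by positivity), hg, hn]
  have h' : ‖(u : WithLp 2 (L2 Ω × L2Vec Ω)).fst‖ ^ 2 ≤
      (2 * R) ^ 2 * ‖(u : WithLp 2 (L2 Ω × L2Vec Ω)).snd‖ ^ 2 := h
  linarith

end Poincare

/-! ### Riesz representation and adjoints, pointwise in time -/

section Riesz

open scoped InnerProductSpace

variable {V W : Type*} [NormedAddCommGroup V] [InnerProductSpace ℝ V] [CompleteSpace V]
  [NormedAddCommGroup W] [InnerProductSpace ℝ W] [CompleteSpace W]

/-- The Riesz representation of functionals. -/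
def rieszRep (V : Type*) [NormedAddCommGroup V] [InnerProductSpace ℝ V] [CompleteSpace V] :
    StrongDual ℝ V →L[ℝ] V :=
  LinearMap.mkContinuous
    { toFun := fun g => (InnerProductSpace.toDual ℝ V).symm g
      map_add' := map_add _
      map_smul' := fun c g => by rw [map_smulₛₗ]; rfl } 1
    (fun g => by rw [one_mul]; exact (LinearIsometryEquiv.norm_map _ g).le)

theorem inner_rieszRep (g : StrongDual ℝ V) (v : V) : ⟪rieszRep V g, v⟫_ℝ = g v :=
  InnerProductSpace.toDual_symm_apply

theorem rieszRep_injective : Function.Injective (rieszRep V) :=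
  (InnerProductSpace.toDual ℝ V).symm.injective

theorem rieszRep_innerSL (v : V) : rieszRep V (innerSL ℝ v) = v :=
  ext_inner_right ℝ fun w => by rw [inner_rieszRep, innerSL_apply_apply]

/-- The Riesz representation on `L²(0,T;V*)`. -/
def rieszTime (T : ℝ) (V : Type*) [NormedAddCommGroup V] [InnerProductSpace ℝ V] [CompleteSpace V]
    (f : L2Time T (StrongDual ℝ V)) : L2Time T V := (rieszRep V).compLp f

theorem coeFn_rieszTime {T : ℝ} (f : L2Time T (StrongDual ℝ V)) :
    rieszTime T V f =ᵐ[volume.restrict (Ioo 0 T)] fun t => rieszRep V (f t) :=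
  (rieszRep V).coeFn_compLp f

theorem rlOp_one_rieszTime {T : ℝ} (g : L2Time T (StrongDual ℝ V)) :
    ∀ᵐ t ∂volume.restrict (Ioo 0 T),
      rlOp T one_pos V (rieszTime T V g) t = rieszRep V (∫ s in (0 : ℝ)..t, g s) := by
  filter_upwards [coeFn_rlOp one_pos (rieszTime T V g), ae_restrict_mem measurableSet_Ioo]
    with t h1 h2
  rw [h1, rlIntegral_congr_ae (coeFn_rieszTime g) h2, rlIntegral_one]
  refine ContinuousLinearMap.intervalIntegral_comp_comm _ ?_
  rw [intervalIntegrable_iff_integrableOn_Ioo_of_le h2.1.le]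
  have : IntegrableOn g (Ioo 0 T) := (Lp.memLp g).integrable (by norm_num)
  exact this.mono_set (Ioo_subset_Ioo le_rfl h2.2.le)

theorem exists_rieszTime_eq_sub {T : ℝ} (f : L2Time T (StrongDual ℝ V)) (v : L2Time T V) :
    ∃ g, rieszTime T V g = rieszTime T V f - v := by
  let D : V →L[ℝ] StrongDual ℝ V := innerSL ℝ
  refine ⟨f - D.compLp v, Lp.ext ?_⟩
  filter_upwards [coeFn_rieszTime (f - D.compLp v), coeFn_rieszTime f,
    Lp.coeFn_sub f (D.compLp v), D.coeFn_compLp v, Lp.coeFn_sub (rieszTime T V f) v]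
    with t h1 h2 h3 h4 h5
  rw [h1, h5, h3, Pi.sub_apply, Pi.sub_apply, map_sub, h4, h2]
  exact congrArg _ (rieszRep_innerSL _)

theorem rieszTime_eq_sub_iff {T : ℝ} (f g : L2Time T (StrongDual ℝ V)) (v : L2Time T V) :
    rieszTime T V g = rieszTime T V f - v ↔
      ∀ᵐ t ∂volume.restrict (Ioo 0 T), ∀ φ, g t φ + ⟪v t, φ⟫_ℝ = f t φ := by
  constructor
  · intro h
    filter_upwards [coeFn_rieszTime g, coeFn_rieszTime f, Lp.coeFn_sub (rieszTime T V f) v]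
      with t h3 h4 h5 φ
    rw [← h, h3, Pi.sub_apply, h4] at h5
    have h6 := congrArg (fun w => ⟪w, φ⟫_ℝ) h5
    simp only [inner_sub_left, inner_rieszRep] at h6
    linarith
  · intro h
    apply Lp.ext
    filter_upwards [h, coeFn_rieszTime g, coeFn_rieszTime f, Lp.coeFn_sub (rieszTime T V f) v]
      with t h1 h3 h4 h5
    rw [h5, Pi.sub_apply, h3, h4]
    refine ext_inner_right ℝ fun φ => ?_
    rw [inner_sub_left, inner_rieszRep, inner_rieszRep, ← h1 φ]
    ring

variable {S : Type*} [MeasurableSpace S] {μ : Measure S}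

/-- The adjoint of the pointwise application of an operator on `L²(μ; ·)`. -/
def adjointLp (μ : Measure S) (A : V →L[ℝ] W) : Lp W 2 μ →L[ℝ] Lp V 2 μ :=
  (ContinuousLinearMap.adjoint A).compLpL 2 μ

theorem coeFn_adjointLp (A : V →L[ℝ] W) (w : Lp W 2 μ) :
    adjointLp μ A w =ᵐ[μ] fun x => ContinuousLinearMap.adjoint A (w x) :=
  (ContinuousLinearMap.adjoint A).coeFn_compLp w

theorem inner_compLpL_left (A : V →L[ℝ] W) (v : Lp V 2 μ) (w : Lp W 2 μ) :
    ⟪A.compLpL 2 μ v, w⟫_ℝ = ⟪v, adjointLp μ A w⟫_ℝ := by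
  rw [L2.inner_def, L2.inner_def]
  refine integral_congr_ae ?_
  filter_upwards [A.coeFn_compLp v, coeFn_adjointLp A w] with x h1 h2
  have h3 : A.compLpL 2 μ v x = A (v x) := h1
  rw [h3, h2, ContinuousLinearMap.adjoint_inner_right]

theorem inner_adjointLp_left (A : V →L[ℝ] W) (v : Lp V 2 μ) (w : Lp W 2 μ) :
    ⟪adjointLp μ A w, v⟫_ℝ = ⟪w, A.compLpL 2 μ v⟫_ℝ := by
  rw [real_inner_comm, ← inner_compLpL_left, real_inner_comm]

/-- The intertwining relation `B j' = j' C` required by the abstract existence and uniqueness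
theorems. -/
theorem adjointLp_rlOp {T β : ℝ} (hβ : 0 < β) (A : V →L[ℝ] W) (w : L2Time T W) :
    adjointLp _ A (rlOp T hβ W w) = rlOp T hβ V (adjointLp _ A w) :=
  compLp_rlOp hβ _ w

end Riesz

/-! ### The weak formulation as an operator equation: solvability and stability -/

section AbstractWeakSolution

open scoped InnerProductSpace
open ContinuousLinearMap (adjoint)

variable {V H : Type*} [NormedAddCommGroup V] [InnerProductSpace ℝ V] [CompleteSpace V]
  [NormedAddCommGroup H] [InnerProductSpace ℝ H] [CompleteSpace H]
  {S : Type*} [MeasurableSpace S] {μ : Measure S} [SFinite μ] {E : Type*} [NormedAddCommGroup E]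
  [InnerProductSpace ℝ E] [CompleteSpace E] [SecondCountableTopology (Lp E 2 μ)]
  {T : ℝ} {m : S × ℝ → ℝ} {C : ℝ}

/-- The operator `D* m D` on `L²(0,T;V)`. -/
def stiffness (D : V →L[ℝ] Lp E 2 μ) (T : ℝ) (hm : Measurable m) (hC : ∀ z, |m z| ≤ C) :
    L2Time T V →L[ℝ] L2Time T V :=
  (adjointLp _ D).comp ((timeMulOp hm hC T μ E).comp (D.compLpL 2 _))

theorem inner_stiffness (D : V →L[ℝ] Lp E 2 μ) (hm : Measurable m) (hC : ∀ z, |m z| ≤ C)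
    (u v : L2Time T V) : ⟪stiffness D T hm hC u, v⟫_ℝ =
      ⟪timeMulOp hm hC T μ E (D.compLpL 2 _ u), D.compLpL 2 _ v⟫_ℝ :=
  inner_adjointLp_left D v _

theorem inner_stiffness_comm (D : V →L[ℝ] Lp E 2 μ) (hm : Measurable m) (hC : ∀ z, |m z| ≤ C)
    (u v : L2Time T V) : ⟪stiffness D T hm hC u, v⟫_ℝ = ⟪u, stiffness D T hm hC v⟫_ℝ := by
  rw [inner_stiffness, inner_timeMulOp_comm, real_inner_comm _ u, inner_stiffness,
    real_inner_comm]

theorem ae_inner_stiffness (D : V →L[ℝ] Lp E 2 μ) (hm : Measurable m) (hC : ∀ z, |m z| ≤ C)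
    (u : L2Time T V) : ∀ᵐ t ∂volume.restrict (Ioo 0 T), ∀ φ : V,
      ⟪stiffness D T hm hC u t, φ⟫_ℝ = ∫ x, m (x, t) * ⟪D (u t) x, D φ x⟫_ℝ ∂μ := by
  filter_upwards [coeFn_adjointLp D (timeMulOp hm hC T μ E (D.compLpL 2 _ u)),
    coeFn_timeMulOp hm hC (D.compLpL 2 _ u), D.coeFn_compLp u] with t h1 h2 h3 φ
  have h4 : D.compLpL 2 _ u t = D (u t) := h3
  have h5 : stiffness D T hm hC u t =
    adjoint D (timeMulOp hm hC T μ E (D.compLpL 2 _ u) t) := h1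
  rw [h5, h2, h4, ContinuousLinearMap.adjoint_inner_left, inner_mulOp]
  rfl

theorem mul_norm_sq_le_inner_stiffness {D : V →L[ℝ] Lp E 2 μ} {c c₀ : ℝ} (hc₀ : 0 ≤ c₀)
    (hD : ∀ u, c * ‖u‖ ^ 2 ≤ ‖D u‖ ^ 2) (hm : Measurable m) (hC : ∀ z, |m z| ≤ C)
    (hm₀ : ∀ z, c₀ ≤ m z) (u : L2Time T V) :
    c₀ * c * ‖u‖ ^ 2 ≤ ⟪stiffness D T hm hC u, u⟫_ℝ := by
  rw [inner_stiffness]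
  refine le_trans ?_ (mul_norm_sq_le_inner_timeMulOp hm hC hm₀ _)
  rw [mul_assoc]
  gcongr
  rw [norm_sq_eq_integral, norm_sq_eq_integral, ← integral_const_mul]
  refine integral_mono_ae ((integrable_norm_sq u).const_mul _) (integrable_norm_sq _) ?_
  filter_upwards [D.coeFn_compLp u] with t h3
  have h4 : D.compLpL 2 _ u t = D (u t) := h3
  rw [h4]
  exact hD (u t)

theorem tendsto_stiffness (D : V →L[ℝ] Lp E 2 μ) {m : ℕ → S × ℝ → ℝ} {m₀ : S × ℝ → ℝ}
    (hm : ∀ n, Measurable (m n)) (hm₀ : Measurable m₀) (hC : ∀ n z, |m n z| ≤ C)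
    (hC₀ : ∀ z, |m₀ z| ≤ C)
    (hlim : ∀ᵐ t ∂volume.restrict (Ioo 0 T), ∀ᵐ x ∂μ,
      Filter.Tendsto (fun n => m n (x, t)) Filter.atTop (nhds (m₀ (x, t)))) (w : L2Time T V) :
    Filter.Tendsto (fun n => stiffness D T (hm n) (hC n) w) Filter.atTop
      (nhds (stiffness D T hm₀ hC₀ w)) :=
  ((adjointLp _ D).continuous.tendsto _).comp (tendsto_timeMulOp hm hm₀ hC hC₀ hlim _)

theorem rieszRep_innerSL_comp (ι : V →L[ℝ] H) (v : H) :
    rieszRep V ((innerSL ℝ v).comp ι) = adjoint ι v :=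
  ext_inner_right ℝ fun φ => by
    rw [inner_rieszRep, ContinuousLinearMap.adjoint_inner_left]
    rfl

/-- Apply the injective integral of order `1 - α` to the right-hand equation. Its composition with
order `α` is the primitive, and it commutes with the adjoint of `ι`, so the Riesz representation of
the left-hand condition appears. -/
theorem hasZeroH1Deriv_iff (ι : V →L[ℝ] H) {α : ℝ} (hα₀ : 0 < α) (hα₁ : α < 1) (u₀ : H)
    (u : L2Time T V) (g : L2Time T (StrongDual ℝ V)) :
    HasZeroH1Deriv T
      (fun t => (innerSL ℝ (rlIntegral (1 - α) (fun s => ι (u s) - u₀) t)).comp ι) g ↔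
    adjointLp _ ι (ι.compLpL 2 _ u - constTime T u₀) = rlOp T hα₀ V (rieszTime T V g) := by
  have hβ : 0 < 1 - α := sub_pos.mpr hα₁
  rw [← (rlOp_injective hβ (by linarith)).eq_iff (f := rlOp T hβ V),
    rlOp_rlOp hβ hα₀ one_pos (by ring), ← adjointLp_rlOp]
  set v : L2Time T H := ι.compLpL 2 _ u - constTime T u₀ with hv
  have hve : v =ᵐ[volume.restrict (Ioo 0 T)] fun s => ι (u s) - u₀ := by
    filter_upwards [Lp.coeFn_sub (ι.compLpL 2 _ u) (constTime T u₀), ι.coeFn_compLp u,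
      coeFn_constTime T u₀] with s h1 h2 h3
    have h4 : ι.compLpL 2 _ u s = ι (u s) := h2
    rw [hv, h1, Pi.sub_apply, h4, h3]
  have hL : ∀ᵐ t ∂volume.restrict (Ioo 0 T), adjointLp _ ι (rlOp T hβ H v) t =
      rieszRep V ((innerSL ℝ (rlIntegral (1 - α) (fun s => ι (u s) - u₀) t)).comp ι) := by
    filter_upwards [coeFn_adjointLp ι (rlOp T hβ H v), coeFn_rlOp hβ v,
      ae_restrict_mem measurableSet_Ioo] with t h1 h2 h3
    rw [h1, h2, rieszRep_innerSL_comp, rlIntegral_congr_ae hve h3]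
  have hR := rlOp_one_rieszTime g
  constructor
  · intro h
    apply Lp.ext
    filter_upwards [h, hL, hR] with t h1 h2 h3
    rw [h2, h3, h1]
  · intro h
    rw [h] at hL
    filter_upwards [hL, hR] with t h2 h3
    exact rieszRep_injective (h2.symm.trans h3)

/-- The weak formulation as an operator equation in `L²(0,T;V)`. -/
theorem exists_hasZeroH1Deriv_iff (ι : V →L[ℝ] H) (D : V →L[ℝ] Lp E 2 μ) {α : ℝ} (hα₀ : 0 < α)
    (hα₁ : α < 1) (u₀ : H) (f : L2Time T (StrongDual ℝ V)) (q : S × ℝ → ℝ) (hm : Measurable m)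
    (hC : ∀ z, |m z| ≤ C)
    (hq : ∀ᵐ t ∂volume.restrict (Ioo 0 T), ∀ᵐ x ∂μ, q (x, t) = m (x, t)) (u : L2Time T V) :
    (∃ g : L2Time T (StrongDual ℝ V), HasZeroH1Deriv T
        (fun t => (innerSL ℝ (rlIntegral (1 - α) (fun s => ι (u s) - u₀) t)).comp ι) g ∧
      ∀ᵐ t ∂volume.restrict (Ioo 0 T), ∀ φ : V,
        g t φ + ∫ x, q (x, t) * ⟪D (u t) x, D φ x⟫_ℝ ∂μ = f t φ) ↔
      adjointLp _ ι (ι.compLpL 2 _ u - constTime T u₀) =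
        rlOp T hα₀ V (rieszTime T V f - stiffness D T hm hC u) := by
  have hst : ∀ᵐ t ∂volume.restrict (Ioo 0 T), ∀ φ : V, ⟪stiffness D T hm hC u t, φ⟫_ℝ =
      ∫ x, q (x, t) * ⟪D (u t) x, D φ x⟫_ℝ ∂μ := by
    filter_upwards [ae_inner_stiffness D hm hC u, hq] with t h1 h2 φ
    rw [h1]
    refine integral_congr_ae ?_
    filter_upwards [h2] with x hx
    rw [hx]
  have key : ∀ g : L2Time T (StrongDual ℝ V),
      (∀ᵐ t ∂volume.restrict (Ioo 0 T), ∀ φ : V,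
        g t φ + ∫ x, q (x, t) * ⟪D (u t) x, D φ x⟫_ℝ ∂μ = f t φ) ↔
      rieszTime T V g = rieszTime T V f - stiffness D T hm hC u := by
    intro g
    rw [rieszTime_eq_sub_iff]
    refine Filter.eventually_congr ?_
    filter_upwards [hst] with t ht
    simp only [ht]
  constructor
  · rintro ⟨g, h1, h2⟩
    rw [← (key g).mp h2]
    exact (hasZeroH1Deriv_iff ι hα₀ hα₁ u₀ u g).mp h1
  · intro h
    obtain ⟨g, hg⟩ := exists_rieszTime_eq_sub f (stiffness D T hm hC u)
    rw [← hg] at h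
    exact ⟨g, (hasZeroH1Deriv_iff ι hα₀ hα₁ u₀ u g).mpr h, (key g).mpr hg⟩

/-- The pairing of a weakly convergent bounded sequence with a strongly convergent one. -/
theorem tendsto_inner_of_weak_of_strong {X : Type*} [NormedAddCommGroup X] [InnerProductSpace ℝ X]
    {u v : ℕ → X} {u₀ v₀ : X} {R : ℝ} (hR : ∀ n, ‖u n‖ ≤ R)
    (hu : ∀ w, Filter.Tendsto (fun n => ⟪u n, w⟫_ℝ) Filter.atTop (nhds ⟪u₀, w⟫_ℝ))
    (hv : Filter.Tendsto v Filter.atTop (nhds v₀)) :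
    Filter.Tendsto (fun n => ⟪u n, v n⟫_ℝ) Filter.atTop (nhds ⟪u₀, v₀⟫_ℝ) := by
  have h1 : Filter.Tendsto (fun n => ⟪u n, v n - v₀⟫_ℝ) Filter.atTop (nhds 0) := by
    have h2 : Filter.Tendsto (fun n => R * ‖v n - v₀‖) Filter.atTop (nhds 0) := by
      simpa using (tendsto_iff_norm_sub_tendsto_zero.mp hv).const_mul R
    refine squeeze_zero_norm (fun n => (norm_inner_le_norm _ _).trans ?_) h2
    gcongr
    exact hR n
  have h3 := h1.add (hu v₀)
  rw [zero_add] at h3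
  refine h3.congr fun n => ?_
  rw [← inner_add_right, sub_add_cancel]

/-- Symmetry of `A` moves it onto the test vector, so that `u` occurs only as the bare first
argument of inner products, as weak limits require. -/
theorem inner_solution_equation {X Y : Type*} [NormedAddCommGroup X] [InnerProductSpace ℝ X]
    [CompleteSpace X] [NormedAddCommGroup Y] [InnerProductSpace ℝ Y] {j : X →L[ℝ] Y}
    {j' : Y →L[ℝ] X} (hj : ∀ x y, ⟪j x, y⟫_ℝ = ⟪x, j' y⟫_ℝ) (B : X →L[ℝ] X) {A : X → X}
    (hA : ∀ x y, ⟪A x, y⟫_ℝ = ⟪x, A y⟫_ℝ) (e : Y) (f u : X) :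
    j' (j u - e) = B (f - A u) ↔ ∀ w, ⟪u, j' (j w)⟫_ℝ - ⟪j' e, w⟫_ℝ =
      ⟪B f, w⟫_ℝ - ⟪u, A (ContinuousLinearMap.adjoint B w)⟫_ℝ := by
  have key : ∀ w, ⟪j' (j u - e), w⟫_ℝ = ⟪u, j' (j w)⟫_ℝ - ⟪j' e, w⟫_ℝ ∧
      ⟪B (f - A u), w⟫_ℝ = ⟪B f, w⟫_ℝ - ⟪u, A (ContinuousLinearMap.adjoint B w)⟫_ℝ := by
    intro w
    constructor
    · rw [map_sub, inner_sub_left, ← hj, real_inner_comm, ← hj, real_inner_comm]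
    · rw [map_sub, inner_sub_left, ← hA, ContinuousLinearMap.adjoint_inner_right]
  constructor
  · intro h w
    rw [← (key w).1, ← (key w).2, h]
  · intro h
    exact ext_inner_right ℝ fun w => by rw [(key w).1, (key w).2, h]

/-- Stability of `j' (j u - e) = B (f - A u)` under weak convergence of `u` and strong convergence
of `A`. -/
theorem solution_of_tendsto {X Y : Type*} [NormedAddCommGroup X] [InnerProductSpace ℝ X]
    [CompleteSpace X] [NormedAddCommGroup Y] [InnerProductSpace ℝ Y] {j : X →L[ℝ] Y}
    {j' : Y →L[ℝ] X} (hj : ∀ x y, ⟪j x, y⟫_ℝ = ⟪x, j' y⟫_ℝ) (B : X →L[ℝ] X) {A : ℕ → X → X}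
    {A₀ : X → X} (hA : ∀ n x y, ⟪A n x, y⟫_ℝ = ⟪x, A n y⟫_ℝ)
    (hA₀ : ∀ x y, ⟪A₀ x, y⟫_ℝ = ⟪x, A₀ y⟫_ℝ)
    (hlim : ∀ x, Filter.Tendsto (fun n => A n x) Filter.atTop (nhds (A₀ x))) (e : Y) (f : X)
    {u : ℕ → X} {u₀ : X} {R : ℝ} (hR : ∀ n, ‖u n‖ ≤ R)
    (hw : ∀ w, Filter.Tendsto (fun n => ⟪u n, w⟫_ℝ) Filter.atTop (nhds ⟪u₀, w⟫_ℝ))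
    (hu : ∀ n, j' (j (u n) - e) = B (f - A n (u n))) : j' (j u₀ - e) = B (f - A₀ u₀) := by
  rw [inner_solution_equation hj B hA₀]
  intro w
  refine tendsto_nhds_unique ((hw (j' (j w))).sub_const ⟪j' e, w⟫_ℝ) ?_
  refine Filter.Tendsto.congr (fun n => ((inner_solution_equation hj B (hA n) e f _).mp (hu n) w).symm) ?_
  exact (tendsto_inner_of_weak_of_strong hR hw (hlim _)).const_sub _

/-- The bound `R` is fixed before `m`: it involves only `κ`, the coercivity constant `c₀ * c` and
`‖F‖`. -/
theorem exists_solution_operator_equation (ι : V →L[ℝ] H) (D : V →L[ℝ] Lp E 2 μ) {α c c₀ : ℝ}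
    (hα₀ : 0 < α) (hα₁ : α < 1) (hc₀ : 0 < c₀) (hc : 0 < c) (hD : ∀ u, c * ‖u‖ ^ 2 ≤ ‖D u‖ ^ 2)
    (u₀ : H) (F : L2Time T V) :
    ∃ R : ℝ, ∀ (m : S × ℝ → ℝ) (hm : Measurable m) (hC : ∀ z, |m z| ≤ C), (∀ z, c₀ ≤ m z) →
      ∃ u : L2Time T V, ‖u‖ ≤ R ∧ ∀ v : L2Time T V,
        adjointLp _ ι (ι.compLpL 2 _ v - constTime T u₀) =
          rlOp T hα₀ V (F - stiffness D T hm hC v) ↔ v = u := by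
  obtain ⟨κ, hκ, hC'⟩ := exists_inner_constTime_sq_le hα₀ hα₁ T u₀
  -- With `e = 0` the inequality reduces to accretivity of the fractional integral on `L²(0,T;V)`.
  obtain ⟨κ', hκ', hB⟩ := exists_inner_constTime_sq_le hα₀ hα₁ T (0 : V)
  have hCn : ∀ w : L2Time T H, 0 ≤ ⟪rlOp T hα₀ H w, w⟫_ℝ := fun w =>
    nonneg_of_mul_nonneg_right ((sq_nonneg _).trans (hC' w)) hκ
  have hBn : ∀ w : L2Time T V, 0 ≤ ⟪rlOp T hα₀ V w, w⟫_ℝ := fun w =>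
    nonneg_of_mul_nonneg_right ((sq_nonneg _).trans (hB w)) hκ'
  have hBC : ∀ y, rlOp T hα₀ V (adjointLp _ ι y) = adjointLp _ ι (rlOp T hα₀ H y) :=
    fun y => (adjointLp_rlOp hα₀ _ y).symm
  have ha : 0 < c₀ * c := mul_pos hc₀ hc
  refine ⟨√(κ / (c₀ * c)) + ‖F‖ / (c₀ * c), fun m hm hC hmc => ?_⟩
  have hA := mul_norm_sq_le_inner_stiffness (T := T) hc₀.le hD hm hC hmc
  obtain ⟨u, hu, hequ⟩ := exists_solution_of_accretive (ι.compLpL 2 _) (adjointLp _ ι)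
    (rlOp T hα₀ V) (stiffness D T hm hC) (rlOp T hα₀ H) (constTime T u₀) F
    (inner_compLpL_left ι) hκ ha hBC hC' hA
  refine ⟨u, hu, fun v => ⟨fun hv => ?_, fun hv => hv ▸ hequ⟩⟩
  rw [← sub_eq_zero]
  refine solution_unique_of_accretive (ι.compLpL 2 _) (adjointLp _ ι)
    (rlOp T hα₀ V) (stiffness D T hm hC) (rlOp T hα₀ H) (inner_compLpL_left ι) ha hBC hCn hBn
    (rlOp_injective hα₀ hα₁) hA (v - u) ?_
  simp only [map_sub] at hv hequ ⊢
  have := congrArg₂ (· - ·) hv hequ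
  rw [sub_sub_sub_cancel_right, sub_sub_sub_cancel_left] at this
  rw [this]
  abel

theorem operator_equation_of_tendsto (ι : V →L[ℝ] H) (D : V →L[ℝ] Lp E 2 μ) {β : ℝ} (hβ : 0 < β)
    {m : ℕ → S × ℝ → ℝ} {m₀ : S × ℝ → ℝ}
    (hm : ∀ n, Measurable (m n)) (hm₀ : Measurable m₀) (hC : ∀ n z, |m n z| ≤ C)
    (hC₀ : ∀ z, |m₀ z| ≤ C)
    (hlim : ∀ᵐ t ∂volume.restrict (Ioo 0 T), ∀ᵐ x ∂μ,
      Filter.Tendsto (fun n => m n (x, t)) Filter.atTop (nhds (m₀ (x, t))))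
    (e : L2Time T H) (F : L2Time T V) {u : ℕ → L2Time T V} {v : L2Time T V} {R : ℝ}
    (hR : ∀ n, ‖u n‖ ≤ R)
    (hw : ∀ w, Filter.Tendsto (fun n => ⟪u n, w⟫_ℝ) Filter.atTop (nhds ⟪v, w⟫_ℝ))
    (hu : ∀ n, adjointLp _ ι (ι.compLpL 2 _ (u n) - e) =
      rlOp T hβ V (F - stiffness D T (hm n) (hC n) (u n))) :
    adjointLp _ ι (ι.compLpL 2 _ v - e) = rlOp T hβ V (F - stiffness D T hm₀ hC₀ v) :=
  solution_of_tendsto (inner_compLpL_left ι) (rlOp T hβ V)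
    (A := fun n => stiffness D T (hm n) (hC n))
    (fun _ => inner_stiffness_comm D _ _) (inner_stiffness_comm D _ _)
    (tendsto_stiffness D hm hm₀ hC hC₀ hlim) e F hR hw hu

end AbstractWeakSolution

/-! ### Representatives of the coefficients that are bounded at every point -/

section Clip

variable {d : ℕ} {Ω : Set (Space d)} {T : ℝ} {c₀ c₁ : ℝ}

/-- The representative of `q`, truncated to `[c₀, c₁]`. -/
def clip (c₀ c₁ : ℝ) (q : LInfty Ω T) (z : Space d × ℝ) : ℝ := max c₀ (min c₁ (q z))

theorem measurable_clip (q : LInfty Ω T) : Measurable (clip c₀ c₁ q) :=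
  measurable_const.max (measurable_const.min (Lp.stronglyMeasurable q).measurable)

theorem le_clip (q : LInfty Ω T) (z : Space d × ℝ) : c₀ ≤ clip c₀ c₁ q z := le_max_left _ _

theorem abs_clip_le (hc₀ : 0 < c₀) (hc₁ : c₀ < c₁) (q : LInfty Ω T) (z : Space d × ℝ) :
    |clip c₀ c₁ q z| ≤ c₁ := by
  rw [abs_of_nonneg (hc₀.le.trans (le_clip q z))]
  exact max_le hc₁.le (min_le_left _ _)

theorem ae_ae_of_ae_cylinder {p : Space d × ℝ → Prop}
    (h : ∀ᵐ z ∂volume.restrict (cylinder Ω T), p z) :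
    ∀ᵐ t ∂volume.restrict (Ioo 0 T), ∀ᵐ x ∂volume.restrict Ω, p (x, t) := by
  rw [cylinder, Measure.volume_eq_prod, ← Measure.prod_restrict, ← Measure.prod_swap] at h
  exact Measure.ae_ae_of_ae_prod (ae_of_ae_map measurable_swap.aemeasurable h)

theorem ae_eq_clip {q : LInfty Ω T} (hq : q ∈ admissibleSet Ω T c₀ c₁) :
    ∀ᵐ z ∂volume.restrict (cylinder Ω T), q z = clip c₀ c₁ q z := by
  filter_upwards [hq] with z hz
  rw [clip, min_eq_right hz.2, max_eq_right hz.1]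

end Clip

/-! ### States of admissible coefficients: existence, uniqueness, stability -/

section SolutionOperator

open scoped InnerProductSpace

open ContinuousLinearMap (adjoint)

instance : Fact ((2 : ℝ≥0∞) ≠ ⊤) := ⟨ENNReal.ofNat_ne_top⟩

variable {d : ℕ} {Ω : Set (Space d)} {T α c₀ c₁ : ℝ}

instance : CompleteSpace (H10 Ω) := Submodule.topologicalClosure.completeSpace _

theorem isWeakSolution_iff (hα₀ : 0 < α) (hα₁ : α < 1) (hc₀ : 0 < c₀) (hc₁ : c₀ < c₁) (u₀ : L2 Ω)
    (f : L2Time T (Hm1 Ω)) {q : LInfty Ω T} (hq : q ∈ admissibleSet Ω T c₀ c₁)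
    (u : L2Time T (H10 Ω)) :
    IsWeakSolution Ω T α u₀ f q u ↔
      adjointLp _ (toL2 Ω) ((toL2 Ω).compLpL 2 _ u - constTime T u₀) =
        rlOp T hα₀ (H10 Ω) (rieszTime T (H10 Ω) f -
          stiffness (grad Ω) T (measurable_clip q) (abs_clip_le hc₀ hc₁ q) u) :=
  exists_hasZeroH1Deriv_iff (toL2 Ω) (grad Ω) hα₀ hα₁ u₀ f q (measurable_clip q)
    (abs_clip_le hc₀ hc₁ q) (ae_ae_of_ae_cylinder (ae_eq_clip hq)) u

theorem exists_isWeakSolution (hd : 1 ≤ d) (hΩ : Bornology.IsBounded Ω) (hα₀ : 0 < α) (hα₁ : α < 1)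
    (hc₀ : 0 < c₀) (hc₁ : c₀ < c₁) (u₀ : L2 Ω) (f : L2Time T (Hm1 Ω)) :
    ∃ R : ℝ, ∀ q ∈ admissibleSet Ω T c₀ c₁, ∃ u : L2Time T (H10 Ω), ‖u‖ ≤ R ∧
      ∀ v, IsWeakSolution Ω T α u₀ f q v ↔ v = u := by
  obtain ⟨c, hc, hD⟩ := exists_norm_sq_le_grad hd hΩ
  obtain ⟨R, hR⟩ := exists_solution_operator_equation (C := c₁) (toL2 Ω) (grad Ω) hα₀ hα₁ hc₀ hc hD u₀
    (rieszTime T (H10 Ω) f)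
  refine ⟨R, fun q hq => ?_⟩
  obtain ⟨u, hu, H⟩ := hR _ (measurable_clip q) (abs_clip_le hc₀ hc₁ q) (le_clip q)
  exact ⟨u, hu, fun v => (isWeakSolution_iff hα₀ hα₁ hc₀ hc₁ u₀ f hq v).trans (H v)⟩

theorem isWeakSolution_of_tendsto (hα₀ : 0 < α) (hα₁ : α < 1) (hc₀ : 0 < c₀) (hc₁ : c₀ < c₁)
    {u₀ : L2 Ω} {f : L2Time T (Hm1 Ω)} {q : ℕ → LInfty Ω T} {p : LInfty Ω T}
    (hq : ∀ n, q n ∈ admissibleSet Ω T c₀ c₁) (hp : p ∈ admissibleSet Ω T c₀ c₁)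
    (hlim : ∀ᵐ z ∂volume.restrict (cylinder Ω T),
      Filter.Tendsto (fun n => q n z) Filter.atTop (nhds (p z)))
    {u : ℕ → L2Time T (H10 Ω)} {v : L2Time T (H10 Ω)} {R : ℝ} (hR : ∀ n, ‖u n‖ ≤ R)
    (hw : ∀ w, Filter.Tendsto (fun n => ⟪u n, w⟫_ℝ) Filter.atTop (nhds ⟪v, w⟫_ℝ))
    (hu : ∀ n, IsWeakSolution Ω T α u₀ f (q n) (u n)) : IsWeakSolution Ω T α u₀ f p v := by
  have hcl := ae_ae_of_ae_cylinder (Ω := Ω) (T := T)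
    (p := fun z => Filter.Tendsto (fun n => clip c₀ c₁ (q n) z) Filter.atTop
      (nhds (clip c₀ c₁ p z))) (by
        filter_upwards [hlim] with z hz
        exact tendsto_const_nhds.max (tendsto_const_nhds.min hz))
  rw [isWeakSolution_iff hα₀ hα₁ hc₀ hc₁ u₀ f hp]
  refine operator_equation_of_tendsto (toL2 Ω) (grad Ω) hα₀
    (fun n => measurable_clip (c₀ := c₀) (c₁ := c₁) (q n)) (measurable_clip p)
    (fun n => abs_clip_le hc₀ hc₁ (q n)) (abs_clip_le hc₀ hc₁ p) hcl _ _ hR hw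
    fun n => (isWeakSolution_iff hα₀ hα₁ hc₀ hc₁ u₀ f (hq n) (u n)).mp (hu n)

end SolutionOperator

/-! ### Translation estimates from a bound on the distributional gradient -/

section Rellich

open scoped Convolution

variable {E : Type*} [NormedAddCommGroup E] [NormedSpace ℝ E]

theorem IsTestFunction.comp_add_right {U : Set E} {φ : E → ℝ} (hφ : ContDiff ℝ ∞ φ)
    (hc : HasCompactSupport φ) {s : E} (hs : ∀ x ∈ tsupport φ, x - s ∈ U) :
    IsTestFunction U fun x => φ (x + s) := by
  refine ⟨hφ.comp (contDiff_id.add contDiff_const), hc.comp_homeomorph (Homeomorph.addRight s),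
    fun x hx => ?_⟩
  have h : x + s ∈ tsupport φ := by
    have := tsupport_comp_eq_preimage φ (Homeomorph.addRight s)
    exact (this ▸ hx : x ∈ (Homeomorph.addRight s) ⁻¹' tsupport φ)
  simpa using hs _ h

variable [MeasurableSpace E] [BorelSpace E] {μ : Measure E}

/-- The derivative of `t ↦ ∫ r x * ψ (x + t • z)` falls on `ψ`, so `hM` bounds it as long as the
translates stay supported in `Q`; the mean value inequality concludes. -/
theorem abs_integral_mul_translate_sub_le {Q : Set E} {r : E → ℝ} (hr : Integrable r μ) {M C : ℝ}
    (hM : ∀ φ, IsTestFunction Q φ → (∀ x, |φ x| ≤ C) → ∀ v,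
      |∫ x, r x * fderiv ℝ φ x v ∂μ| ≤ M * ‖v‖)
    {ψ : E → ℝ} (hψ : ContDiff ℝ ∞ ψ) (hc : HasCompactSupport ψ) (hC : ∀ x, |ψ x| ≤ C) {z : E}
    (hz : ∀ t ∈ Icc (0 : ℝ) 1, ∀ x ∈ tsupport ψ, x - t • z ∈ Q) :
    |∫ x, r x * ψ (x + z) ∂μ - ∫ x, r x * ψ x ∂μ| ≤ M * ‖z‖ := by
  have hd := hψ.differentiable (by simp)
  obtain ⟨B, hB⟩ := (hψ.continuous_fderiv (by simp)).bounded_above_of_compact_support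
    (hc.fderiv (𝕜 := ℝ))
  have hder (t : ℝ) : HasDerivAt (fun t : ℝ => ∫ x, r x * ψ (x + t • z) ∂μ)
      (∫ x, r x * fderiv ℝ ψ (x + t • z) z ∂μ) t := by
    refine (hasDerivAt_integral_of_dominated_loc_of_deriv_le (s := univ)
      (F := fun (t : ℝ) x => r x * ψ (x + t • z))
      (F' := fun (t : ℝ) x => r x * fderiv ℝ ψ (x + t • z) z)
      (bound := fun x => |r x| * (B * ‖z‖)) Filter.univ_mem (.of_forall fun t => ?_) ?_ ?_
      (.of_forall fun x t _ => ?_) (hr.abs.mul_const _) (.of_forall fun x t _ => ?_)).2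
    · exact hr.1.mul (hψ.continuous.comp (by fun_prop)).aestronglyMeasurable
    · refine hr.mul_bdd (c := C) (hψ.continuous.comp (by fun_prop)).aestronglyMeasurable
        (.of_forall fun x => hC _)
    · exact hr.1.mul (((hψ.continuous_fderiv (by simp)).comp (by fun_prop)).clm_apply
        continuous_const).aestronglyMeasurable
    · rw [norm_mul, Real.norm_eq_abs (r x)]
      gcongr
      exact (fderiv ℝ ψ _).le_of_opNorm_le (hB _) z
    · have h1 : HasDerivAt (fun t : ℝ => x + t • z) z t := by
        simpa using ((hasDerivAt_id t).smul_const z).const_add x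
      exact ((hd (x + t • z)).hasFDerivAt.comp_hasDerivAt t h1).const_mul _
  have h := norm_image_sub_le_of_norm_deriv_le_segment_01' (C := M * ‖z‖)
    (fun t _ => (hder t).hasDerivWithinAt) (fun t ht => ?_)
  · simpa using h
  · have := hM _ (IsTestFunction.comp_add_right (U := Q) hψ hc (hz t ⟨ht.1, ht.2.le⟩))
      (fun x => hC _) z
    simpa only [fderiv_comp_add_right, Real.norm_eq_abs] using this

variable [FiniteDimensional ℝ E] [μ.IsAddHaarMeasure]

/-- Mollification: unit mass preserves the bound `C`, a small radius confines the support, and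
Lebesgue differentiation gives the limit. -/
theorem exists_smooth_approx {K : Set E} (hK : IsCompact K) {g : E → ℝ} (hg : Measurable g) {C : ℝ}
    (hC : ∀ x, |g x| ≤ C) (hgK : ∀ x ∉ K, g x = 0) {δ : ℝ} (hδ : 0 < δ) :
    ∃ ψ : ℕ → E → ℝ, (∀ k, ContDiff ℝ ∞ (ψ k)) ∧ (∀ k, tsupport (ψ k) ⊆ Metric.cthickening δ K) ∧
      (∀ k x, |ψ k x| ≤ C) ∧
      ∀ᵐ x ∂μ, Filter.Tendsto (fun k => ψ k x) Filter.atTop (nhds (g x)) := by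
  have hgi : Integrable g μ := by
    have h : g = K.indicator g := by
      ext x
      by_cases hx : x ∈ K
      · rw [indicator_of_mem hx]
      · rw [indicator_of_notMem hx, hgK x hx]
    rw [h, integrable_indicator_iff hK.measurableSet]
    exact Measure.integrableOn_of_bounded hK.measure_lt_top.ne hg.aestronglyMeasurable
      (M := C) (.of_forall hC)
  have hpos (k : ℕ) : 0 < δ / (k + 1) := by positivity
  let b (k : ℕ) : ContDiffBump (0 : E) :=
    ⟨δ / (k + 1) / 2, δ / (k + 1), half_pos (hpos k), half_lt_self (hpos k)⟩
  have hle (k : ℕ) : (b k).rOut ≤ δ := div_le_self hδ.le (by simp)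
  refine ⟨fun k => (b k).normed μ ⋆[ContinuousLinearMap.lsmul ℝ ℝ, μ] g, fun k => ?_, fun k => ?_,
    fun k x => ?_, ?_⟩
  · exact (b k).hasCompactSupport_normed.contDiff_convolution_left _ (b k).contDiff_normed
      hgi.locallyIntegrable
  · refine closure_minimal ((support_convolution_subset _).trans ?_) Metric.isClosed_cthickening
    rintro _ ⟨x, hx, y, hy, rfl⟩
    rw [(b k).support_normed_eq, mem_ball_zero_iff] at hx
    refine Metric.mem_cthickening_of_dist_le _ y _ _ (by_contra fun h => hy (hgK y h)) ?_
    rw [dist_eq_norm, add_sub_cancel_right]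
    exact hx.le.trans (hle k)
  · change |((b k).normed μ ⋆[ContinuousLinearMap.lsmul ℝ ℝ, μ] g) x| ≤ C
    rw [convolution_def, ← Real.norm_eq_abs]
    refine (norm_integral_le_of_norm_le (((b k).integrable_normed (μ := μ)).mul_const C)
      (.of_forall fun y => ?_)).trans_eq ?_
    · rw [ContinuousLinearMap.lsmul_apply, norm_smul, Real.norm_of_nonneg ((b k).nonneg_normed y)]
      exact mul_le_mul_of_nonneg_left (hC _) ((b k).nonneg_normed y)
    · rw [integral_mul_const, (b k).integral_normed, one_mul]
  · refine ContDiffBump.ae_convolution_tendsto_right_of_locallyIntegrable (K := 2) ?_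
      (.of_forall fun k => ?_) hgi.locallyIntegrable
    · simpa [b, div_eq_mul_inv] using (tendsto_one_div_add_atTop_nhds_zero_nat (𝕜 := ℝ)).const_mul δ
    · change δ / (k + 1) ≤ 2 * (δ / (k + 1) / 2)
      linarith

/-- Since `hM` constrains test functions only by a supremum bound, the estimate passes to bounded
measurable `g`. Half of the margin `δ` is spent on mollification, half on translation. -/
theorem abs_integral_mul_translate_sub_le_of_compact {Q : Set E} {r : E → ℝ} (hr : Integrable r μ)
    {M C : ℝ} (hM : ∀ φ, IsTestFunction Q φ → (∀ x, |φ x| ≤ C) → ∀ v,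
      |∫ x, r x * fderiv ℝ φ x v ∂μ| ≤ M * ‖v‖)
    {K : Set E} (hK : IsCompact K) {δ : ℝ} (hδ : 0 < δ) (hKQ : Metric.cthickening δ K ⊆ Q)
    {g : E → ℝ} (hg : Measurable g) (hC : ∀ x, |g x| ≤ C) (hgK : ∀ x ∉ K, g x = 0) {z : E}
    (hz : ‖z‖ ≤ δ / 2) :
    |∫ x, r x * g (x + z) ∂μ - ∫ x, r x * g x ∂μ| ≤ M * ‖z‖ := by
  obtain ⟨ψ, h1, h2, h3, h4⟩ := exists_smooth_approx (μ := μ) hK hg hC hgK (half_pos hδ)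
  have hlim (w : E) : Filter.Tendsto (fun k => ∫ x, r x * ψ k (x + w) ∂μ) Filter.atTop
      (nhds (∫ x, r x * g (x + w) ∂μ)) := by
    refine tendsto_integral_of_dominated_convergence (fun x => |r x| * C)
      (fun k => hr.1.mul ((h1 k).continuous.comp (by fun_prop)).aestronglyMeasurable)
      (hr.abs.mul_const C) (fun k => .of_forall fun x => ?_) ?_
    · rw [norm_mul, Real.norm_eq_abs, Real.norm_eq_abs]
      exact mul_le_mul_of_nonneg_left (h3 k _) (abs_nonneg _)
    · filter_upwards [(measurePreserving_add_right μ w).quasiMeasurePreserving.ae h4] with x hx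
      exact hx.const_mul _
  have h0 := hlim 0
  simp only [add_zero] at h0
  refine le_of_tendsto ((hlim z).sub h0).abs (.of_forall fun k => ?_)
  have hc : HasCompactSupport (ψ k) :=
    hK.cthickening.of_isClosed_subset (isClosed_tsupport _) (h2 k)
  refine abs_integral_mul_translate_sub_le hr hM (h1 k) hc (h3 k) fun t ht x hx => hKQ ?_
  refine Metric.cthickening_cthickening_subset (half_pos hδ).le (half_pos hδ).le K |>.trans
    (by rw [add_halves]) ?_
  refine Metric.mem_cthickening_of_dist_le _ x _ _ (h2 k hx) ?_
  rw [dist_eq_norm, sub_sub_cancel_left, norm_neg, norm_smul, Real.norm_of_nonneg ht.1]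
  exact (mul_le_of_le_one_left (norm_nonneg z) ht.2).trans hz

end Rellich

/-! ### From weak to strong `L²` convergence -/

section Rellich

variable {E : Type*} [NormedAddCommGroup E] [NormedSpace ℝ E] [FiniteDimensional ℝ E]
  [MeasurableSpace E] [BorelSpace E] {μ : Measure E} [μ.IsAddHaarMeasure]

/-- Averaging the correlation over translations replaces `r` by its integrals over balls, which a
weakly null sequence sends to zero at each point. -/
theorem setIntegral_ball_integral_mul_translate {r g : E → ℝ} (hr : Measurable r)
    (hri : Integrable r μ) (hg : Measurable g) (hgi : Integrable g μ) {C : ℝ}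
    (hrC : ∀ x, |r x| ≤ C) (hgC : ∀ x, |g x| ≤ C) (ε : ℝ) :
    IntegrableOn (fun w => ∫ x, r x * g (x + w) ∂μ) (Metric.ball 0 ε) μ ∧
    ∫ w in Metric.ball 0 ε, ∫ x, r x * g (x + w) ∂μ ∂μ =
      ∫ x, g x * ∫ y in Metric.ball x ε, r y ∂μ ∂μ := by
  have : IsFiniteMeasure (μ.restrict (Metric.ball 0 ε)) :=
    ⟨by simpa using measure_ball_lt_top⟩
  have hI1 : Integrable (fun p : E × E => r p.2 * g (p.2 + p.1))
      ((μ.restrict (Metric.ball 0 ε)).prod μ) :=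
    (hri.comp_snd _).mul_bdd (c := C) (hg.comp (by fun_prop)).aestronglyMeasurable
      (.of_forall fun p => hgC _)
  have hI2 : Integrable (fun p : E × E => g p.2 * r (p.2 - p.1))
      ((μ.restrict (Metric.ball 0 ε)).prod μ) :=
    (hgi.comp_snd _).mul_bdd (c := C) (hr.comp (by fun_prop)).aestronglyMeasurable
      (.of_forall fun p => hrC _)
  refine ⟨hI1.integral_prod_left, ?_⟩
  have h1 (w : E) : ∫ x, r x * g (x + w) ∂μ = ∫ x, g x * r (x - w) ∂μ := by
    rw [← integral_sub_right_eq_self _ w]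
    simp only [sub_add_cancel, mul_comm]
  simp only [h1]
  rw [integral_integral_swap hI2]
  refine integral_congr_ae (.of_forall fun x => ?_)
  simp only
  rw [integral_const_mul, ← integral_indicator Metric.isOpen_ball.measurableSet,
    ← integral_indicator Metric.isOpen_ball.measurableSet, ← integral_sub_left_eq_self _ _ x]
  congr 2
  ext y
  simp only [indicator, sub_zero, sub_sub_cancel, Metric.mem_ball, dist_eq_norm,
    norm_sub_rev]

variable {Q : Set E} {r : ℕ → E → ℝ} {C M : ℝ}

/-- With `g = 1_K r`, the integral of `r²` over `K` is the correlation of `r` and `g` at shift zero.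
The translation estimate says it differs little from its average over a small ball of shifts,
uniformly in `n`, and for a fixed ball this average tends to zero. -/
theorem tendsto_setIntegral_sq_of_compact (hQ : IsOpen Q) (hμQ : μ Q ≠ ⊤)
    (hr : ∀ n, Measurable (r n)) (hC : ∀ n x, |r n x| ≤ C) (hrQ : ∀ n, ∀ x ∉ Q, r n x = 0)
    (hM : ∀ n φ, IsTestFunction Q φ → (∀ x, |φ x| ≤ C) → ∀ v,
      |∫ x, r n x * fderiv ℝ φ x v ∂μ| ≤ M * ‖v‖)
    (hw : ∀ s, MeasurableSet s →
      Filter.Tendsto (fun n => ∫ x in s, r n x ∂μ) Filter.atTop (nhds 0))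
    {K : Set E} (hK : IsCompact K) (hKQ : K ⊆ Q) :
    Filter.Tendsto (fun n => ∫ x in K, r n x ^ 2 ∂μ) Filter.atTop (nhds 0) := by
  have hC0 : 0 ≤ C := (abs_nonneg _).trans (hC 0 0)
  have hind (n : ℕ) : (Q.indicator (r n)) = r n := by
    rw [indicator_eq_self]
    exact fun x hx => by_contra fun h => hx (hrQ n x h)
  have hri (n : ℕ) : Integrable (r n) μ := by
    rw [← hind n, integrable_indicator_iff hQ.measurableSet]
    exact Measure.integrableOn_of_bounded hμQ (hr n).aestronglyMeasurable (M := C)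
      (.of_forall (hC n))
  obtain ⟨δ, hδ, hδQ⟩ := hK.exists_cthickening_subset_open hQ hKQ
  set g : ℕ → E → ℝ := fun n => K.indicator (r n)
  have hg (n : ℕ) : Measurable (g n) := (hr n).indicator hK.measurableSet
  have hgC (n : ℕ) (x : E) : |g n x| ≤ C := by
    by_cases hx : x ∈ K
    · simpa [g, hx] using hC n x
    · simpa [g, hx] using hC0
  have hgK (n : ℕ) : ∀ x ∉ K, g n x = 0 := fun x hx => indicator_of_notMem hx _
  have hgi (n : ℕ) : Integrable (g n) μ := (hri n).indicator hK.measurableSet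
  have hS0 (n : ℕ) : ∫ x in K, r n x ^ 2 ∂μ = ∫ x, r n x * g n x ∂μ := by
    rw [← integral_indicator hK.measurableSet]
    congr 1
    ext x
    by_cases hx : x ∈ K <;> simp [g, hx, sq]
  have havg (ε : ℝ) : Filter.Tendsto
      (fun n => ∫ w in Metric.ball 0 ε, ∫ x, r n x * g n (x + w) ∂μ ∂μ) Filter.atTop (nhds 0) := by
    simp only [fun n => (setIntegral_ball_integral_mul_translate (hr n) (hri n) (hg n) (hgi n)
      (hC n) (hgC n) ε).2]
    have hb (n : ℕ) (x : E) : |∫ y in Metric.ball x ε, r n y ∂μ| ≤ C * μ.real (Metric.ball 0 ε) := by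
      have := norm_setIntegral_le_of_norm_le_const (measure_ball_lt_top (μ := μ) (x := x) (r := ε))
        (f := r n) (C := C) fun y _ => hC n y
      rwa [Measure.real, Measure.addHaar_ball_center] at this
    have := tendsto_integral_of_dominated_convergence (μ := μ)
      (F := fun n x => g n x * ∫ y in Metric.ball x ε, r n y ∂μ) (f := fun _ => 0)
      (K.indicator fun _ => C * (C * μ.real (Metric.ball 0 ε))) (fun n => ?_) ?_
      (fun n => .of_forall fun x => ?_) (.of_forall fun x => ?_)
    · simpa using this
    · refine (hg n).aestronglyMeasurable.mul ?_
      have h2 (x : E) : ∫ y in Metric.ball x ε, r n y ∂μ =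
          ∫ y, (if dist y x < ε then r n y else 0) ∂μ := by
        rw [← integral_indicator Metric.isOpen_ball.measurableSet]
        rfl
      simp only [h2]
      refine StronglyMeasurable.aestronglyMeasurable ?_
      refine StronglyMeasurable.integral_prod_right (f := fun x y => if dist y x < ε then r n y else 0) ?_
      exact (Measurable.ite (measurableSet_lt (by fun_prop) measurable_const)
        ((hr n).comp measurable_snd) measurable_const).stronglyMeasurable
    · exact (integrable_indicator_iff hK.measurableSet).mpr
        (integrableOn_const hK.measure_lt_top.ne)
    · by_cases hx : x ∈ K
      · rw [indicator_of_mem hx, norm_mul]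
        exact mul_le_mul (hgC n x) (hb n x) (norm_nonneg _) hC0
      · simp [hx, hgK n x hx]
    · refine squeeze_zero_norm (fun n => ?_) (by
        simpa using ((hw _ (Metric.isOpen_ball (x := x) (ε := ε)).measurableSet).abs.const_mul C))
      rw [norm_mul]
      exact mul_le_mul_of_nonneg_right (hgC n x) (abs_nonneg _)
  rw [Metric.tendsto_atTop]
  intro η hη
  -- The radius is fixed before `n`, so that shifts stay admissible and cost at most `η / 2`; the `+
  -- 1` covers `M = 0`.
  obtain ⟨ε, hε, hεδ, hεη⟩ : ∃ ε > 0, ε ≤ δ / 2 ∧ |M| * ε ≤ η / 2 := by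
    refine ⟨min (δ / 2) (η / 2 / (|M| + 1)), by positivity, min_le_left _ _, ?_⟩
    calc |M| * min (δ / 2) (η / 2 / (|M| + 1)) ≤ (|M| + 1) * (η / 2 / (|M| + 1)) := by
          gcongr
          · linarith
          · exact min_le_right _ _
      _ = η / 2 := by field_simp
  set m := μ.real (Metric.ball 0 ε)
  have hm : 0 < m := ENNReal.toReal_pos (Metric.measure_ball_pos μ _ hε).ne'
    measure_ball_lt_top.ne
  have := (Metric.tendsto_atTop.mp (havg ε)) (m * (η / 2)) (by positivity)
  obtain ⟨N, hN⟩ := this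
  refine ⟨N, fun n hn => ?_⟩
  have h1 := hN n hn
  rw [Real.dist_eq, sub_zero] at h1 ⊢
  have hint := (setIntegral_ball_integral_mul_translate (hr n) (hri n) (hg n) (hgi n)
      (hC n) (hgC n) ε).1
  have h2 : |∫ w in Metric.ball 0 ε, (∫ x, r n x * g n (x + w) ∂μ -
      ∫ x, r n x * g n x ∂μ) ∂μ| ≤ η / 2 * m := by
    rw [← Real.norm_eq_abs]
    refine norm_setIntegral_le_of_norm_le_const measure_ball_lt_top fun w hw' => ?_
    rw [mem_ball_zero_iff] at hw'
    refine (abs_integral_mul_translate_sub_le_of_compact (hri n) (hM n) hK hδ hδQ (hg n) (hgC n)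
      (hgK n) (hw'.le.trans hεδ)).trans (le_trans ?_ hεη)
    exact mul_le_mul (le_abs_self M) hw'.le (norm_nonneg _) (abs_nonneg _)
  rw [integral_sub hint (integrableOn_const measure_ball_lt_top.ne), setIntegral_const, smul_eq_mul,
    ← hS0] at h2
  have h3 : m * |∫ x in K, r n x ^ 2 ∂μ| < m * η := by
    rw [← abs_of_pos hm, ← abs_mul, abs_of_pos hm]
    have := abs_sub_abs_le_abs_sub (m * ∫ x in K, r n x ^ 2 ∂μ)
      (∫ w in Metric.ball 0 ε, ∫ x, r n x * g n (x + w) ∂μ ∂μ)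
    rw [abs_sub_comm] at this
    linarith
  exact lt_of_mul_lt_mul_left h3 hm.le

/-- Inner regularity leaves a set of small measure near the boundary, where the uniform bound on `r`
suffices. -/
theorem tendsto_integral_sq_of_weak (hQ : IsOpen Q) (hμQ : μ Q ≠ ⊤)
    (hr : ∀ n, Measurable (r n)) (hC : ∀ n x, |r n x| ≤ C) (hrQ : ∀ n, ∀ x ∉ Q, r n x = 0)
    (hM : ∀ n φ, IsTestFunction Q φ → (∀ x, |φ x| ≤ C) → ∀ v,
      |∫ x, r n x * fderiv ℝ φ x v ∂μ| ≤ M * ‖v‖)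
    (hw : ∀ s, MeasurableSet s →
      Filter.Tendsto (fun n => ∫ x in s, r n x ∂μ) Filter.atTop (nhds 0)) :
    Filter.Tendsto (fun n => ∫ x in Q, r n x ^ 2 ∂μ) Filter.atTop (nhds 0) := by
  rw [Metric.tendsto_atTop]
  intro η hη
  have hC0 : 0 ≤ C := (abs_nonneg _).trans (hC 0 0)
  set a : ℝ := η / 2 / (C ^ 2 + 1)
  have ha : 0 < a := by positivity
  obtain ⟨K, hKQ, hK, hlt⟩ := hQ.measurableSet.exists_isCompact_sdiff_lt hμQ
    (ENNReal.ofReal_pos.mpr ha).ne'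
  have hreal : μ.real (Q \ K) ≤ a := ENNReal.toReal_le_of_le_ofReal ha.le hlt.le
  obtain ⟨N, hN⟩ := (Metric.tendsto_atTop.mp
    (tendsto_setIntegral_sq_of_compact hQ hμQ hr hC hrQ hM hw hK hKQ)) (η / 2) (half_pos hη)
  refine ⟨N, fun n hn => ?_⟩
  have h1 := hN n hn
  rw [Real.dist_eq, sub_zero, abs_of_nonneg (integral_nonneg fun x => sq_nonneg _)] at h1 ⊢
  have hsq (x : E) : ‖r n x ^ 2‖ ≤ C ^ 2 := by
    rw [norm_pow]
    exact pow_le_pow_left₀ (norm_nonneg _) (hC n x) 2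
  have hint : IntegrableOn (fun x => r n x ^ 2) Q μ :=
    Measure.integrableOn_of_bounded hμQ ((hr n).pow_const 2).aestronglyMeasurable (M := C ^ 2)
      (.of_forall hsq)
  have h2 := norm_setIntegral_le_of_norm_le_const
    ((measure_mono sdiff_subset).trans_lt hμQ.lt_top : μ (Q \ K) < ⊤)
    (f := fun x => r n x ^ 2) (C := C ^ 2) fun y _ => hsq y
  rw [Real.norm_of_nonneg (integral_nonneg fun x => sq_nonneg _)] at h2
  have h3 := setIntegral_union (μ := μ) (f := fun x => r n x ^ 2) (disjoint_sdiff_right (s := K) (t := Q))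
    (hQ.measurableSet.diff hK.measurableSet) (hint.mono_set hKQ) (hint.mono_set sdiff_subset)
  rw [union_sdiff_cancel hKQ] at h3
  have h4 : C ^ 2 * μ.real (Q \ K) ≤ η / 2 := by
    calc C ^ 2 * μ.real (Q \ K) ≤ (C ^ 2 + 1) * a := by
          gcongr
          linarith
      _ = η / 2 := by simp only [a]; field_simp
  linarith

end Rellich

/-! ### Weak gradients and convergence of bounded coefficients -/

section Coefficients

open scoped InnerProductSpace

variable {E : Type*} [NormedAddCommGroup E] [NormedSpace ℝ E] [MeasurableSpace E]
  {F : Type*} [NormedAddCommGroup F] [InnerProductSpace ℝ F]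
  {μ : Measure E} {Q : Set E} {A : E →L[ℝ] F}

/-- `G` is the weak gradient of `q` on `Q`, where the gradient takes values in the Hilbert space
`F`, and `A` embeds the directions into `F`. -/
def IsWeakGradientOn (μ : Measure E) (Q : Set E) (A : E →L[ℝ] F) (q : E → ℝ) (G : E → F) : Prop :=
  ∀ φ : E → ℝ, IsTestFunction Q φ → ∀ v : E,
    ∫ x in Q, q x * fderiv ℝ φ x v ∂μ = -∫ x in Q, ⟪G x, A v⟫_ℝ * φ x ∂μ

section Finite

variable {α : Type*} [MeasurableSpace α] {ν : Measure α} [IsFiniteMeasure ν]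

/-- Pairings with `φ` become inner products with an `L²` function whose norm depends on `φ` only
through its supremum bound; this yields the hypothesis `hM` of the translation estimates. -/
theorem exists_toLp_inner_smul {φ : α → ℝ} (hφ : AEStronglyMeasurable φ ν) {C : ℝ} (hC0 : 0 ≤ C)
    (hC : ∀ x, |φ x| ≤ C) (a : F) :
    ∃ W : Lp F 2 ν, (∀ G : Lp F 2 ν, ⟪G, W⟫_ℝ = ∫ x, ⟪G x, a⟫_ℝ * φ x ∂ν) ∧
      ‖W‖ ≤ measureUnivNNReal ν ^ (2 : ℝ)⁻¹ * (C * ‖a‖) := by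
  have hb (x : α) : ‖φ x • a‖ ≤ C * ‖a‖ := by
    rw [norm_smul]
    exact mul_le_mul_of_nonneg_right (hC x) (norm_nonneg a)
  have hm : MemLp (fun x => φ x • a) 2 ν :=
    MemLp.of_bound (hφ.smul_const a) (C * ‖a‖) (.of_forall hb)
  refine ⟨hm.toLp _, fun G => ?_, ?_⟩
  · rw [L2.inner_def]
    refine integral_congr_ae ?_
    filter_upwards [hm.coeFn_toLp] with x hx
    rw [hx, real_inner_smul_right, mul_comm]
  · have := Lp.norm_le_of_ae_bound (f := hm.toLp _) (p := 2) (C := C * ‖a‖) (by positivity) (by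
      filter_upwards [hm.coeFn_toLp] with x hx
      rw [hx]
      exact hb x)
    simpa using this

theorem exists_toLp_inner_mul {φ : α → ℝ} (hφ : AEStronglyMeasurable φ ν) {C : ℝ} (hC0 : 0 ≤ C)
    (hC : ∀ x, |φ x| ≤ C) :
    ∃ W : Lp ℝ 2 ν, ∀ q : Lp ℝ 2 ν, ⟪q, W⟫_ℝ = ∫ x, q x * φ x ∂ν := by
  obtain ⟨W, hW, -⟩ := exists_toLp_inner_smul (F := ℝ) hφ hC0 hC 1
  exact ⟨W, fun q => by simp [hW q]⟩

/-- Weak convergence preserves the bounds on integrals over measurable sets, and these determine the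
pointwise bounds. -/
theorem ae_mem_Icc_of_tendsto_inner {q : ℕ → Lp ℝ 2 ν} {p : Lp ℝ 2 ν} {a b : ℝ}
    (hq : ∀ n, ∀ᵐ x ∂ν, a ≤ q n x ∧ q n x ≤ b)
    (hw : ∀ w, Filter.Tendsto (fun n => ⟪q n, w⟫_ℝ) Filter.atTop (nhds ⟪p, w⟫_ℝ)) :
    ∀ᵐ x ∂ν, a ≤ p x ∧ p x ≤ b := by
  have hint (w : Lp ℝ 2 ν) : Integrable w ν := (Lp.memLp w).integrable (by norm_num)
  have hs (s : Set α) (hs : MeasurableSet s) : Filter.Tendsto (fun n => ∫ x in s, q n x ∂ν)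
      Filter.atTop (nhds (∫ x in s, p x ∂ν)) := by
    have := hw (indicatorConstLp 2 hs (measure_ne_top ν s) (1 : ℝ))
    simpa only [fun f : Lp ℝ 2 ν => real_inner_comm (indicatorConstLp 2 hs (measure_ne_top ν s) (1 : ℝ)) f,
      L2.inner_indicatorConstLp_one] using this
  have h1 : (fun _ => a) ≤ᵐ[ν] p := ae_le_of_forall_setIntegral_le (integrable_const a) (hint p)
    fun s h _ => ge_of_tendsto' (hs s h) fun n => setIntegral_mono_ae
      (integrableOn_const (measure_ne_top ν s)) (hint _).integrableOn ((hq n).mono fun x hx => hx.1)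
  have h2 : p ≤ᵐ[ν] (fun _ => b) := ae_le_of_forall_setIntegral_le (hint p) (integrable_const b)
    fun s h _ => le_of_tendsto' (hs s h) fun n => setIntegral_mono_ae
      (hint _).integrableOn (integrableOn_const (measure_ne_top ν s)) ((hq n).mono fun x hx => hx.2)
  filter_upwards [h1, h2] with x h3 h4 using ⟨h3, h4⟩

theorem exists_subseq_ae_tendsto_zero {r : ℕ → α → ℝ} (hr : ∀ n, Integrable (fun x => r n x ^ 2) ν)
    (h : Filter.Tendsto (fun n => ∫ x, r n x ^ 2 ∂ν) Filter.atTop (nhds 0)) :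
    ∃ φ : ℕ → ℕ, StrictMono φ ∧
      ∀ᵐ x ∂ν, Filter.Tendsto (fun n => r (φ n) x) Filter.atTop (nhds 0) := by
  have h1 : TendstoInMeasure ν (fun n x => r n x ^ 2) Filter.atTop (fun _ => 0) := by
    refine tendstoInMeasure_of_tendsto_eLpNorm one_ne_zero (fun n => (hr n).1)
      aestronglyMeasurable_const ?_
    have h2 (n : ℕ) : eLpNorm ((fun x => r n x ^ 2) - fun _ => 0) 1 ν =
        ENNReal.ofReal (∫ x, r n x ^ 2 ∂ν) := by
      rw [eLpNorm_one_eq_lintegral_enorm, ← ofReal_integral_norm_eq_lintegral_enorm]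
      · simp
      · exact (hr n).sub (integrable_const 0)
    simp only [h2]
    simpa using ENNReal.tendsto_ofReal h
  obtain ⟨φ, hφ, H⟩ := h1.exists_seq_tendsto_ae
  refine ⟨φ, hφ, ?_⟩
  filter_upwards [H] with x hx
  have := hx.sqrt
  simp only [Real.sqrt_zero, Real.sqrt_sq_eq_abs] at this
  exact (tendsto_zero_iff_abs_tendsto_zero _).mpr this

end Finite

variable [BorelSpace E]

/-- For a fixed test function both sides of the defining identity are inner products with fixed `L²`
functions, hence weakly continuous. -/
theorem IsWeakGradientOn.of_tendsto_inner (hQ : μ Q ≠ ⊤)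
    {q : ℕ → Lp ℝ 2 (μ.restrict Q)} {p : Lp ℝ 2 (μ.restrict Q)} {G : ℕ → Lp F 2 (μ.restrict Q)}
    {H : Lp F 2 (μ.restrict Q)} (hG : ∀ n, IsWeakGradientOn μ Q A (q n) (G n))
    (hq : ∀ w, Filter.Tendsto (fun n => ⟪q n, w⟫_ℝ) Filter.atTop (nhds ⟪p, w⟫_ℝ))
    (hH : ∀ w, Filter.Tendsto (fun n => ⟪G n, w⟫_ℝ) Filter.atTop (nhds ⟪H, w⟫_ℝ)) :
    IsWeakGradientOn μ Q A p H := by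
  intro φ hφ v
  have : IsFiniteMeasure (μ.restrict Q) := isFiniteMeasure_restrict.mpr hQ
  obtain ⟨C, hC⟩ := hφ.1.continuous.bounded_above_of_compact_support hφ.2.1
  have hf : Continuous fun x => fderiv ℝ φ x v :=
    (hφ.1.continuous_fderiv (by simp)).clm_apply continuous_const
  obtain ⟨B, hB⟩ := hf.bounded_above_of_compact_support (hφ.2.1.fderiv_apply ℝ v)
  obtain ⟨W, hW, -⟩ := exists_toLp_inner_smul (ν := μ.restrict Q)
    hφ.1.continuous.aestronglyMeasurable ((norm_nonneg _).trans (hC 0)) hC (A v)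
  obtain ⟨Y, hY⟩ := exists_toLp_inner_mul (ν := μ.restrict Q) hf.aestronglyMeasurable
    ((norm_nonneg _).trans (hB 0)) hB
  rw [← hW, ← hY]
  refine tendsto_nhds_unique (hq Y) ((hH W).neg.congr fun n => ?_)
  rw [hW, hY]
  exact (hG n φ hφ v).symm

variable [FiniteDimensional ℝ E] [μ.IsAddHaarMeasure]

/-- The differences `q n - p`, extended by zero, are bounded and weakly null; Cauchy-Schwarz against
`H - G n` supplies the gradient bound for the Rellich argument. -/
theorem exists_subseq_ae_tendsto_of_isWeakGradientOn (hQo : IsOpen Q) (hQ : μ Q ≠ ⊤) {c : ℝ}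
    {q : ℕ → E → ℝ} {p : E → ℝ} (hqm : ∀ n, Measurable (q n)) (hpm : Measurable p)
    (hq : ∀ n x, |q n x| ≤ c) (hp : ∀ x, |p x| ≤ c) {G : ℕ → Lp F 2 (μ.restrict Q)}
    {H : Lp F 2 (μ.restrict Q)} (hG : ∀ n, IsWeakGradientOn μ Q A (q n) (G n))
    (hH : IsWeakGradientOn μ Q A p H) {R : ℝ} (hR : ∀ n, ‖G n‖ ≤ R)
    (hw : ∀ s, MeasurableSet s → Filter.Tendsto (fun n => ∫ x in s, q n x ∂μ.restrict Q)
      Filter.atTop (nhds (∫ x in s, p x ∂μ.restrict Q))) :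
    ∃ φ : ℕ → ℕ, StrictMono φ ∧ ∀ᵐ x ∂μ.restrict Q,
      Filter.Tendsto (fun n => q (φ n) x) Filter.atTop (nhds (p x)) := by
  have : IsFiniteMeasure (μ.restrict Q) := isFiniteMeasure_restrict.mpr hQ
  have hc : 0 ≤ c := (abs_nonneg _).trans (hp 0)
  have hb {f : E → ℝ} (hf : Measurable f) {a : ℝ} (h : ∀ x, |f x| ≤ a) : Integrable f (μ.restrict Q) :=
    Integrable.of_bound hf.aestronglyMeasurable a (.of_forall h)
  have hC (n : ℕ) (x : E) : |q n x - p x| ≤ c + c :=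
    (abs_sub _ _).trans (add_le_add (hq n x) (hp x))
  set r : ℕ → E → ℝ := fun n => Q.indicator fun x => q n x - p x with hr
  have key : Filter.Tendsto (fun n => ∫ x in Q, r n x ^ 2 ∂μ) Filter.atTop (nhds 0) := by
    refine tendsto_integral_sq_of_weak (C := c + c)
      (M := (R + ‖H‖) * (measureUnivNNReal (μ.restrict Q) ^ (2 : ℝ)⁻¹ * ((c + c) * ‖A‖))) hQo hQ
      (fun n => ((hqm n).sub hpm).indicator hQo.measurableSet) (fun n x => ?_)
      (fun n x hx => indicator_of_notMem hx _) (fun n φ hφ hφC v => ?_) (fun s hs => ?_)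
    · by_cases hx : x ∈ Q
      · simpa [hr, hx] using hC n x
      · simpa [hr, hx] using add_nonneg hc hc
    · obtain ⟨W, hW, hW2⟩ := exists_toLp_inner_smul (ν := μ.restrict Q)
        hφ.1.continuous.aestronglyMeasurable (add_nonneg hc hc) hφC (A v)
      have hf : Continuous fun x => fderiv ℝ φ x v :=
        (hφ.1.continuous_fderiv (by simp)).clm_apply continuous_const
      obtain ⟨B, hB⟩ := hf.bounded_above_of_compact_support (hφ.2.1.fderiv_apply ℝ v)
      have h1 : ∫ x, r n x * fderiv ℝ φ x v ∂μ = ⟪H - G n, W⟫_ℝ := by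
        have h2 : (fun x => r n x * fderiv ℝ φ x v) =
            Q.indicator fun x => q n x * fderiv ℝ φ x v - p x * fderiv ℝ φ x v := by
          ext x
          by_cases hx : x ∈ Q
          · simp [hr, hx, sub_mul]
          · simp [hr, hx]
        rw [h2, integral_indicator hQo.measurableSet, integral_sub
          ((hb (hqm n) (hq n)).mul_bdd hf.aestronglyMeasurable (.of_forall hB))
          ((hb hpm hp).mul_bdd hf.aestronglyMeasurable (.of_forall hB)), hG n φ hφ v, hH φ hφ v,
          inner_sub_left, hW, hW]
        ring
      rw [h1]
      calc |⟪H - G n, W⟫_ℝ| ≤ ‖H - G n‖ * ‖W‖ := abs_real_inner_le_norm _ _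
        _ ≤ (R + ‖H‖) * (measureUnivNNReal (μ.restrict Q) ^ (2 : ℝ)⁻¹ * ((c + c) * (‖A‖ * ‖v‖))) := by
          refine mul_le_mul ?_ (hW2.trans ?_) (norm_nonneg _)
            (add_nonneg ((norm_nonneg _).trans (hR 0)) (norm_nonneg _))
          · rw [add_comm]
            exact (norm_sub_le _ _).trans (add_le_add_right (hR n) _)
          · gcongr
            exact A.le_opNorm v
        _ = _ := by ring
    · have h1 (n : ℕ) : ∫ x in s, r n x ∂μ =
          ∫ x in s, q n x ∂μ.restrict Q - ∫ x in s, p x ∂μ.restrict Q := by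
        rw [← integral_sub (hb (hqm n) (hq n)).integrableOn (hb hpm hp).integrableOn,
          Measure.restrict_restrict hs, hr]
        exact setIntegral_indicator hQo.measurableSet
      simp only [h1]
      exact tendsto_sub_nhds_zero_iff.mpr (hw s hs)
  have hrm (n : ℕ) : Measurable (r n) := ((hqm n).sub hpm).indicator hQo.measurableSet
  have hrsq (n : ℕ) (x : E) : |r n x ^ 2| ≤ (c + c) ^ 2 := by
    rw [abs_pow]
    refine pow_le_pow_left₀ (abs_nonneg _) ?_ 2
    by_cases hx : x ∈ Q
    · simpa [hr, hx] using hC n x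
    · simpa [hr, hx] using add_nonneg hc hc
  obtain ⟨φ, hφ, h⟩ := exists_subseq_ae_tendsto_zero (ν := μ.restrict Q)
    (fun n => hb ((hrm n).pow_const 2) (hrsq n)) key
  refine ⟨φ, hφ, ?_⟩
  filter_upwards [h, ae_restrict_mem hQo.measurableSet] with x hx hxQ
  simp only [hr, indicator_of_mem hxQ] at hx
  exact tendsto_sub_nhds_zero_iff.mp hx

end Coefficients

/-! ### Compactness of bounded coefficients with bounded gradients -/

section Compactness

open scoped InnerProductSpace

variable {E : Type*} [NormedAddCommGroup E] [NormedSpace ℝ E] [MeasurableSpace E]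
  {F : Type*} [NormedAddCommGroup F] [InnerProductSpace ℝ F]
  {μ : Measure E} {Q : Set E} {A : E →L[ℝ] F}

theorem IsWeakGradientOn.congr {q p : E → ℝ} {G : E → F} (h : IsWeakGradientOn μ Q A q G)
    (hqp : q =ᵐ[μ.restrict Q] p) : IsWeakGradientOn μ Q A p G := by
  intro φ hφ v
  rw [← h φ hφ v]
  refine integral_congr_ae ?_
  filter_upwards [hqp] with x hx
  rw [hx]

variable [BorelSpace E] [FiniteDimensional ℝ E] [μ.IsAddHaarMeasure]

theorem isWeakGradientOn_const (c : ℝ) : IsWeakGradientOn μ Q A (fun _ => c) (fun _ => 0) := by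
  intro φ hφ v
  have h0 (x : E) (hx : x ∉ Q) : c * fderiv ℝ φ x v = 0 := by
    have h1 : fderiv ℝ φ x = 0 := by
      by_contra h
      exact hx (hφ.2.2 (support_fderiv_subset ℝ h))
    simp [h1]
  have hf : Continuous fun x => fderiv ℝ φ x v :=
    (hφ.1.continuous_fderiv (by simp)).clm_apply continuous_const
  have := integral_mul_fderiv_eq_neg_fderiv_mul_of_integrable (μ := μ) (f := fun _ : E => c) (g := φ)
    (v := v) (by simp)
    ((hf.integrable_of_hasCompactSupport (hφ.2.1.fderiv_apply ℝ v)).const_mul c)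
    ((hφ.1.continuous.integrable_of_hasCompactSupport hφ.2.1).const_mul c) (by simp)
    fun x _ => hφ.1.differentiable (by simp) x
  rw [setIntegral_eq_integral_of_forall_compl_eq_zero h0, this]
  simp

theorem exists_subseq_isWeakGradientOn [CompleteSpace F] (hQo : IsOpen Q) (hQ : μ Q ≠ ⊤)
    {c₀ c₁ : ℝ} (hc₀ : 0 < c₀) (hc : c₀ < c₁)
    {q : ℕ → E → ℝ} (hqm : ∀ n, Measurable (q n)) (hq : ∀ n x, c₀ ≤ q n x ∧ q n x ≤ c₁)
    {G : ℕ → Lp F 2 (μ.restrict Q)} (hG : ∀ n, IsWeakGradientOn μ Q A (q n) (G n)) {R : ℝ}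
    (hR : ∀ n, ‖G n‖ ≤ R) :
    ∃ (φ : ℕ → ℕ) (p : E → ℝ) (H : Lp F 2 (μ.restrict Q)), StrictMono φ ∧ Measurable p ∧
      (∀ x, c₀ ≤ p x ∧ p x ≤ c₁) ∧ IsWeakGradientOn μ Q A p H ∧
      (∀ w, Filter.Tendsto (fun n => ⟪G (φ n), w⟫_ℝ) Filter.atTop (nhds ⟪H, w⟫_ℝ)) ∧
      ∀ᵐ x ∂μ.restrict Q, Filter.Tendsto (fun n => q (φ n) x) Filter.atTop (nhds (p x)) := by
  have : IsFiniteMeasure (μ.restrict Q) := isFiniteMeasure_restrict.mpr hQ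
  have habs {a : ℝ} (ha : c₀ ≤ a ∧ a ≤ c₁) : |a| ≤ c₁ := by
    rw [abs_of_nonneg (hc₀.le.trans ha.1)]
    exact ha.2
  have hqL (n : ℕ) : MemLp (q n) 2 (μ.restrict Q) :=
    MemLp.of_bound (hqm n).aestronglyMeasurable c₁ (.of_forall fun x => habs (hq n x))
  have hnorm (n : ℕ) := Lp.norm_le_of_ae_bound (f := (hqL n).toLp (q n)) (hc₀.le.trans hc.le)
    ((hqL n).coeFn_toLp.mono fun x hx => by rw [hx]; exact habs (hq n x))
  obtain ⟨y, φ₁, hφ₁, hy⟩ := exists_subseq_tendsto_inner _ hnorm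
  obtain ⟨H, φ₂, hφ₂, hH⟩ := exists_subseq_tendsto_inner (fun n => G (φ₁ n)) fun n => hR _
  have hy₂ := fun w => (hy w).comp hφ₂.tendsto_atTop
  have hyb := ae_mem_Icc_of_tendsto_inner (a := c₀) (b := c₁) (fun n => by
    filter_upwards [(hqL (φ₁ (φ₂ n))).coeFn_toLp] with x hx
    rw [hx]
    exact hq _ x) hy₂
  -- Truncation turns the almost everywhere bounds on the weak limit into bounds at every point.
  set p : E → ℝ := fun x => max c₀ (min c₁ (y x)) with hp
  have hpm : Measurable p :=
    measurable_const.max (measurable_const.min (Lp.stronglyMeasurable y).measurable)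
  have hpb (x : E) : c₀ ≤ p x ∧ p x ≤ c₁ :=
    ⟨le_max_left _ _, max_le hc.le (min_le_left _ _)⟩
  have hyp : y =ᵐ[μ.restrict Q] p := by
    filter_upwards [hyb] with x hx
    rw [hp]
    simp only
    rw [min_eq_right hx.2, max_eq_right hx.1]
  have hpH : IsWeakGradientOn μ Q A p H :=
    (IsWeakGradientOn.of_tendsto_inner hQ
      (fun n => (hG (φ₁ (φ₂ n))).congr (hqL _).coeFn_toLp.symm) hy₂ hH).congr hyp
  obtain ⟨φ₃, hφ₃, hae⟩ := exists_subseq_ae_tendsto_of_isWeakGradientOn (c := c₁) hQo hQ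
    (fun n => hqm (φ₁ (φ₂ n))) hpm (fun n x => habs (hq _ x)) (fun x => habs (hpb x))
    (fun n => hG (φ₁ (φ₂ n))) hpH (fun n => hR _) fun s hs => by
      have h1 := hy₂ (indicatorConstLp 2 hs (measure_ne_top _ s) (1 : ℝ))
      have h2 (w : Lp ℝ 2 (μ.restrict Q)) :
          ⟪w, indicatorConstLp 2 hs (measure_ne_top _ s) (1 : ℝ)⟫_ℝ =
            ∫ x in s, w x ∂μ.restrict Q := by
        rw [real_inner_comm, L2.inner_indicatorConstLp_one]
      simp only [Function.comp_def, h2] at h1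
      rw [integral_congr_ae (ae_restrict_of_ae hyp)] at h1
      refine h1.congr fun n => integral_congr_ae (ae_restrict_of_ae (hqL _).coeFn_toLp)
  exact ⟨fun n => φ₁ (φ₂ (φ₃ n)), p, H, hφ₁.comp (hφ₂.comp hφ₃), hpm, hpb, hpH,
    fun w => (hH w).comp hφ₃.tendsto_atTop, hae⟩

end Compactness

/-! ### The direct method -/

section DirectMethod

open scoped InnerProductSpace

variable {P X Y Z : Type*} [NormedAddCommGroup X] [InnerProductSpace ℝ X]
  [NormedAddCommGroup Y] [InnerProductSpace ℝ Y] [NormedAddCommGroup Z]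
  [InnerProductSpace ℝ Z]

/-- The squared norm lies above its tangent at `y`, an affine function that is weakly continuous in
`x`; this gives lower semicontinuity. -/
theorem two_mul_inner_sub_norm_sq_le (x y : X) : 2 * ⟪x, y⟫_ℝ - ‖y‖ ^ 2 ≤ ‖x‖ ^ 2 := by
  have := norm_sub_sq_real x y
  nlinarith [sq_nonneg ‖x - y‖]

/-- The gradient is a second variable tied to the coefficient by `W`, so its uniqueness plays no
role. `hcpt` is only asked for along sequences whose states already converge weakly, which `hU` can
always arrange. -/
theorem exists_minimizer [CompleteSpace X] [CompleteSpace Y] (L : X →L[ℝ] Y) (z : Y) (U : P → X) (S : Set P) (W : P → Z → Prop) {γ : ℝ}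
    (hγ : 0 < γ) {R : ℝ} (hU : ∀ q ∈ S, ‖U q‖ ≤ R) (hS : ∃ q ∈ S, ∃ G, W q G)
    (hcpt : ∀ (q : ℕ → P) (G : ℕ → Z), (∀ n, q n ∈ S) → (∀ n, W (q n) (G n)) →
      ∀ B : ℝ, (∀ n, ‖G n‖ ≤ B) → ∀ u,
      (∀ w, Filter.Tendsto (fun n => ⟪U (q n), w⟫_ℝ) Filter.atTop (nhds ⟪u, w⟫_ℝ)) →
      ∃ (φ : ℕ → ℕ) (p : P) (H : Z), StrictMono φ ∧ p ∈ S ∧ W p H ∧ u = U p ∧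
        ∀ w, Filter.Tendsto (fun n => ⟪G (φ n), w⟫_ℝ) Filter.atTop (nhds ⟪H, w⟫_ℝ)) :
    ∃ p ∈ S, ∃ H, W p H ∧ ∀ q ∈ S, ∀ G, W q G →
      1 / 2 * ‖L (U p) - z‖ ^ 2 + γ / 2 * ‖H‖ ^ 2 ≤
        1 / 2 * ‖L (U q) - z‖ ^ 2 + γ / 2 * ‖G‖ ^ 2 := by
  set J : P → Z → ℝ := fun q G => 1 / 2 * ‖L (U q) - z‖ ^ 2 + γ / 2 * ‖G‖ ^ 2 with hJ
  set V : Set ℝ := {a | ∃ q ∈ S, ∃ G, W q G ∧ a = J q G}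
  have hbdd : BddBelow V := by
    refine ⟨0, ?_⟩
    rintro _ ⟨q, -, G, -, rfl⟩
    positivity
  obtain ⟨q₀, hq₀, G₀, hG₀⟩ := hS
  have hne : V.Nonempty := ⟨_, q₀, hq₀, G₀, hG₀, rfl⟩
  obtain ⟨a, ha, hlim, hmem⟩ := exists_seq_tendsto_sInf hne hbdd
  choose q hq G hG haJ using hmem
  -- The values `a` decrease, so `a 0` bounds every gradient term.
  have hle (n : ℕ) : ‖G n‖ ≤ Real.sqrt (2 / γ * a 0) := by
    refine Real.le_sqrt_of_sq_le ?_
    have h1 : γ / 2 * ‖G n‖ ^ 2 ≤ a 0 := by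
      refine le_trans ?_ (ha (Nat.zero_le n))
      rw [haJ n]
      exact le_add_of_nonneg_left (by positivity)
    calc ‖G n‖ ^ 2 = 2 / γ * (γ / 2 * ‖G n‖ ^ 2) := by field_simp
      _ ≤ 2 / γ * a 0 := by gcongr
  obtain ⟨u, φ, hφ, hu⟩ := exists_subseq_tendsto_inner (fun n => U (q n)) fun n => hU _ (hq n)
  obtain ⟨ψ, p, H, hψ, hp, hH, rfl, hw⟩ := hcpt (fun n => q (φ n)) (fun n => G (φ n))
    (fun n => hq _) (fun n => hG _) _ (fun n => hle _) u hu
  refine ⟨p, hp, H, hH, fun q' hq' G' hG' => le_trans ?_ (csInf_le hbdd ⟨q', hq', G', hG', rfl⟩)⟩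
  set y := L (U p) - z
  have h1 : Filter.Tendsto (fun n => ⟪L (U (q (φ (ψ n)))) - z, y⟫_ℝ) Filter.atTop
      (nhds ⟪y, y⟫_ℝ) := by
    have h2 := ((hu (L.adjoint y)).comp hψ.tendsto_atTop).sub_const ⟪z, y⟫_ℝ
    simp only [ContinuousLinearMap.adjoint_inner_right, Function.comp_def, ← inner_sub_left] at h2
    exact h2
  have h3 := (((h1.const_mul 2).sub_const (‖y‖ ^ 2)).const_mul (1 / 2)).add
    ((((hw H).const_mul 2).sub_const (‖H‖ ^ 2)).const_mul (γ / 2))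
  have h4 := le_of_tendsto_of_tendsto' h3 ((hlim.comp hφ.tendsto_atTop).comp hψ.tendsto_atTop)
    fun n => by
      simp only [Function.comp_apply]
      rw [haJ]
      have h5 := two_mul_inner_sub_norm_sq_le (L (U (q (φ (ψ n)))) - z) y
      have h6 := two_mul_inner_sub_norm_sq_le (G (φ (ψ n))) H
      exact add_le_add (mul_le_mul_of_nonneg_left h5 (by norm_num))
        (mul_le_mul_of_nonneg_left h6 (half_pos hγ).le)
  rw [real_inner_self_eq_norm_sq, real_inner_self_eq_norm_sq] at h4
  linarith

end DirectMethod

/-! ### The concrete functional and admissible set -/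

section Identification

open scoped InnerProductSpace

variable {d : ℕ} {Ω : Set (Space d)} {T α c₀ c₁ : ℝ}

instance : (volume : Measure (Space d × ℝ)).IsAddHaarMeasure :=
  Measure.prod.instIsAddHaarMeasure volume volume

theorem hasWeakGradient_iff {q : LInfty Ω T}
    {G : Lp (WithLp 2 (Space d × ℝ)) 2 (volume.restrict (cylinder Ω T))} :
    HasWeakGradient Ω T q G ↔ IsWeakGradientOn volume (cylinder Ω T)
      ((WithLp.prodContinuousLinearEquiv 2 ℝ (Space d) ℝ).symm : Space d × ℝ →L[ℝ] _) q G :=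
  Iff.rfl

theorem isOpen_cylinder (hΩ : IsOpen Ω) : IsOpen (cylinder Ω T) := hΩ.prod isOpen_Ioo

theorem volume_cylinder_ne_top (hΩ : Bornology.IsBounded Ω) : volume (cylinder Ω T) ≠ ⊤ :=
  (hΩ.prod (Metric.isBounded_Ioo 0 T)).measure_lt_top.ne

theorem exists_toLp_mem_admissibleSet {p : Space d × ℝ → ℝ} (hp : Measurable p) (hc₀ : 0 < c₀)
    (hb : ∀ x, c₀ ≤ p x ∧ p x ≤ c₁) :
    ∃ q ∈ admissibleSet Ω T c₀ c₁, q =ᵐ[volume.restrict (cylinder Ω T)] p := by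
  have hm : MemLp p ⊤ (volume.restrict (cylinder Ω T)) :=
    memLp_top_of_bound hp.aestronglyMeasurable c₁ (.of_forall fun x => by
      rw [Real.norm_of_nonneg (hc₀.le.trans (hb x).1)]
      exact (hb x).2)
  refine ⟨hm.toLp p, ?_, hm.coeFn_toLp⟩
  filter_upwards [hm.coeFn_toLp] with x hx
  rw [hx]
  exact hb x

/-- A constant coefficient has zero gradient, so the infimum is not over an empty set. -/
theorem exists_hasWeakGradient (hc₀ : 0 < c₀) (hc₁ : c₀ < c₁) :
    ∃ q ∈ admissibleSet Ω T c₀ c₁, ∃ G, HasWeakGradient Ω T q G := by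
  obtain ⟨q, hq, hqc⟩ := exists_toLp_mem_admissibleSet (Ω := Ω) (T := T) (p := fun _ => c₀)
    measurable_const hc₀ fun _ => ⟨le_rfl, hc₁.le⟩
  refine ⟨q, hq, 0, hasWeakGradient_iff.mpr ?_⟩
  intro φ hφ v
  have h := (isWeakGradientOn_const (μ := volume) (Q := cylinder Ω T)
    (A := ((WithLp.prodContinuousLinearEquiv 2 ℝ (Space d) ℝ).symm :
      Space d × ℝ →L[ℝ] WithLp 2 (Space d × ℝ))) c₀).congr hqc.symm φ hφ v
  rw [h]
  congr 1
  refine integral_congr_ae ?_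
  filter_upwards [Lp.coeFn_zero (WithLp 2 (Space d × ℝ)) 2 (volume.restrict (cylinder Ω T))]
    with x hx
  rw [hx, Pi.zero_apply]

theorem exists_subseq_hasWeakGradient (hΩo : IsOpen Ω) (hΩ : Bornology.IsBounded Ω) (hc₀ : 0 < c₀)
    (hc₁ : c₀ < c₁) {q : ℕ → LInfty Ω T} (hq : ∀ n, q n ∈ admissibleSet Ω T c₀ c₁)
    {G : ℕ → Lp (WithLp 2 (Space d × ℝ)) 2 (volume.restrict (cylinder Ω T))}
    (hG : ∀ n, HasWeakGradient Ω T (q n) (G n)) {R : ℝ} (hR : ∀ n, ‖G n‖ ≤ R) :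
    ∃ (φ : ℕ → ℕ) (p : LInfty Ω T)
      (H : Lp (WithLp 2 (Space d × ℝ)) 2 (volume.restrict (cylinder Ω T))),
      StrictMono φ ∧ p ∈ admissibleSet Ω T c₀ c₁ ∧ HasWeakGradient Ω T p H ∧
      (∀ w, Filter.Tendsto (fun n => ⟪G (φ n), w⟫_ℝ) Filter.atTop (nhds ⟪H, w⟫_ℝ)) ∧
      ∀ᵐ x ∂volume.restrict (cylinder Ω T),
        Filter.Tendsto (fun n => q (φ n) x) Filter.atTop (nhds (p x)) := by
  have hqc (n : ℕ) := ae_eq_clip (hq n)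
  obtain ⟨φ, p, H, hφ, hpm, hpb, hpH, hw, hae⟩ := exists_subseq_isWeakGradientOn
    (isOpen_cylinder (T := T) hΩo) (volume_cylinder_ne_top hΩ) hc₀ hc₁
    (fun n => measurable_clip (c₀ := c₀) (c₁ := c₁) (q n))
    (fun n x => ⟨le_clip (q n) x, (le_abs_self _).trans (abs_clip_le hc₀ hc₁ (q n) x)⟩)
    (fun n => (hasWeakGradient_iff.mp (hG n)).congr (hqc n)) hR
  obtain ⟨p', hp', hpp'⟩ := exists_toLp_mem_admissibleSet (Ω := Ω) (T := T) hpm hc₀ hpb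
  refine ⟨φ, p', H, hφ, hp', hasWeakGradient_iff.mpr (hpH.congr hpp'.symm), hw, ?_⟩
  filter_upwards [hae, hpp', ae_all_iff.mpr hqc] with x h1 h2 h3
  rw [h2]
  exact h1.congr fun n => (h3 (φ n)).symm

/-- Sum and positive factor move inside the infimum. Positivity of `γ` preserves the value `∞`, the
empty infimum, when there is no weak gradient. -/
theorem objective_eq_iInf {γ : ℝ} (hγ : 0 < γ) (z : L2Time T (L2 Ω)) (u : L2Time T (H10 Ω))
    (q : LInfty Ω T) :
    objective Ω T γ z u q = ⨅ (G) (_ : HasWeakGradient Ω T q G),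
      ENNReal.ofReal (1 / 2 * ‖(toL2 Ω).compLpL 2 _ u - z‖ ^ 2 + γ / 2 * ‖G‖ ^ 2) := by
  have h0 : ENNReal.ofReal (γ / 2) ≠ 0 := (ENNReal.ofReal_pos.mpr (half_pos hγ)).ne'
  rw [objective, h1SeminormSq, ENNReal.mul_iInf_of_ne h0 ENNReal.ofReal_ne_top, ENNReal.add_iInf]
  congr 1
  ext G
  rw [ENNReal.mul_iInf_of_ne h0 ENNReal.ofReal_ne_top, ENNReal.add_iInf]
  congr 1
  ext hG
  rw [ENNReal.ofReal_add (by positivity) (by positivity), ENNReal.ofReal_mul (half_pos hγ).le]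
  rfl

end Identification

end Subdiffusion

end

theorem mainTheorem8 (d : ℕ) (hd₁ : 1 ≤ d) (hd₃ : d ≤ 3)
    (Ω : Set (Subdiffusion.Space d)) (hΩ : Subdiffusion.IsConvexPolyhedralDomain Ω)
    (T : ℝ) (hT : 0 < T) (α : ℝ) (hα₀ : 0 < α) (hα₁ : α < 1)
    (c₀ c₁ : ℝ) (hc₀ : 0 < c₀) (hc₁ : c₀ < c₁) (γ : ℝ) (hγ : 0 < γ)
    (u₀ : Subdiffusion.L2 Ω) (f : Subdiffusion.L2Time T (Subdiffusion.Hm1 Ω))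
    (z : Subdiffusion.L2Time T (Subdiffusion.L2 Ω)) :
    ∃ U : Subdiffusion.LInfty Ω T → Subdiffusion.L2Time T (Subdiffusion.H10 Ω),
      (∀ q ∈ Subdiffusion.admissibleSet Ω T c₀ c₁, ∀ u : Subdiffusion.L2Time T (Subdiffusion.H10 Ω),
        Subdiffusion.IsWeakSolution Ω T α u₀ f q u ↔ u = U q) ∧
      ∃ q ∈ Subdiffusion.admissibleSet Ω T c₀ c₁,
        Subdiffusion.objective Ω T γ z (U q) q < ⊤ ∧
        IsMinOn (fun p => Subdiffusion.objective Ω T γ z (U p) p)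
          (Subdiffusion.admissibleSet Ω T c₀ c₁) q := by
  obtain ⟨R, hR⟩ := Subdiffusion.exists_isWeakSolution (T := T) hd₁ hΩ.isBounded hα₀ hα₁ hc₀ hc₁ u₀ f
  -- `U q` is unspecified when `q` is not admissible; only admissible coefficients are ever
  -- compared.
  choose! U hUR hU using hR
  refine ⟨U, hU, ?_⟩
  obtain ⟨p, hp, H, hpH, hmin⟩ := Subdiffusion.exists_minimizer
    ((Subdiffusion.toL2 Ω).compLpL 2 (MeasureTheory.volume.restrict (Set.Ioo 0 T))) z U
    (Subdiffusion.admissibleSet Ω T c₀ c₁) (Subdiffusion.HasWeakGradient Ω T) hγ hUR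
    (Subdiffusion.exists_hasWeakGradient hc₀ hc₁) fun q G hq hG B hB u hu => by
      obtain ⟨φ, p, H, hφ, hp, hpH, hw, hae⟩ :=
        Subdiffusion.exists_subseq_hasWeakGradient hΩ.isOpen hΩ.isBounded hc₀ hc₁ hq hG hB
      -- The weak limit of the states solves the problem with the limit coefficient, so uniqueness
      -- identifies it with `U p`.
      exact ⟨φ, p, H, hφ, hp, hpH, (hU p hp u).mp (Subdiffusion.isWeakSolution_of_tendsto hα₀ hα₁
        hc₀ hc₁ (fun n => hq (φ n)) hp hae (fun n => hUR _ (hq (φ n)))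
        (fun w => (hu w).comp hφ.tendsto_atTop) fun n => (hU _ (hq (φ n)) _).mpr rfl), hw⟩
  refine ⟨p, hp, ?_, fun q hq => ?_⟩
  · rw [Subdiffusion.objective_eq_iInf hγ]
    exact (iInf₂_le H hpH).trans_lt ENNReal.ofReal_lt_top
  · simp only [Set.mem_ofPred_eq, Subdiffusion.objective_eq_iInf hγ]
    exact le_iInf₂ fun G hG =>
      (iInf₂_le H hpH).trans (ENNReal.ofReal_le_ofReal (hmin q hq G hG))
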